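/- Let $0<\alpha<1$, $\lambda\ge 0$, $\kappa_\alpha>0$, $L,T>0$, $\Omega=(0,L)$ and let $k\ge 0$ be an integer. Let $u(x,t)$, $L$-periodic in $x$, be the exact solution of $${}_0^CD_t^{\alpha,\lambda}u(x,t)=\kappa_\alpha u_{xx}(x,t)+f(x,t)\quad (0<t\le T),\qquad u(x,0)=u_0(x),\qquad u(x+L,t)=u(x,t),$$ where $f$ is a given force term ($f=0$ is allowed) and $${}_0^CD_t^{\alpha,\lambda}v(t)=\frac{e^{-\lambda t}}{\Gamma(1-\alpha)}\int_0^t (t-s)^{-\alpha}\,\frac{d}{ds}\big(e^{\lambda s}v(s)\big)\,ds .$$ Assume that $u$ is sufficiently smooth, namely $u\in C^2([0,T];H^{k+2}_{\rm per}(\Omega))$. For a mesh $0=x_{1/2}<x_{3/2}<\dots<x_{N+1/2}=L$ with cells $I_j=(x_{j-1/2},x_{j+1/2})$ and $h=\max_j (x_{j+1/2}-x_{j-1/2})$, let $V_h$ be the space of functions whose restriction to each $I_j$ is a polynomial of degree at most $k$. For $q\in V_h$ let $q^-_{j+1/2}$ and $q^+_{j+1/2}$ be its values at $x_{j+1/2}$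 from $I_j$ and from $I_{j+1}$, where the cells are continued periodically. Let $M\ge 1$, $\tau=T/M$, $t_n=n\tau$, and let $w_0=1$, $w_i=\big(1-\frac{\alpha+1}{i}\big)w_{i-1}$ be the first-order Grünwald–Lubich weights. Let $u_h^0\in V_h$ be the $L^2(\Omega)$ projection of $u_0$, and let $u_h^n,p_h^n\in V_h$, $n=1,\dots,M$, satisfy for all $v,w\in V_h$ the fully discrete local discontinuous Galerkin scheme $$(p_h^n,w)_\Omega+(u_h^n,w_x)_\Omega-\sum_{j=1}^N\big[(\widehat u_h^n w^-)_{j+1/2}-(\widehat u_h^n w^+)_{j-1/2}\big]=0,$$ $$w_0(u_h^n,v)_\Omega+\kappa_\alpha\tau^\alpha\Big((p_h^n,v_x)_\Omega-\sum_{j=1}^N\big[(\widehat p_h^n v^-)_{j+1/2}-(\widehat p_h^n v^+)_{j-1/2}\big]\Big) = e^{-\lambda n\tau}\sum_{i=0}^{n-1}w_i\,(u_h^0,v)_\Omega-\sum_{i=1}^{n-1}e^{-\lambda i\tau}w_i\,(u_h^{n-i},v)_\Omega+\tau^\alpha (f(\cdot,t_n),v)_\Omega,$$ with the fluxes $\widehat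 u_h^n=(u_h^n)^-$ and $\widehat p_h^n=(p_h^n)^+$, where $v_x,w_x$ are taken cell by cell. Then there is a constant $C>0$, depending on $u$, $T$, $\alpha$ and the fixed data $\lambda,\kappa_\alpha,L,k$, but not on $\tau$, $h$, the mesh, $M$ or $n$, such that $$\|u(\cdot,t_n)-u_h^n\|_{L^2(\Omega)}\le C(\tau+h^{k+1}),\qquad n=1,\dots,M.$$ -/

import Mathlib

open scoped ContDiff Polynomial

namespace TemperedLDG

noncomputable section

/-! ## The continuous problem -/

/-- The Caputo tempered fractional derivative of order `α ∈ (0,1)` with tempering parameter `lam`,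
`e^{-λt} / Γ(1-α) ∫_0^t (t-s)^{-α} d/ds (e^{λs} v(s)) ds`. -/
def caputoTempered (α lam : ℝ) (v : ℝ → ℝ) (t : ℝ) : ℝ :=
  Real.exp (-lam * t) / Real.Gamma (1 - α) *
    ∫ s in (0 : ℝ)..t, (t - s) ^ (-α) * deriv (fun r => Real.exp (lam * r) * v r) s

/-- Lebesgue measure on the space domain `Ω = (0, L)` (the end point `L` is a null set). -/
abbrev domainMeasure (L : ℝ) : MeasureTheory.Measure ℝ :=
  MeasureTheory.volume.restrict (Set.Ioc 0 L)

/-- `g` is the `j`-th weak derivative of the `L`-periodic function `w` (both are used on one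
period only): integration by parts against every smooth `L`-periodic test function. -/
def IsPeriodicWeakDeriv (L : ℝ) (j : ℕ) (w g : ℝ → ℝ) : Prop :=
  MeasureTheory.Integrable w (domainMeasure L) ∧
  MeasureTheory.Integrable g (domainMeasure L) ∧
  ∀ φ : ℝ → ℝ, ContDiff ℝ ∞ φ → (∀ x, φ (x + L) = φ x) →
    ∫ x in (0 : ℝ)..L, w x * iteratedDeriv j φ x
      = (-1) ^ j * ∫ x in (0 : ℝ)..L, g x * φ x

/-- `u ∈ C^r([0,T]; H^m_per(0,L))`. As the norm of `H^m` is the sum of the `L²` norms of the weak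
derivatives of order at most `m`, this says that each of these weak derivatives is a `C^r` curve
in `L²(0,L)`. -/
def TimeSobolevRegular (L T : ℝ) (r m : ℕ) (u : ℝ → ℝ → ℝ) : Prop :=
  ∃ U : ℕ → ℝ → MeasureTheory.Lp ℝ 2 (domainMeasure L),
    ∀ j ≤ m, ContDiffOn ℝ r (U j) (Set.Icc 0 T) ∧
      ∀ t ∈ Set.Icc 0 T, IsPeriodicWeakDeriv L j (fun x => u x t) (U j t)

/-- `u` solves `ᶜD_t^{α,λ} u = κ u_xx + f` for `0 < t ≤ T` (almost everywhere in `x`), with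
`u(·,0) = u₀` and `u(x,t) = u(x+L,t)`. Functions of `(x,t)` are written `u x t`; `u(·,t)` is
the continuous representative, and `u_xx` is the weak second derivative. -/
structure IsExactSolution (α lam κ L T : ℝ) (f : ℝ → ℝ → ℝ) (u₀ : ℝ → ℝ)
    (u : ℝ → ℝ → ℝ) : Prop where
  continuous : ∀ t ∈ Set.Icc 0 T, Continuous fun x => u x t
  periodic : ∀ t ∈ Set.Icc 0 T, ∀ x, u (x + L) t = u x t
  initial : ∀ x ∈ Set.Ioo 0 L, u x 0 = u₀ x
  equation : ∀ t ∈ Set.Ioc 0 T, ∃ uxx : ℝ → ℝ,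
    IsPeriodicWeakDeriv L 2 (fun x => u x t) uxx ∧
    ∀ᵐ x ∂(domainMeasure L), caputoTempered α lam (u x) t = κ * uxx x + f x t

/-! ## Meshes and the discontinuous finite element space -/

/-- A partition `0 = x_{1/2} < x_{3/2} < ⋯ < x_{N+1/2} = L` into `N` cells. -/
structure Mesh (L : ℝ) (N : ℕ) where
  node : Fin (N + 1) → ℝ
  strictMono : StrictMono node
  first : node 0 = 0
  last : node (Fin.last N) = L

namespace Mesh

variable {L : ℝ} {N : ℕ}

/-- Left end point of the cell `I_j`. -/
def left (𝒯 : Mesh L N) (j : Fin N) : ℝ := 𝒯.node j.castSucc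

/-- Right end point of the cell `I_j`. -/
def right (𝒯 : Mesh L N) (j : Fin N) : ℝ := 𝒯.node j.succ

/-- The mesh size `h = max_j h_j`. -/
def size (𝒯 : Mesh L N) : ℝ := ⨆ j : Fin N, (𝒯.right j - 𝒯.left j)

/-- The `L²(Ω)` inner product of two functions given cell by cell. -/
def innerProd (𝒯 : Mesh L N) (v w : Fin N → ℝ → ℝ) : ℝ :=
  ∑ j, ∫ x in (𝒯.left j)..(𝒯.right j), v j x * w j x

/-- The `L²(Ω)` norm. -/
def l2norm (𝒯 : Mesh L N) (v : Fin N → ℝ → ℝ) : ℝ := Real.sqrt (𝒯.innerProd v v)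

end Mesh

/-- The space `V_h` of piecewise polynomials of degree at most `k`; an element is given by its
polynomial on each of the `N` cells. -/
def dgSpace (N k : ℕ) : Set (Fin N → ℝ[X]) := {v | ∀ j, (v j).natDegree ≤ k}

/-- The function on each cell defined by a piecewise polynomial. -/
def cellFun {N : ℕ} (v : Fin N → ℝ[X]) : Fin N → ℝ → ℝ := fun j x => (v j).eval x

/-- The function on each cell of the piecewise derivative `v_x`. -/
def cellDeriv {N : ℕ} (v : Fin N → ℝ[X]) : Fin N → ℝ → ℝ :=
  fun j x => (Polynomial.derivative (v j)).eval x

/-- `(q, w_x)_Ω - ∑_j [(q̂ w⁻)_{j+1/2} - (q̂ w⁺)_{j-1/2}]`, where `qR j` and `qL j` are the values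
of the numerical flux `q̂` at the right and at the left end point of the cell `I_j`. -/
def dgForm {L : ℝ} {N : ℕ} (𝒯 : Mesh L N) (q : Fin N → ℝ[X]) (qL qR : Fin N → ℝ)
    (w : Fin N → ℝ[X]) : ℝ :=
  𝒯.innerProd (cellFun q) (cellDeriv w)
    - ∑ j, (qR j * (w j).eval (𝒯.right j) - qL j * (w j).eval (𝒯.left j))

/-- `dgForm` with the flux `û = u⁻`, the value from the left cell; by periodicity the cell to the
left of the first cell is the last one. -/
def formMinus {L : ℝ} {N : ℕ} (𝒯 : Mesh L N) (u w : Fin N → ℝ[X]) : ℝ :=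
  dgForm 𝒯 u
    (fun j => (u ((finRotate N).symm j)).eval (𝒯.right ((finRotate N).symm j)))
    (fun j => (u j).eval (𝒯.right j)) w

/-- `dgForm` with the flux `p̂ = p⁺`, the value from the right cell; by periodicity the cell to the
right of the last cell is the first one. -/
def formPlus {L : ℝ} {N : ℕ} (𝒯 : Mesh L N) (p v : Fin N → ℝ[X]) : ℝ :=
  dgForm 𝒯 p
    (fun j => (p j).eval (𝒯.left j))
    (fun j => (p (finRotate N j)).eval (𝒯.left (finRotate N j))) v

/-! ## The fully discrete scheme -/

/-- The first-order Grünwald–Lubich weights `w_i = (-1)^i (α choose i)`, by their recursion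
`w_0 = 1`, `w_i = (1 - (α+1)/i) w_{i-1}`. -/
def glWeight (α : ℝ) : ℕ → ℝ
  | 0 => 1
  | i + 1 => (1 - (α + 1) / ((i : ℝ) + 1)) * glWeight α i

/-- `(u_h^n, p_h^n)`, `n = 0, …, M`, solves the fully discrete LDG scheme with step `τ = T / M`,
times `t_n = n τ`, first-order weights and `u_h^0` the `L²` projection of `u₀` onto `V_h`. -/
structure IsLDGSolution (α lam κ T : ℝ) {L : ℝ} (f : ℝ → ℝ → ℝ) (u₀ : ℝ → ℝ)
    (k : ℕ) {N : ℕ} (𝒯 : Mesh L N) (M : ℕ) (uh ph : ℕ → Fin N → ℝ[X]) : Prop where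
  mem_u : ∀ n ≤ M, uh n ∈ dgSpace N k
  mem_p : ∀ n, 1 ≤ n → n ≤ M → ph n ∈ dgSpace N k
  initial : ∀ v ∈ dgSpace N k,
    𝒯.innerProd (cellFun (uh 0)) (cellFun v) = 𝒯.innerProd (fun _ => u₀) (cellFun v)
  flux_eq : ∀ n, 1 ≤ n → n ≤ M → ∀ w ∈ dgSpace N k,
    𝒯.innerProd (cellFun (ph n)) (cellFun w) + formMinus 𝒯 (uh n) w = 0
  evolution_eq : ∀ n, 1 ≤ n → n ≤ M → ∀ v ∈ dgSpace N k,
    glWeight α 0 * 𝒯.innerProd (cellFun (uh n)) (cellFun v)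
        + κ * (T / M) ^ α * formPlus 𝒯 (ph n) v
      = Real.exp (-lam * (n * (T / M))) * (∑ i ∈ Finset.range n, glWeight α i)
            * 𝒯.innerProd (cellFun (uh 0)) (cellFun v)
          - ∑ i ∈ Finset.Ico 1 n, Real.exp (-lam * (i * (T / M))) * glWeight α i
              * 𝒯.innerProd (cellFun (uh (n - i))) (cellFun v)
          + (T / M) ^ α * 𝒯.innerProd (fun _ x => f x (n * (T / M))) (cellFun v)

end

end TemperedLDG

namespace TemperedLDG

/-! Multiplication by `e^{λt}` removes the tempering: the derivative becomes the Caputo derivative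
of `φ = e^{λt} u`, and the scheme becomes a plain Grünwald–Lubich convolution with weights `w_i`.
All errors below carry this weight, which is at least `1`, so it is dropped at the end for free.

Time. Let `g_j = w_0 + ⋯ + w_j` (`glSum`). Then `0 < g_j ≤ 1`, `w_i ≤ 0` for `i ≥ 1`, and `g_n ≥
(n+1)^{-α} / Γ(1-α)`. Summation by parts turns the convolution into a quadrature with weights `g_j`
on the increments of `φ`. By Gautschi's inequality its weights differ from those of product
integration by a sequence with partial sums `O(m^{-α})`, so the truncation error is `O(τ t_n^{-α})`
(`abs_fractional_sub_glSum_le`). The singular factor is harmless: times `τ^α` the error is `O(τ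
g_n)`, and the stability lemma `norm_le_of_glWeight` needs right-hand sides only of size `g_n` to
bound the error uniformly in `n`, without a Gronwall argument.

Space. `u` and `u_x` are compared with Gauss–Radau projections exact at the right and at the left
end points of the cells. The discrete derivatives see no projection error there
(`formMinus_radauRight`, `formPlus_radauLeft`). The alternating fluxes make the two discrete
derivatives negative adjoints (`formPlus_add_formMinus`), so testing the error equation with the
error itself produces the square of the flux error, which absorbs the projection error of `u_x`
(`energy_inequality`). What remains is `O(h^{k+1})` in the projection errors. Their convolution is
again `O(g_n h^{k+1})` by summation by parts, and the flux part carries `τ^α ≤ Γ(1-α) T^α g_n`. The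
initial datum enters the scheme only tested against `V_h`, where its `L²` projection is exact.

Regularity. The hypothesis concerns `L²`-valued curves of weak derivatives. Du Bois-Reymond's lemma
makes these a chain of primitives (`exists_primitive_chain`), and point evaluation as a bounded
functional of a function and its derivative gives pointwise time derivatives with bounds uniform in
`x` (`exists_regularSolution`). -/

open Finset in
/-- Partial sums of the Grünwald–Lubich weights. -/
noncomputable def glSum (α : ℝ) (j : ℕ) : ℝ := ∑ i ∈ range (j + 1), glWeight α i

/-! ### Grünwald–Lubich weights and the size of their partial sums. -/

section Weights

open Finset

theorem glSum_zero (α : ℝ) : glSum α 0 = 1 := by simp [glSum, glWeight]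

theorem glSum_succ_eq_add (α : ℝ) (j : ℕ) : glSum α (j + 1) = glSum α j + glWeight α (j + 1) := by
  rw [glSum, sum_range_succ, ← glSum]

/-- Weights and partial sums are the Taylor coefficients of `(1-x)^α` and `(1-x)^{α-1}`, and the
former is the antiderivative of the latter times `-α`. The signs of both sequences follow from this.
-/
theorem glWeight_succ (α : ℝ) (j : ℕ) :
    glWeight α (j + 1) = -(α / ((j : ℝ) + 1)) * glSum α j := by
  induction j with
  | zero => simp [glWeight, glSum_zero]
  | succ j ih =>
    have h : glWeight α (j + 1 + 1) = (1 - (α + 1) / (((j + 1 : ℕ) : ℝ) + 1)) * glWeight α (j + 1) :=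
      rfl
    rw [glSum_succ_eq_add, h, ih]
    push_cast
    have h1 : (j : ℝ) + 1 ≠ 0 := by positivity
    have h2 : (j : ℝ) + 1 + 1 ≠ 0 := by positivity
    field_simp
    ring

theorem glSum_succ (α : ℝ) (j : ℕ) :
    glSum α (j + 1) = (1 - α / ((j : ℝ) + 1)) * glSum α j := by
  rw [glSum_succ_eq_add, glWeight_succ]; ring

theorem glSum_pos {α : ℝ} (hα' : α < 1) (j : ℕ) : 0 < glSum α j := by
  induction j with
  | zero => simp [glSum_zero]
  | succ j ih =>
    rw [glSum_succ]
    refine mul_pos ?_ ih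
    rw [sub_pos, div_lt_one (by positivity)]
    have : (0 : ℝ) ≤ j := by positivity
    linarith

theorem glWeight_succ_nonpos {α : ℝ} (hα : 0 < α) (hα' : α < 1) (j : ℕ) :
    glWeight α (j + 1) ≤ 0 := by
  rw [glWeight_succ, neg_mul]
  have := glSum_pos hα' j
  have : 0 ≤ α / ((j : ℝ) + 1) * glSum α j := by positivity
  linarith

/-- Summing once more gives coefficients of `(1-x)^{α-2}`, again explicit; this makes sharp
two-sided bounds available. -/
theorem sum_glSum {α : ℝ} (hα' : α < 1) (m : ℕ) :
    ∑ j ∈ range m, glSum α j = m * glSum α m / (1 - α) := by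
  have h : 1 - α ≠ 0 := by linarith
  induction m with
  | zero => simp
  | succ m ih =>
    have h1 : (m : ℝ) + 1 ≠ 0 := by positivity
    rw [sum_range_succ, ih, glSum_succ]
    push_cast
    field_simp
    ring

theorem sum_glSum_succ_eq_Gamma {α : ℝ} (hα' : α < 1) (m : ℕ) :
    ∑ j ∈ range (m + 1), glSum α j
      = Real.Gamma (m + 2 - α) / (Real.Gamma (2 - α) * Real.Gamma (m + 1)) := by
  have h2 : Real.Gamma (2 - α) ≠ 0 := (Real.Gamma_pos_of_pos (by linarith)).ne'
  induction m with
  | zero => simp [glSum_zero, h2]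
  | succ m ih =>
    have h3 : (m : ℝ) + 1 ≠ 0 := by positivity
    have h4 : (m : ℝ) + 2 - α ≠ 0 := by
      have : (0 : ℝ) ≤ m := by positivity
      have : (m : ℝ) + 2 - α > 0 := by linarith
      exact this.ne'
    have h5 : Real.Gamma (m + 1) ≠ 0 := (Real.Gamma_pos_of_pos (by positivity)).ne'
    have e1 : Real.Gamma (((m + 1 : ℕ) : ℝ) + 2 - α) = (m + 2 - α) * Real.Gamma (m + 2 - α) := by
      rw [← Real.Gamma_add_one h4]; push_cast; ring_nf
    have e2 : Real.Gamma (((m + 1 : ℕ) : ℝ) + 1) = (m + 1) * Real.Gamma (m + 1) := by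
      rw [← Real.Gamma_add_one h3]; push_cast; ring_nf
    have h1 : 1 - α ≠ 0 := by linarith
    have e3 : ∑ j ∈ range (m + 1 + 1), glSum α j
        = (m + 2 - α) / (m + 1) * ∑ j ∈ range (m + 1), glSum α j := by
      rw [sum_range_succ, sum_glSum hα']
      push_cast
      field_simp
      ring
    rw [e3, ih, e1, e2]
    field_simp

/-- Gautschi's inequality, upper half. -/
theorem Gamma_add_le_rpow {α x : ℝ} (hα : 0 < α) (hα' : α < 1) (hx : 0 < x) :
    Real.Gamma (x + 1 - α) ≤ Real.Gamma x * x ^ (1 - α) := by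
  -- Log-convexity of `Γ` at `x + 1 - α = α x + (1-α)(x+1)`.
  have h := Real.Gamma_mul_add_mul_le_rpow_Gamma_mul_rpow_Gamma (s := x) (t := x + 1) (a := α)
    (b := 1 - α) hx (by linarith) hα (by linarith) (by ring)
  have hG := Real.Gamma_pos_of_pos hx
  rw [Real.Gamma_add_one hx.ne', Real.mul_rpow hx.le hG.le, mul_left_comm,
    ← Real.rpow_add hG] at h
  have e : α * x + (1 - α) * (x + 1) = x + 1 - α := by ring
  rw [e] at h
  simpa [mul_comm] using h

/-- Gautschi's inequality, lower half. -/
theorem rpow_le_Gamma_add {α x : ℝ} (hα : 0 < α) (hα' : α < 1) (hx : 1 ≤ x) :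
    Real.Gamma x * (x ^ (-α) * (x - α)) ≤ Real.Gamma (x + 1 - α) := by
  have hx0 : 0 < x := by linarith
  have hs : 0 < x - α := by linarith
  have hG := Real.Gamma_pos_of_pos hs
  -- The upper half at `x - α` with exponent `1 - α` bounds `Γ(x)` by `Γ(x-α)`, which is the reverse
  -- inequality.
  have h := Gamma_add_le_rpow (α := 1 - α) (x := x - α) (by linarith) (by linarith) hs
  have e : x - α + 1 - (1 - α) = x := by ring
  rw [e, sub_sub_cancel] at h
  have e2 : Real.Gamma (x + 1 - α) = (x - α) * Real.Gamma (x - α) := by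
    rw [← Real.Gamma_add_one hs.ne']; ring_nf
  rw [e2]
  have h3 : Real.Gamma x * x ^ (-α) ≤ Real.Gamma (x - α) := by
    calc Real.Gamma x * x ^ (-α) ≤ (Real.Gamma (x - α) * (x - α) ^ α) * x ^ (-α) := by gcongr
      _ ≤ (Real.Gamma (x - α) * x ^ α) * x ^ (-α) := by
        gcongr
        linarith
      _ = Real.Gamma (x - α) := by
        rw [mul_assoc, ← Real.rpow_add hx0]; simp
  calc _ = (x - α) * (Real.Gamma x * x ^ (-α)) := by ring
    _ ≤ _ := by gcongr

theorem sum_glSum_le {α : ℝ} (hα : 0 < α) (hα' : α < 1) (m : ℕ) :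
    ∑ j ∈ range (m + 1), glSum α j ≤ ((m : ℝ) + 1) ^ (1 - α) / Real.Gamma (2 - α) := by
  rw [sum_glSum_succ_eq_Gamma hα']
  have h2 : 0 < Real.Gamma (2 - α) := Real.Gamma_pos_of_pos (by linarith)
  have h5 : 0 < Real.Gamma ((m : ℝ) + 1) := Real.Gamma_pos_of_pos (by positivity)
  rw [div_le_div_iff₀ (by positivity) h2]
  have h := Gamma_add_le_rpow hα hα' (x := (m : ℝ) + 1) (by positivity)
  have e : (m : ℝ) + 1 + 1 - α = m + 2 - α := by ring
  rw [e] at h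
  calc _ ≤ Real.Gamma (m + 1) * (m + 1) ^ (1 - α) * Real.Gamma (2 - α) := by gcongr
    _ = _ := by ring

theorem le_sum_glSum {α : ℝ} (hα : 0 < α) (hα' : α < 1) (m : ℕ) :
    ((m : ℝ) + 1) ^ (-α) * (m + 1 - α) / Real.Gamma (2 - α) ≤ ∑ j ∈ range (m + 1), glSum α j := by
  rw [sum_glSum_succ_eq_Gamma hα']
  have h2 : 0 < Real.Gamma (2 - α) := Real.Gamma_pos_of_pos (by linarith)
  have h5 : 0 < Real.Gamma ((m : ℝ) + 1) := Real.Gamma_pos_of_pos (by positivity)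
  rw [div_le_div_iff₀ h2 (by positivity)]
  have h := rpow_le_Gamma_add hα hα' (x := (m : ℝ) + 1) (by linarith [Nat.cast_nonneg (α := ℝ) m])
  have e : (m : ℝ) + 1 + 1 - α = m + 2 - α := by ring
  rw [e] at h
  calc _ = (Real.Gamma (m + 1) * ((m + 1) ^ (-α) * (m + 1 - α))) * Real.Gamma (2 - α) := by ring
    _ ≤ _ := by gcongr

theorem Gamma_two_sub {α : ℝ} (hα' : α < 1) :
    Real.Gamma (2 - α) = (1 - α) * Real.Gamma (1 - α) := by
  rw [← Real.Gamma_add_one (by linarith)]; ring_nf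

/-- The bridge from truncation to stability: singular factors `(m+1)^{-α}` are absorbed by the
partial sum. The factor `m + 1 - α` of Gautschi's bound cancels exactly against the closed form of
the sum. -/
theorem rpow_le_glSum {α : ℝ} (hα : 0 < α) (hα' : α < 1) (m : ℕ) :
    ((m : ℝ) + 1) ^ (-α) ≤ Real.Gamma (1 - α) * glSum α m := by
  have h := le_sum_glSum hα hα' m
  have hG := Real.Gamma_pos_of_pos (show 0 < 1 - α by linarith)
  have hm : (0 : ℝ) ≤ m := by positivity
  have h1 : 0 < 1 - α := by linarith
  have h2 : 0 < (m : ℝ) + 1 - α := by linarith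
  have e : ∑ j ∈ range (m + 1), glSum α j = (m + 1 - α) * glSum α m / (1 - α) := by
    rw [sum_glSum hα', glSum_succ]; push_cast; field_simp
  rw [e, Gamma_two_sub hα', div_le_div_iff₀ (by positivity) h1] at h
  have : ((m : ℝ) + 1 - α) * (1 - α) * ((m : ℝ) + 1) ^ (-α)
      ≤ (m + 1 - α) * (1 - α) * (Real.Gamma (1 - α) * glSum α m) := by nlinarith [h]
  exact le_of_mul_le_mul_left this (by positivity)

/-- Lets `m + 1` increments of size `O(τ)` cost only a bounded multiple of the last partial sum. -/
theorem sum_glSum_le_mul {α : ℝ} (hα : 0 < α) (hα' : α < 1) (m : ℕ) :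
    ∑ j ∈ range (m + 1), glSum α j ≤ (m + 1) * glSum α m / (1 - α) := by
  have h := glSum_pos hα' m
  have h1 : 0 < 1 - α := by linarith
  rw [sum_glSum hα', glSum_succ]
  push_cast
  gcongr
  have : 0 ≤ α / ((m : ℝ) + 1) := by positivity
  nlinarith

/-- Summation by parts for Grünwald–Lubich convolutions. -/
theorem sum_glWeight_smul {E : Type*} [AddCommGroup E] [Module ℝ E] (α : ℝ) (φ : ℕ → E) (n : ℕ) :
    ∑ i ∈ range (n + 1), glWeight α i • φ (n + 1 - i)
      = ∑ j ∈ range (n + 1), glSum α j • (φ (n + 1 - j) - φ (n - j)) + glSum α n • φ 0 := by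
  -- The sum is truncated at `m` with `n` fixed; induction on `n` would shift every argument of `φ`.
  have key : ∀ m ≤ n, ∑ i ∈ range (m + 1), glWeight α i • φ (n + 1 - i)
      = ∑ j ∈ range (m + 1), glSum α j • (φ (n + 1 - j) - φ (n - j)) + glSum α m • φ (n - m) := by
    intro m
    induction m with
    | zero => intro _; simp [glSum_zero, glWeight]
    | succ m ih =>
      intro hm
      rw [sum_range_succ, ih (by omega), sum_range_succ _ (m + 1), glSum_succ_eq_add]
      have e : n + 1 - (m + 1) = n - m := by omega
      rw [e]
      module
  simpa using key n le_rfl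

end Weights

/-! ### Truncation error of the Grünwald–Lubich formula. -/

section Truncation

open Finset intervalIntegral MeasureTheory

theorem sum_sub_mul_by_parts (E c : ℕ → ℝ) (hE : E 0 = 0) (m : ℕ) :
    ∑ j ∈ range (m + 1), (E (j + 1) - E j) * c j
      = E (m + 1) * c m - ∑ j ∈ range m, E (j + 1) * (c (j + 1) - c j) := by
  induction m with
  | zero => simp [hE]
  | succ m ih => rw [sum_range_succ, ih, sum_range_succ _ m]; ring

/-- Grünwald–Lubich and product-integration weights differ by a sequence whose partial sums decay. -/
theorem abs_sum_glSum_sub_le {α : ℝ} (hα : 0 < α) (hα' : α < 1) (m : ℕ) :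
    |∑ j ∈ range (m + 1), glSum α j - ((m : ℝ) + 1) ^ (1 - α) / Real.Gamma (2 - α)|
      ≤ ((m : ℝ) + 1) ^ (-α) / Real.Gamma (2 - α) := by
  have h1 := sum_glSum_le hα hα' m
  have h2 := le_sum_glSum hα hα' m
  have hG : 0 < Real.Gamma (2 - α) := Real.Gamma_pos_of_pos (by linarith)
  have hm : 0 < (m : ℝ) + 1 := by positivity
  have e : ((m : ℝ) + 1) ^ (1 - α) = ((m : ℝ) + 1) ^ (-α) * (m + 1) := by
    rw [show 1 - α = -α + 1 by ring, Real.rpow_add_one hm.ne']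
  have hp : 0 < ((m : ℝ) + 1) ^ (-α) := by positivity
  rw [abs_le]
  constructor
  · have : ((m : ℝ) + 1) ^ (-α) * (m + 1 - α) / Real.Gamma (2 - α)
        = ((m : ℝ) + 1) ^ (1 - α) / Real.Gamma (2 - α)
          - α * (((m : ℝ) + 1) ^ (-α) / Real.Gamma (2 - α)) := by
      rw [e]; ring
    have h3 : α * (((m : ℝ) + 1) ^ (-α) / Real.Gamma (2 - α))
        ≤ 1 * (((m : ℝ) + 1) ^ (-α) / Real.Gamma (2 - α)) := by gcongr
    linarith
  · have : 0 ≤ ((m : ℝ) + 1) ^ (-α) / Real.Gamma (2 - α) := by positivity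
    linarith

/-- Abel summation moves the difference of weights onto its primitive `E`, which is `O(m^{-α})`; the
values `d` then enter only through `d 0` and their increments. -/
theorem abs_sum_weight_diff_mul_le {α K δ : ℝ} (hα : 0 < α) (hα' : α < 1) (n : ℕ)
    (d : ℕ → ℝ) (h0 : |d 0| ≤ K) (hδ : 0 ≤ δ) (hd : ∀ m < n, |d (m + 1) - d m| ≤ δ) :
    |∑ j ∈ range (n + 1), (glSum α j
        - (((j : ℝ) + 1) ^ (1 - α) - (j : ℝ) ^ (1 - α)) / Real.Gamma (2 - α)) * d (n - j)|
      ≤ ((n : ℝ) + 1) ^ (-α) / Real.Gamma (2 - α) * (K + δ * (n + 1) / (1 - α)) := by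
  have hG : 0 < Real.Gamma (2 - α) := Real.Gamma_pos_of_pos (by linarith)
  have hG1 : 0 < Real.Gamma (1 - α) := Real.Gamma_pos_of_pos (by linarith)
  have h1α : 0 < 1 - α := by linarith
  set E : ℕ → ℝ := fun m => ∑ j ∈ range m, glSum α j - (m : ℝ) ^ (1 - α) / Real.Gamma (2 - α)
    with hE
  have hE0 : E 0 = 0 := by simp [hE, Real.zero_rpow h1α.ne']
  have hEb : ∀ m, |E (m + 1)| ≤ ((m : ℝ) + 1) ^ (-α) / Real.Gamma (2 - α) := by
    intro m; simpa [hE] using abs_sum_glSum_sub_le hα hα' m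
  have e1 : ∑ j ∈ range (n + 1), (glSum α j
        - (((j : ℝ) + 1) ^ (1 - α) - (j : ℝ) ^ (1 - α)) / Real.Gamma (2 - α)) * d (n - j)
      = ∑ j ∈ range (n + 1), (E (j + 1) - E j) * d (n - j) := by
    refine sum_congr rfl fun j _ => ?_
    simp only [hE, sum_range_succ]
    push_cast
    ring
  rw [e1, sum_sub_mul_by_parts E (fun j => d (n - j)) hE0]
  -- The power sum is bounded by passing to partial sums of weights and back; no comparison with an
  -- integral is needed.
  have hsum : ∑ j ∈ range n, ((j : ℝ) + 1) ^ (-α) ≤ ((n : ℝ) + 1) ^ (1 - α) / (1 - α) := by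
    calc ∑ j ∈ range n, ((j : ℝ) + 1) ^ (-α)
        ≤ ∑ j ∈ range n, Real.Gamma (1 - α) * glSum α j :=
          sum_le_sum fun j _ => rpow_le_glSum hα hα' j
      _ ≤ ∑ j ∈ range (n + 1), Real.Gamma (1 - α) * glSum α j := by
          rw [sum_range_succ]
          have := glSum_pos hα' n
          have : 0 ≤ Real.Gamma (1 - α) * glSum α n := by positivity
          linarith
      _ ≤ Real.Gamma (1 - α) * (((n : ℝ) + 1) ^ (1 - α) / Real.Gamma (2 - α)) := by
          rw [← mul_sum]
          gcongr
          exact sum_glSum_le hα hα' n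
      _ = _ := by rw [Gamma_two_sub hα']; field_simp
  have e2 : ((n : ℝ) + 1) ^ (1 - α) = ((n : ℝ) + 1) ^ (-α) * (n + 1) := by
    rw [show 1 - α = -α + 1 by ring, Real.rpow_add_one (by positivity)]
  calc |E (n + 1) * d (n - n) - ∑ j ∈ range n, E (j + 1) * (d (n - (j + 1)) - d (n - j))|
      ≤ |E (n + 1) * d (n - n)| + |∑ j ∈ range n, E (j + 1) * (d (n - (j + 1)) - d (n - j))| :=
        abs_sub _ _
    _ ≤ ((n : ℝ) + 1) ^ (-α) / Real.Gamma (2 - α) * K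
        + ∑ j ∈ range n, ((j : ℝ) + 1) ^ (-α) / Real.Gamma (2 - α) * δ := by
        gcongr
        · rw [abs_mul, Nat.sub_self]
          gcongr
          exact hEb n
        · refine (abs_sum_le_sum_abs _ _).trans (sum_le_sum fun j hj => ?_)
          rw [abs_mul]
          gcongr
          · exact hEb j
          · have hj' := mem_range.mp hj
            have := hd (n - (j + 1)) (by omega)
            rwa [show n - (j + 1) + 1 = n - j by omega, abs_sub_comm] at this
    _ = ((n : ℝ) + 1) ^ (-α) / Real.Gamma (2 - α) * K
        + δ / Real.Gamma (2 - α) * ∑ j ∈ range n, ((j : ℝ) + 1) ^ (-α) := by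
        rw [mul_sum]; congr 1; exact sum_congr rfl fun j _ => by ring
    _ ≤ ((n : ℝ) + 1) ^ (-α) / Real.Gamma (2 - α) * K
        + δ / Real.Gamma (2 - α) * (((n : ℝ) + 1) ^ (1 - α) / (1 - α)) := by gcongr
    _ = _ := by rw [e2]; ring

theorem intervalIntegrable_sub_rpow {α : ℝ} (hα' : α < 1) (t a b : ℝ) :
    IntervalIntegrable (fun s => (t - s) ^ (-α)) volume a b := by
  have := (intervalIntegrable_rpow' (a := t - a) (b := t - b) (r := -α) (by linarith))
  simpa using this.comp_sub_left t

theorem integral_sub_rpow {α : ℝ} (hα' : α < 1) (t a b : ℝ) :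
    ∫ s in a..b, (t - s) ^ (-α) = ((t - a) ^ (1 - α) - (t - b) ^ (1 - α)) / (1 - α) := by
  rw [integral_comp_sub_left (fun s => s ^ (-α)), integral_rpow (Or.inl (by linarith))]
  rw [show -α + 1 = 1 - α by ring]

/-- The Grünwald–Lubich formula approximates the Riemann–Liouville derivative of a function that
vanishes at the origin, with the singular rate `τ t^{-α}`. -/
theorem abs_fractional_sub_glSum_le {α T K : ℝ} (hα : 0 < α) (hα' : α < 1)
    {φ ψ : ℝ → ℝ} (hφ : ∀ t ∈ Set.Icc 0 T, HasDerivWithinAt φ (ψ t) (Set.Icc 0 T) t)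
    (hb : ∀ t ∈ Set.Icc 0 T, |ψ t| ≤ K)
    (hlip : ∀ s ∈ Set.Icc 0 T, ∀ t ∈ Set.Icc 0 T, |ψ s - ψ t| ≤ K * |s - t|)
    {τ : ℝ} (hτ : 0 < τ) (n : ℕ) (hn : ((n : ℝ) + 1) * τ ≤ T) :
    |1 / Real.Gamma (1 - α) * (∫ s in (0 : ℝ)..((n + 1) * τ), ((n + 1) * τ - s) ^ (-α) * ψ s)
      - τ ^ (-α) * ∑ j ∈ range (n + 1), glSum α j
          * (φ (((n + 1 - j : ℕ) : ℝ) * τ) - φ (((n - j : ℕ) : ℝ) * τ))|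
      ≤ K * (T + 1 + 2 * T / (1 - α)) / Real.Gamma (2 - α) * (τ * ((n + 1) * τ) ^ (-α)) := by
  have hG : 0 < Real.Gamma (2 - α) := Real.Gamma_pos_of_pos (by linarith)
  have hG1 : 0 < Real.Gamma (1 - α) := Real.Gamma_pos_of_pos (by linarith)
  have h1α : 0 < 1 - α := by linarith
  have hT : 0 < T := lt_of_lt_of_le (by positivity) hn
  have hK : 0 ≤ K := (abs_nonneg _).trans (hb 0 ⟨le_rfl, hT.le⟩)
  set t : ℝ := (n + 1) * τ with ht
  have ht0 : 0 < t := by positivity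
  have hgrid : ∀ m : ℕ, m ≤ n + 1 → (m : ℝ) * τ ∈ Set.Icc 0 T := by
    intro m hm
    have : (m : ℝ) ≤ n + 1 := by exact_mod_cast hm
    exact ⟨by positivity, (mul_le_mul_of_nonneg_right this hτ.le).trans hn⟩
  have hcont : ContinuousOn ψ (Set.Icc 0 T) := by
    refine LipschitzOnWith.continuousOn (K := K.toNNReal) ?_
    refine LipschitzOnWith.of_dist_le_mul fun s hs r hr => ?_
    rw [Real.dist_eq, Real.dist_eq, Real.coe_toNNReal _ hK]
    exact hlip s hs r hr
  have hφc : ContinuousOn φ (Set.Icc 0 T) := fun s hs => (hφ s hs).continuousWithinAt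
  -- difference quotients
  set d : ℕ → ℝ := fun m => (φ (((m + 1 : ℕ) : ℝ) * τ) - φ ((m : ℝ) * τ)) / τ with hd
  have hmvt : ∀ m : ℕ, m ≤ n → ∃ ξ ∈ Set.Ioo ((m : ℝ) * τ) (((m + 1 : ℕ) : ℝ) * τ), ψ ξ = d m := by
    intro m hm
    have hlt : (m : ℝ) * τ < ((m + 1 : ℕ) : ℝ) * τ := by gcongr; simp
    have hsub : Set.Icc ((m : ℝ) * τ) (((m + 1 : ℕ) : ℝ) * τ) ⊆ Set.Icc 0 T :=
      Set.Icc_subset_Icc (hgrid m (by omega)).1 (hgrid (m + 1) (by omega)).2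
    obtain ⟨ξ, hξ, h⟩ := exists_hasDerivAt_eq_slope φ ψ hlt (hφc.mono hsub) fun s hs =>
      (hφ s (hsub ⟨hs.1.le, hs.2.le⟩)).hasDerivAt
        (Icc_mem_nhds (lt_of_le_of_lt (hgrid m (by omega)).1 hs.1)
          (lt_of_lt_of_le hs.2 (hgrid (m + 1) (by omega)).2))
    refine ⟨ξ, hξ, ?_⟩
    rw [h, hd]
    congr 1
    push_cast; ring
  have hξT : ∀ m : ℕ, m ≤ n → ∀ ξ ∈ Set.Icc ((m : ℝ) * τ) (((m + 1 : ℕ) : ℝ) * τ),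
      ξ ∈ Set.Icc 0 T := fun m hm ξ hξ =>
    ⟨(hgrid m (by omega)).1.trans hξ.1, hξ.2.trans (hgrid (m + 1) (by omega)).2⟩
  -- The difference quotient is a value of `ψ` inside the cell, so the Lipschitz bound applies.
  have hclose : ∀ m : ℕ, m ≤ n → ∀ s ∈ Set.Icc ((m : ℝ) * τ) (((m + 1 : ℕ) : ℝ) * τ),
      |ψ s - d m| ≤ K * τ := by
    intro m hm s hs
    obtain ⟨ξ, hξ, h⟩ := hmvt m hm
    have hξ' := Set.Ioo_subset_Icc_self hξ
    rw [← h]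
    refine (hlip s (hξT m hm s hs) ξ (hξT m hm ξ hξ')).trans ?_
    gcongr
    rw [abs_le]
    have h1 := hs.1; have h2 := hs.2; have h3 := hξ'.1; have h4 := hξ'.2
    push_cast at h2 h4
    constructor <;> nlinarith
  have hd0 : |d 0| ≤ K := by
    obtain ⟨ξ, hξ, h⟩ := hmvt 0 (by omega)
    rw [← h]
    exact hb ξ (hξT 0 (by omega) ξ (Set.Ioo_subset_Icc_self hξ))
  have hdd : ∀ m < n, |d (m + 1) - d m| ≤ 2 * K * τ := by
    intro m hm
    have h1 := hclose (m + 1) (by omega) (((m + 1 : ℕ) : ℝ) * τ)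
      ⟨le_rfl, by gcongr; omega⟩
    have h2 := hclose m (by omega) (((m + 1 : ℕ) : ℝ) * τ) ⟨by gcongr; omega, le_rfl⟩
    rw [abs_le] at h1 h2 ⊢
    constructor <;> linarith [h1.1, h1.2, h2.1, h2.2]
  -- the integral cell by cell
  have hint : ∀ m : ℕ, m ≤ n → IntervalIntegrable (fun s => (t - s) ^ (-α) * ψ s) volume
      ((m : ℝ) * τ) (((m + 1 : ℕ) : ℝ) * τ) := by
    intro m hm
    refine (intervalIntegrable_sub_rpow hα' t _ _).mul_continuousOn (hcont.mono ?_)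
    rw [Set.uIcc_of_le (by gcongr; omega)]
    exact fun s hs => hξT m hm s hs
  have hsplit : ∫ s in (0 : ℝ)..t, (t - s) ^ (-α) * ψ s
      = ∑ m ∈ range (n + 1), ∫ s in ((m : ℝ) * τ)..(((m + 1 : ℕ) : ℝ) * τ),
          (t - s) ^ (-α) * ψ s := by
    rw [sum_integral_adjacent_intervals (a := fun m : ℕ => (m : ℝ) * τ)
      (fun m hm => hint m (by omega))]
    simp [ht]
  -- Freezing `ψ` at `d m` on each cell costs `K τ` times the integral of the kernel.
  have hker : ∀ m : ℕ, m ≤ n → |(∫ s in ((m : ℝ) * τ)..(((m + 1 : ℕ) : ℝ) * τ),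
      (t - s) ^ (-α) * ψ s)
      - d m * ∫ s in ((m : ℝ) * τ)..(((m + 1 : ℕ) : ℝ) * τ), (t - s) ^ (-α)|
      ≤ K * τ * ∫ s in ((m : ℝ) * τ)..(((m + 1 : ℕ) : ℝ) * τ), (t - s) ^ (-α) := by
    intro m hm
    have hle : (m : ℝ) * τ ≤ ((m + 1 : ℕ) : ℝ) * τ := by gcongr; omega
    have hkerint := intervalIntegrable_sub_rpow hα' t ((m : ℝ) * τ) (((m + 1 : ℕ) : ℝ) * τ)
    rw [← intervalIntegral.integral_const_mul, ← intervalIntegral.integral_const_mul,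
      ← intervalIntegral.integral_sub (hint m hm) (hkerint.const_mul _), ← Real.norm_eq_abs]
    refine norm_integral_le_of_norm_le hle ?_ (hkerint.const_mul _)
    refine Filter.Eventually.of_forall fun s hs => ?_
    have hs' : s ∈ Set.Icc ((m : ℝ) * τ) (((m + 1 : ℕ) : ℝ) * τ) := Set.Ioc_subset_Icc_self hs
    have hst : 0 ≤ t - s := by
      have h1 := hs'.2
      have : ((m + 1 : ℕ) : ℝ) * τ ≤ (n + 1) * τ := by gcongr; exact_mod_cast by omega
      rw [ht]; linarith
    rw [Real.norm_eq_abs, show (t - s) ^ (-α) * ψ s - d m * (t - s) ^ (-α)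
      = (ψ s - d m) * (t - s) ^ (-α) by ring, abs_mul, abs_of_nonneg (Real.rpow_nonneg hst _)]
    gcongr
    exact hclose m hm s hs'
  have hpart1 : |(∫ s in (0 : ℝ)..t, (t - s) ^ (-α) * ψ s)
      - ∑ m ∈ range (n + 1), d m * ∫ s in ((m : ℝ) * τ)..(((m + 1 : ℕ) : ℝ) * τ), (t - s) ^ (-α)|
      ≤ K * τ * (t ^ (1 - α) / (1 - α)) := by
    rw [hsplit, ← sum_sub_distrib]
    refine (abs_sum_le_sum_abs _ _).trans ?_
    refine (sum_le_sum fun m hm => hker m (by have := mem_range.mp hm; omega)).trans ?_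
    rw [← mul_sum, sum_integral_adjacent_intervals (a := fun m : ℕ => (m : ℝ) * τ)
      (fun m _ => intervalIntegrable_sub_rpow hα' t _ _), integral_sub_rpow hα']
    simp [ht, Real.zero_rpow h1α.ne']
  -- Cell integrals of the kernel are the product-integration weights, with reversed index `n - m`.
  have hkv : ∀ m : ℕ, m ≤ n → ∫ s in ((m : ℝ) * τ)..(((m + 1 : ℕ) : ℝ) * τ), (t - s) ^ (-α)
      = τ ^ (1 - α) * ((((n - m : ℕ) : ℝ) + 1) ^ (1 - α) - ((n - m : ℕ) : ℝ) ^ (1 - α))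
        / (1 - α) := by
    intro m hm
    rw [integral_sub_rpow hα', mul_sub, ← Real.mul_rpow hτ.le (by positivity),
      ← Real.mul_rpow hτ.le (by positivity), ht, Nat.cast_sub hm]
    congr 4 <;> · push_cast; ring
  have hτp : τ ^ (1 - α) = τ ^ (-α) * τ := by
    rw [show 1 - α = -α + 1 by ring, Real.rpow_add_one hτ.ne']
  have hpart2 : 1 / Real.Gamma (1 - α) * ∑ m ∈ range (n + 1),
      d m * (∫ s in ((m : ℝ) * τ)..(((m + 1 : ℕ) : ℝ) * τ), (t - s) ^ (-α))
      - τ ^ (-α) * ∑ j ∈ range (n + 1), glSum α j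
          * (φ (((n + 1 - j : ℕ) : ℝ) * τ) - φ (((n - j : ℕ) : ℝ) * τ))
      = - (τ ^ (1 - α) * ∑ j ∈ range (n + 1), (glSum α j
        - (((j : ℝ) + 1) ^ (1 - α) - (j : ℝ) ^ (1 - α)) / Real.Gamma (2 - α)) * d (n - j)) := by
    rw [← sum_range_reflect (fun m => d m * _), mul_sum, mul_sum, mul_sum, ← sum_sub_distrib,
      ← sum_neg_distrib]
    refine sum_congr rfl fun j hj => ?_
    have hj' : j ≤ n := by have := mem_range.mp hj; omega
    rw [show n + 1 - 1 - j = n - j by omega, hkv (n - j) (by omega),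
      show n - (n - j) = j by omega, Gamma_two_sub hα', hτp]
    have : φ (((n + 1 - j : ℕ) : ℝ) * τ) - φ (((n - j : ℕ) : ℝ) * τ) = τ * d (n - j) := by
      rw [hd]; simp only
      rw [show n - j + 1 = n + 1 - j by omega]
      field_simp
    rw [this]
    field_simp
    ring
  have hpart3 := abs_sum_weight_diff_mul_le hα hα' n d hd0 (by positivity) hdd
  set A := ∫ s in (0 : ℝ)..t, (t - s) ^ (-α) * ψ s
  set B := ∑ m ∈ range (n + 1), d m * ∫ s in ((m : ℝ) * τ)..(((m + 1 : ℕ) : ℝ) * τ), (t - s) ^ (-α)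
  set D := τ ^ (-α) * ∑ j ∈ range (n + 1), glSum α j
          * (φ (((n + 1 - j : ℕ) : ℝ) * τ) - φ (((n - j : ℕ) : ℝ) * τ))
  have etp : ((n : ℝ) + 1) ^ (-α) * τ ^ (1 - α) = τ * t ^ (-α) := by
    rw [ht, Real.mul_rpow (by positivity) hτ.le, hτp]; ring
  have etp2 : t ^ (1 - α) = t ^ (-α) * t := by
    rw [show 1 - α = -α + 1 by ring, Real.rpow_add_one ht0.ne']
  calc |1 / Real.Gamma (1 - α) * A - D|
      = |1 / Real.Gamma (1 - α) * (A - B) + (1 / Real.Gamma (1 - α) * B - D)| := by ring_nf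
    _ ≤ |1 / Real.Gamma (1 - α) * (A - B)| + |1 / Real.Gamma (1 - α) * B - D| := abs_add_le _ _
    _ ≤ 1 / Real.Gamma (1 - α) * (K * τ * (t ^ (1 - α) / (1 - α)))
        + τ ^ (1 - α) * (((n : ℝ) + 1) ^ (-α) / Real.Gamma (2 - α)
            * (K + 2 * K * τ * (n + 1) / (1 - α))) := by
        rw [hpart2, abs_neg, abs_mul, abs_mul, abs_of_pos (show 0 < 1 / Real.Gamma (1 - α) by positivity),
          abs_of_pos (show 0 < τ ^ (1 - α) by positivity)]
        gcongr
    -- The summand `t` comes from freezing `ψ`, `1` from the first difference quotient, and `2 t /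
    -- (1 - α)` from the `n` increments of size at most `2 K τ`.
    _ = K * (t + 1 + 2 * t / (1 - α)) / Real.Gamma (2 - α)
          * (((n : ℝ) + 1) ^ (-α) * τ ^ (1 - α)) := by
        rw [etp2, Gamma_two_sub hα']
        have : t ^ (-α) * τ = ((n : ℝ) + 1) ^ (-α) * τ ^ (1 - α) := by rw [etp]; ring
        have e5 : K * τ * (t ^ (-α) * t / (1 - α)) = K * (t ^ (-α) * τ) * t / (1 - α) := by ring
        rw [e5, this, ht]
        field_simp
        ring
    _ ≤ _ := by
        rw [etp]
        gcongr

end Truncation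

/-! ### Periodic weak derivatives, primitives and du Bois-Reymond's lemma. -/

section Primitives

open MeasureTheory Set intervalIntegral

/-- `w` is a primitive of the integrable function `g` on `[0, L]`. -/
def IsPrimitive (L : ℝ) (w g : ℝ → ℝ) : Prop :=
  IntervalIntegrable g volume 0 L ∧ ∀ x ∈ Icc 0 L, w x = w 0 + ∫ s in (0 : ℝ)..x, g s

variable {L : ℝ} {w g : ℝ → ℝ}

theorem intervalIntegrable_of_Icc {a b : ℝ} (h : IntervalIntegrable g volume 0 L)
    (ha : a ∈ Icc 0 L) (hb : b ∈ Icc 0 L) : IntervalIntegrable g volume a b := by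
  refine h.mono_set ?_
  rw [uIcc_of_le (ha.1.trans ha.2)]
  exact uIcc_subset_Icc ha hb

theorem IsPrimitive.sub_eq (h : IsPrimitive L w g) {a b : ℝ} (ha : a ∈ Icc 0 L)
    (hb : b ∈ Icc 0 L) : w b - w a = ∫ s in a..b, g s := by
  have h0 : (0 : ℝ) ∈ Icc 0 L := ⟨le_rfl, ha.1.trans ha.2⟩
  rw [h.2 a ha, h.2 b hb, ← integral_interval_sub_left (intervalIntegrable_of_Icc h.1 h0 hb)
    (intervalIntegrable_of_Icc h.1 h0 ha)]
  ring

theorem IsPrimitive.continuousOn (hL : 0 ≤ L) (h : IsPrimitive L w g) :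
    ContinuousOn w (Icc 0 L) := by
  have h1 : ContinuousOn (fun x => ∫ s in (0 : ℝ)..x, g s) (uIcc 0 L) :=
    continuousOn_primitive_interval' h.1 left_mem_uIcc
  rw [uIcc_of_le hL] at h1
  exact (continuousOn_const.add h1).congr h.2

theorem IsPrimitive.smul (h : IsPrimitive L w g) (c : ℝ) :
    IsPrimitive L (fun x => c * w x) (fun x => c * g x) := by
  refine ⟨h.1.const_mul c, fun x hx => ?_⟩
  dsimp only
  rw [h.2 x hx, intervalIntegral.integral_const_mul]; ring

theorem IsPrimitive.sub {w' g' : ℝ → ℝ} (h : IsPrimitive L w g) (h' : IsPrimitive L w' g') :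
    IsPrimitive L (fun x => w x - w' x) (fun x => g x - g' x) := by
  refine ⟨h.1.sub h'.1, fun x hx => ?_⟩
  have h0 : (0 : ℝ) ∈ Icc 0 L := ⟨le_rfl, hx.1.trans hx.2⟩
  dsimp only
  rw [h.2 x hx, h'.2 x hx, intervalIntegral.integral_sub (intervalIntegrable_of_Icc h.1 h0 hx)
    (intervalIntegrable_of_Icc h'.1 h0 hx)]
  ring

/-- Valid for merely integrable `g`: its primitive is absolutely continuous, with derivative `g`
almost everywhere. -/
theorem IsPrimitive.integral_mul (h : IsPrimitive L w g) {a b : ℝ} (hab : a ≤ b)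
    (ha : a ∈ Icc 0 L) (hb : b ∈ Icc 0 L) {φ φ' : ℝ → ℝ} (hφ : ∀ x, HasDerivAt φ (φ' x) x)
    (hφ' : Continuous φ') :
    ∫ x in a..b, g x * φ x = w b * φ b - w a * φ a - ∫ x in a..b, w x * φ' x := by
  have hg := intervalIntegrable_of_Icc h.1 ha hb
  have hac := hg.absolutelyContinuousOnInterval_intervalIntegral (left_mem_uIcc (a := a) (b := b))
  have hd : deriv φ = φ' := funext fun x => (hφ x).deriv
  have hφ1 : ContDiff ℝ 1 φ := by
    rw [contDiff_one_iff_deriv, hd]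
    exact ⟨fun x => (hφ x).differentiableAt, hφ'⟩
  have key := hac.integral_mul_deriv_eq_deriv_mul hφ1.contDiffOn.absolutelyContinuousOnInterval
  rw [hd] at key
  have e1 : ∫ x in a..b, deriv (fun x => ∫ v in a..x, g v) x * φ x = ∫ x in a..b, g x * φ x := by
    refine integral_congr_ae ?_
    filter_upwards [hg.ae_hasDerivAt_integral] with x hx hx'
    rw [(hx (uIoc_subset_uIcc hx') a left_mem_uIcc).deriv]
  have e2 : ∫ x in a..b, w x * φ' x
      = w a * (φ b - φ a) + ∫ x in a..b, (∫ v in a..x, g v) * φ' x := by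
    rw [← integral_eq_sub_of_hasDerivAt (fun x _ => hφ x) (hφ'.intervalIntegrable _ _),
      ← intervalIntegral.integral_const_mul, ← intervalIntegral.integral_add]
    · refine integral_congr fun x hx => ?_
      rw [uIcc_of_le hab] at hx
      have := h.sub_eq ha ⟨ha.1.trans hx.1, hx.2.trans hb.2⟩
      rw [← this]; ring
    · exact (hφ'.intervalIntegrable _ _).const_mul _
    · exact (hac.continuousOn.mul hφ'.continuousOn).intervalIntegrable
  rw [e1, integral_same] at key
  have := h.sub_eq ha hb
  rw [e2, key, ← this]
  ring

theorem memLp_of_continuousOn (h : ContinuousOn w (Icc 0 L)) :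
    MemLp w 2 (domainMeasure L) := by
  obtain ⟨C, hC⟩ := isCompact_Icc.exists_bound_of_continuousOn h
  refine MemLp.of_bound ((h.mono Ioc_subset_Icc_self).aestronglyMeasurable measurableSet_Ioc) C ?_
  exact (ae_restrict_iff' measurableSet_Ioc).mpr
    (Filter.Eventually.of_forall fun x hx => hC x (Ioc_subset_Icc_self hx))

theorem intervalIntegrable_of_memLp (hL : 0 ≤ L) (h : MemLp w 2 (domainMeasure L)) :
    IntervalIntegrable w volume 0 L := by
  rw [intervalIntegrable_iff_integrableOn_Ioc_of_le hL]
  exact h.integrable (by norm_num)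

theorem intervalIntegrable_ofReal {a b : ℝ} {f : ℝ → ℝ} (h : IntervalIntegrable f volume a b) :
    IntervalIntegrable (fun x => (f x : ℂ)) volume a b :=
  ⟨h.1.ofReal, h.2.ofReal⟩

/-- An `L²` function orthogonal to the derivatives of all periodic test functions is constant. -/
theorem ae_eq_const_of_integral_mul_deriv (hL : 0 < L) {V : ℝ → ℝ}
    (hV : MemLp V 2 (domainMeasure L))
    (h : ∀ φ : ℝ → ℝ, ContDiff ℝ ∞ φ → (∀ x, φ (x + L) = φ x) →
      ∫ x in (0 : ℝ)..L, V x * deriv φ x = 0) :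
    V =ᵐ[domainMeasure L] fun _ => (∫ x in (0 : ℝ)..L, V x) / L := by
  set m := (∫ x in (0 : ℝ)..L, V x) / L with hm
  have hVm : MemLp (fun x => V x - m) 2 (domainMeasure L) := hV.sub (memLp_const m)
  have hVmi := intervalIntegrable_of_memLp hL.le hVm
  have hVi := intervalIntegrable_of_memLp hL.le hV
  have hf : MemLp (fun x => ((V x - m : ℝ) : ℂ)) 2 (volume.restrict (Ioc 0 L)) := hVm.ofReal
  have h0 : ∫ x in (0 : ℝ)..L, (V x - m) = 0 := by
    rw [intervalIntegral.integral_sub hVi (by simp)]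
    simp only [intervalIntegral.integral_const, smul_eq_mul, hm]
    field_simp
    ring
  have hφ : ∀ φ : ℝ → ℝ, ContDiff ℝ ∞ φ → (∀ x, φ (x + L) = φ x) →
      ∫ x in (0 : ℝ)..L, (V x - m) * deriv φ x = 0 := by
    intro φ hc hp
    have hdc : Continuous (deriv φ) := hc.continuous_deriv (by simp)
    simp_rw [sub_mul]
    rw [intervalIntegral.integral_sub (hVi.mul_continuousOn hdc.continuousOn)
      ((hdc.intervalIntegrable _ _).const_mul m), h φ hc hp, intervalIntegral.integral_const_mul,
      integral_deriv_eq_sub (fun x _ => (hc.differentiable (by simp)) x)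
        (hdc.intervalIntegrable _ _)]
    have := hp 0
    rw [zero_add] at this
    rw [this]; ring
  -- Every nonconstant trigonometric function is the derivative of a periodic one, so these test
  -- functions suffice.
  have hcos : ∀ n : ℤ, n ≠ 0 → ∫ x in (0 : ℝ)..L, (V x - m) * Real.cos (2 * Real.pi * n / L * x) = 0
      ∧ ∫ x in (0 : ℝ)..L, (V x - m) * Real.sin (2 * Real.pi * n / L * x) = 0 := by
    intro n hn
    set a := 2 * Real.pi * n / L with ha
    have ha0 : a ≠ 0 := by
      have : (n : ℝ) ≠ 0 := by exact_mod_cast hn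
      have := Real.pi_ne_zero
      positivity
    have haL : ∀ x, a * (x + L) = a * x + n * (2 * Real.pi) := by
      intro x; rw [ha]; field_simp
    constructor
    · have e := hφ (fun x => Real.sin (a * x) / a)
        ((Real.contDiff_sin.comp (contDiff_const.mul contDiff_id)).div_const a) (by
          intro x; rw [haL, Real.sin_add_int_mul_two_pi])
      refine Eq.trans ?_ e
      refine integral_congr fun x _ => ?_
      have : HasDerivAt (fun x => Real.sin (a * x) / a) (Real.cos (a * x) * (a * 1) / a) x :=
        (((hasDerivAt_id x).const_mul a).sin).div_const a
      rw [this.deriv]; field_simp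
    · have e := hφ (fun x => -Real.cos (a * x) / a)
        ((Real.contDiff_cos.comp (contDiff_const.mul contDiff_id)).neg.div_const a) (by
          intro x; rw [haL, Real.cos_add_int_mul_two_pi])
      refine Eq.trans ?_ e
      refine integral_congr fun x _ => ?_
      have : HasDerivAt (fun x => -Real.cos (a * x) / a) (-(-Real.sin (a * x) * (a * 1)) / a) x :=
        (((hasDerivAt_id x).const_mul a).cos).neg.div_const a
      rw [this.deriv]; field_simp
  have hcoef : ∀ n : ℤ, fourierCoeffOn hL (fun x => ((V x - m : ℝ) : ℂ)) n = 0 := by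
    intro n
    rw [fourierCoeffOn_eq_integral]
    rcases eq_or_ne n 0 with rfl | hn
    · simp only [neg_zero, fourier_zero, one_smul]
      rw [intervalIntegral.integral_ofReal, h0]; simp
    · have e : ∀ x : ℝ, fourier (-n) (x : AddCircle (L - 0)) • ((V x - m : ℝ) : ℂ)
          = (((V x - m) * Real.cos (2 * Real.pi * n / L * x) : ℝ) : ℂ)
            - Complex.I * (((V x - m) * Real.sin (2 * Real.pi * n / L * x) : ℝ) : ℂ) := by
        intro x
        rw [fourier_coe_apply]
        have e2 : 2 * (Real.pi : ℂ) * Complex.I * ((-n : ℤ) : ℂ) * (x : ℂ) / ((L - 0 : ℝ) : ℂ)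
            = ((-(2 * Real.pi * n / L * x) : ℝ) : ℂ) * Complex.I := by
          push_cast; rw [sub_zero]; ring
        rw [e2, Complex.exp_mul_I, ← Complex.ofReal_cos, ← Complex.ofReal_sin, Real.cos_neg,
          Real.sin_neg, smul_eq_mul]
        push_cast
        ring
      simp_rw [e]
      have i1 : IntervalIntegrable (fun x => (V x - m) * Real.cos (2 * Real.pi * n / L * x))
          volume 0 L := hVmi.mul_continuousOn (by fun_prop)
      have i2 : IntervalIntegrable (fun x => (V x - m) * Real.sin (2 * Real.pi * n / L * x))
          volume 0 L := hVmi.mul_continuousOn (by fun_prop)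
      rw [intervalIntegral.integral_sub (intervalIntegrable_ofReal i1) ((intervalIntegrable_ofReal i2).const_mul _),
        intervalIntegral.integral_const_mul, intervalIntegral.integral_ofReal,
        intervalIntegral.integral_ofReal, (hcos n hn).1, (hcos n hn).2]
      simp
  -- All Fourier coefficients of `V - m` vanish, the zeroth by the choice of `m`; Parseval's
  -- identity concludes.
  have hsum := hasSum_sq_fourierCoeffOn hL hf
  simp_rw [hcoef] at hsum
  have hz : ∫ x in (0 : ℝ)..L, ‖((V x - m : ℝ) : ℂ)‖ ^ 2 = 0 := by
    have := hsum.unique (show HasSum (fun _ : ℤ => ‖(0 : ℂ)‖ ^ 2) 0 by simp)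
    simpa [hL.ne'] using this
  rw [integral_of_le hL.le, integral_eq_zero_iff_of_nonneg (fun x => by positivity)] at hz
  · filter_upwards [hz] with x hx
    have : ‖((V x - m : ℝ) : ℂ)‖ = 0 := by simpa using hx
    rw [norm_eq_zero, Complex.ofReal_eq_zero] at this
    linarith
  · exact hf.integrable_norm_pow (by norm_num)

theorem contDiff_deriv_of_contDiff_infty {φ : ℝ → ℝ} (hφ : ContDiff ℝ ∞ φ) :
    ContDiff ℝ ∞ (deriv φ) := (contDiff_infty_iff_deriv.mp hφ).2

theorem deriv_add_period {φ : ℝ → ℝ} (hp : ∀ x, φ (x + L) = φ x) (x : ℝ) :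
    deriv φ (x + L) = deriv φ x := by
  rw [← deriv_comp_add_const, funext hp]

/-- The difference annihilates all test functions: derivatives as tests make it constant, and the
test function `1` makes the constant zero. -/
theorem IsPeriodicWeakDeriv.ae_eq (hL : 0 < L) (h : IsPeriodicWeakDeriv L 0 w g)
    (hw : MemLp w 2 (domainMeasure L)) (hg : MemLp g 2 (domainMeasure L)) :
    w =ᵐ[domainMeasure L] g := by
  have hwi := intervalIntegrable_of_memLp hL.le hw
  have hgi := intervalIntegrable_of_memLp hL.le hg
  have hz : ∀ φ : ℝ → ℝ, ContDiff ℝ ∞ φ → (∀ x, φ (x + L) = φ x) →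
      ∫ x in (0 : ℝ)..L, (w x - g x) * φ x = 0 := by
    intro φ hφ hp
    have := h.2.2 φ hφ hp
    simp only [iteratedDeriv_zero, pow_zero, one_mul] at this
    simp_rw [sub_mul]
    rw [intervalIntegral.integral_sub (hwi.mul_continuousOn hφ.continuous.continuousOn)
      (hgi.mul_continuousOn hφ.continuous.continuousOn), this, sub_self]
  have hc := ae_eq_const_of_integral_mul_deriv hL (hw.sub hg) fun φ hφ hp =>
    hz _ (contDiff_deriv_of_contDiff_infty hφ) (deriv_add_period hp)
  have h1 := hz (fun _ => 1) contDiff_const (fun _ => rfl)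
  simp only [mul_one] at h1
  filter_upwards [hc] with x hx
  simp only [Pi.sub_apply, h1, zero_div] at hx
  linarith

theorem IsPeriodicWeakDeriv.succ {j : ℕ} {g' : ℝ → ℝ} (h : IsPeriodicWeakDeriv L j w g)
    (h' : IsPeriodicWeakDeriv L (j + 1) w g') : IsPeriodicWeakDeriv L 1 g g' := by
  refine ⟨h.2.1, h'.2.1, fun φ hφ hp => ?_⟩
  have e1 := h.2.2 _ (contDiff_deriv_of_contDiff_infty hφ) (deriv_add_period hp)
  have e2 := h'.2.2 φ hφ hp
  rw [iteratedDeriv_succ', e1, pow_succ, mul_assoc] at e2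
  have h1 : ((-1 : ℝ)) ^ j ≠ 0 := by simp
  rw [iteratedDeriv_one, pow_one]
  exact mul_left_cancel₀ h1 e2

/-- du Bois-Reymond: an `L²` function with an integrable weak derivative is almost everywhere a
primitive of it, and the weak derivative has mean value zero. -/
theorem IsPeriodicWeakDeriv.exists_primitive (hL : 0 < L) (h : IsPeriodicWeakDeriv L 1 w g)
    (hw : MemLp w 2 (domainMeasure L)) :
    (∃ c : ℝ, w =ᵐ[domainMeasure L] fun x => c + ∫ s in (0 : ℝ)..x, g s) ∧
      ∫ s in (0 : ℝ)..L, g s = 0 := by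
  have hgi : IntervalIntegrable g volume 0 L :=
    (intervalIntegrable_iff_integrableOn_Ioc_of_le hL.le).mpr h.2.1
  have hwi := intervalIntegrable_of_memLp hL.le hw
  -- Zero mean makes the primitive of `g` vanish at `L` as well, so no boundary term survives the
  -- integration by parts below.
  have hmean : ∫ s in (0 : ℝ)..L, g s = 0 := by
    have := h.2.2 (fun _ => 1) contDiff_const (fun _ => rfl)
    simp only [iteratedDeriv_one, deriv_const, mul_zero, intervalIntegral.integral_zero, mul_one,
      pow_one] at this
    linarith
  have hprim : IsPrimitive L (fun x => ∫ s in (0 : ℝ)..x, g s) g := ⟨hgi, fun x _ => by simp⟩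
  have hGm := memLp_of_continuousOn (hprim.continuousOn hL.le)
  refine ⟨?_, hmean⟩
  have hc := ae_eq_const_of_integral_mul_deriv hL (hw.sub hGm) fun φ hφ hp => by
    have hdc : Continuous (deriv φ) := hφ.continuous_deriv (by simp)
    have e1 := h.2.2 φ hφ hp
    rw [iteratedDeriv_one, pow_one] at e1
    have e2 := hprim.integral_mul hL.le ⟨le_rfl, hL.le⟩ ⟨hL.le, le_rfl⟩
      (fun x => ((hφ.differentiable (by simp)) x).hasDerivAt) hdc
    simp only [integral_same, zero_mul, hmean, zero_sub, sub_zero] at e2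
    simp_rw [Pi.sub_apply, sub_mul]
    rw [intervalIntegral.integral_sub (hwi.mul_continuousOn hdc.continuousOn)
      ((intervalIntegrable_of_memLp hL.le hGm).mul_continuousOn hdc.continuousOn), e1, e2]
    ring
  refine ⟨(∫ x in (0 : ℝ)..L, (w - fun x => ∫ s in (0 : ℝ)..x, g s) x) / L, ?_⟩
  filter_upwards [hc] with x hx
  rw [← hx]
  simp

end Primitives

/-! ### Gauss–Radau projections on an interval. -/

section Radau

open MeasureTheory Set intervalIntegral Polynomial

/-- The functionals fixing the Gauss–Radau projection on `[0, 1]`: moments of order below `k` and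
the value at `1`. -/
noncomputable def radauCoef (k : ℕ) (w : ℝ → ℝ) (i : Fin (k + 1)) : ℝ :=
  if (i : ℕ) < k then ∫ x in (0 : ℝ)..1, w x * x ^ (i : ℕ) else w 1

theorem intervalIntegrable_mul_pow {w : ℝ → ℝ} (hw : ContinuousOn w (Icc 0 1)) (i : ℕ) :
    IntervalIntegrable (fun x => w x * x ^ i) volume 0 1 := by
  refine ContinuousOn.intervalIntegrable ?_
  rw [uIcc_of_le zero_le_one]
  fun_prop

theorem radauCoef_sub {k : ℕ} {w w' : ℝ → ℝ} (hw : ContinuousOn w (Icc 0 1))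
    (hw' : ContinuousOn w' (Icc 0 1)) (i : Fin (k + 1)) :
    radauCoef k (fun x => w x - w' x) i = radauCoef k w i - radauCoef k w' i := by
  unfold radauCoef
  split_ifs
  · simp_rw [sub_mul]
    exact intervalIntegral.integral_sub (intervalIntegrable_mul_pow hw _)
      (intervalIntegrable_mul_pow hw' _)
  · rfl

theorem radauCoef_add {k : ℕ} {w w' : ℝ → ℝ} (hw : ContinuousOn w (Icc 0 1))
    (hw' : ContinuousOn w' (Icc 0 1)) (i : Fin (k + 1)) :
    radauCoef k (fun x => w x + w' x) i = radauCoef k w i + radauCoef k w' i := by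
  unfold radauCoef
  split_ifs
  · simp_rw [add_mul]
    exact intervalIntegral.integral_add (intervalIntegrable_mul_pow hw _)
      (intervalIntegrable_mul_pow hw' _)
  · rfl

theorem radauCoef_const_mul {k : ℕ} (c : ℝ) (w : ℝ → ℝ) (i : Fin (k + 1)) :
    radauCoef k (fun x => c * w x) i = c * radauCoef k w i := by
  unfold radauCoef
  split_ifs
  · simp_rw [mul_assoc]
    exact intervalIntegral.integral_const_mul _ _
  · rfl

theorem abs_radauCoef_le {k : ℕ} {w : ℝ → ℝ} {δ : ℝ} (h : ∀ x ∈ Icc (0 : ℝ) 1, |w x| ≤ δ)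
    (i : Fin (k + 1)) : |radauCoef k w i| ≤ δ := by
  have hδ : 0 ≤ δ := (abs_nonneg _).trans (h 0 (by simp))
  unfold radauCoef
  split_ifs
  · have := norm_integral_le_of_norm_le_const (a := 0) (b := 1) (C := δ)
      (f := fun x : ℝ => w x * x ^ (i : ℕ)) (fun x hx => by
        rw [uIoc_of_le zero_le_one] at hx
        have hx' := Ioc_subset_Icc_self hx
        rw [Real.norm_eq_abs, abs_mul, abs_of_nonneg (pow_nonneg hx'.1 _)]
        have h1 : x ^ (i : ℕ) ≤ 1 := pow_le_one₀ hx'.1 hx'.2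
        calc |w x| * x ^ (i : ℕ) ≤ δ * 1 := by gcongr; exacts [pow_nonneg hx'.1 _, h x hx']
          _ = δ := mul_one δ)
    simpa using this
  · exact h 1 (by simp)

theorem integral_mul_eq_zero_of_moments {k : ℕ} {w : ℝ → ℝ} (hw : ContinuousOn w (Icc 0 1))
    (h : ∀ i < k, ∫ x in (0 : ℝ)..1, w x * x ^ i = 0) {v : ℝ[X]} (hv : v.degree < k) :
    ∫ x in (0 : ℝ)..1, w x * v.eval x = 0 := by
  have e : ∀ x, w x * v.eval x = ∑ i ∈ Finset.range k, v.coeff i * (w x * x ^ i) := by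
    intro x
    have hk : v.eval x = ∑ i ∈ Finset.range k, v.coeff i * x ^ i := by
      rcases eq_or_ne v 0 with rfl | h0
      · simp
      · exact eval_eq_sum_range' ((natDegree_lt_iff_degree_lt h0).mpr hv) x
    rw [hk, Finset.mul_sum]
    exact Finset.sum_congr rfl fun i _ => by ring
  simp_rw [e]
  rw [integral_finsetSum fun i _ => (intervalIntegrable_mul_pow hw i).const_mul _]
  refine Finset.sum_eq_zero fun i hi => ?_
  rw [intervalIntegral.integral_const_mul, h i (Finset.mem_range.mp hi), mul_zero]

/-- Unisolvence: `q(1) = 0` gives `q = (x-1) r` with `r` of degree below `k`, and the vanishing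
moments then give `∫ (1-x) r² = 0`. -/
theorem eq_zero_of_radauCoef_eq_zero {k : ℕ} {q : ℝ[X]} (hq : q.natDegree ≤ k)
    (h : ∀ i, radauCoef k (fun x => q.eval x) i = 0) : q = 0 := by
  by_contra hq0
  have h1 : q.eval 1 = 0 := by simpa [radauCoef] using h (Fin.last k)
  have hmom : ∀ i < k, ∫ x in (0 : ℝ)..1, q.eval x * x ^ i = 0 := by
    intro i hi
    simpa [radauCoef, hi] using h ⟨i, by omega⟩
  obtain ⟨r, hr⟩ := dvd_iff_isRoot.mpr (show IsRoot q 1 from h1)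
  have hr0 : r ≠ 0 := by rintro rfl; simp [hr] at hq0
  have hdeg : r.degree < k := by
    rw [← natDegree_lt_iff_degree_lt hr0]
    have : q.natDegree = 1 + r.natDegree := by
      rw [hr, natDegree_mul (X_sub_C_ne_zero 1) hr0, natDegree_X_sub_C]
    omega
  have hz := integral_mul_eq_zero_of_moments q.continuous.continuousOn hmom hdeg
  obtain ⟨c, hc, hrc⟩ : ∃ c ∈ Ioo (0 : ℝ) 1, r.eval c ≠ 0 := by
    by_contra hcon
    push Not at hcon
    exact hr0 (eq_zero_of_infinite_isRoot r
      ((Ioo_infinite (zero_lt_one (α := ℝ))).mono fun c hc => hcon c hc))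
  have hpos : 0 < ∫ x in (0 : ℝ)..1, (1 - x) * (r.eval x) ^ 2 := by
    refine intervalIntegral.integral_pos zero_lt_one (by fun_prop) (fun x hx => ?_)
      ⟨c, Ioo_subset_Icc_self hc, ?_⟩
    · have : 0 ≤ 1 - x := by linarith [hx.2]
      positivity
    · have : 0 < 1 - c := by linarith [hc.2]
      positivity
  have e : ∫ x in (0 : ℝ)..1, (1 - x) * (r.eval x) ^ 2 = - ∫ x in (0 : ℝ)..1, q.eval x * r.eval x := by
    rw [← intervalIntegral.integral_neg]
    refine integral_congr fun x _ => ?_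
    simp only [hr, eval_mul, eval_sub, eval_X, eval_C]
    ring
  rw [e, hz] at hpos
  simp at hpos

/-- An injective endomorphism of a finite-dimensional space is surjective, so unisolvence already
yields a dual basis. -/
theorem exists_radauBasis (k : ℕ) : ∃ b : Fin (k + 1) → ℝ[X], (∀ i, (b i).natDegree ≤ k) ∧
    ∀ i j, radauCoef k (fun x => (b i).eval x) j = if i = j then 1 else 0 := by
  let F : (Fin (k + 1) → ℝ) →ₗ[ℝ] (Fin (k + 1) → ℝ) :=
    { toFun := fun y => radauCoef k fun x => (((degreeLTEquiv ℝ (k + 1)).symm y : ℝ[X])).eval x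
      map_add' := fun y z => by
        ext j
        simp only [map_add, Submodule.coe_add, eval_add, Pi.add_apply]
        exact radauCoef_add (Polynomial.continuous _).continuousOn
          (Polynomial.continuous _).continuousOn j
      map_smul' := fun c y => by
        ext j
        simp only [map_smul, Submodule.coe_smul, eval_smul, smul_eq_mul, Pi.smul_apply,
          RingHom.id_apply]
        exact radauCoef_const_mul c _ j }
  have hdeg : ∀ y, ((degreeLTEquiv ℝ (k + 1)).symm y : ℝ[X]).natDegree ≤ k := fun y => by
    have := mem_degreeLT.mp ((degreeLTEquiv ℝ (k + 1)).symm y).2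
    rcases eq_or_ne ((degreeLTEquiv ℝ (k + 1)).symm y : ℝ[X]) 0 with h0 | h0
    · simp [h0]
    · exact Nat.lt_succ_iff.mp ((natDegree_lt_iff_degree_lt h0).mpr this)
  have hinj : Function.Injective F := by
    rw [← LinearMap.ker_eq_bot, LinearMap.ker_eq_bot']
    intro y hy
    have h0 := eq_zero_of_radauCoef_eq_zero (hdeg y) fun i => congrFun hy i
    have : (degreeLTEquiv ℝ (k + 1)).symm y = 0 := Subtype.ext h0
    simpa using this
  have hsurj := LinearMap.injective_iff_surjective.mp hinj
  choose y hy using fun i : Fin (k + 1) => hsurj (Pi.single i 1)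
  refine ⟨fun i => ((degreeLTEquiv ℝ (k + 1)).symm (y i) : ℝ[X]), fun i => hdeg _, fun i j => ?_⟩
  have := congrFun (hy i) j
  rw [Pi.single_apply] at this
  simpa [F, eq_comm] using this

/-- The dual basis of the Gauss–Radau functionals. -/
noncomputable def radauBasis (k : ℕ) : Fin (k + 1) → ℝ[X] := (exists_radauBasis k).choose

theorem natDegree_radauBasis_le (k : ℕ) (i : Fin (k + 1)) : (radauBasis k i).natDegree ≤ k :=
  (exists_radauBasis k).choose_spec.1 i

theorem radauCoef_radauBasis (k : ℕ) (i j : Fin (k + 1)) :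
    radauCoef k (fun x => (radauBasis k i).eval x) j = if i = j then 1 else 0 :=
  (exists_radauBasis k).choose_spec.2 i j

/-- The Gauss–Radau projection on `[0, 1]`. -/
noncomputable def refRadau (k : ℕ) (w : ℝ → ℝ) : ℝ[X] :=
  ∑ i, C (radauCoef k w i) * radauBasis k i

theorem natDegree_refRadau_le (k : ℕ) (w : ℝ → ℝ) : (refRadau k w).natDegree ≤ k :=
  natDegree_sum_le_of_forall_le _ _ fun i _ =>
    (natDegree_C_mul_le _ _).trans (natDegree_radauBasis_le k i)

theorem radauCoef_refRadau (k : ℕ) (w : ℝ → ℝ) (j : Fin (k + 1)) :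
    radauCoef k (fun x => (refRadau k w).eval x) j = radauCoef k w j := by
  have key : ∀ s : Finset (Fin (k + 1)),
      radauCoef k (fun x => (∑ i ∈ s, C (radauCoef k w i) * radauBasis k i).eval x) j
        = ∑ i ∈ s, radauCoef k w i * (if i = j then 1 else 0) := by
    intro s
    induction s using Finset.cons_induction with
    | empty => simp [radauCoef]
    | cons a s ha ih =>
      rw [Finset.sum_cons, Finset.sum_cons]
      simp only [eval_add, eval_mul, eval_C] at ih ⊢
      rw [radauCoef_add (Continuous.continuousOn (by fun_prop))
        (Polynomial.continuous _).continuousOn, ih, radauCoef_const_mul, radauCoef_radauBasis]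
  rw [refRadau, key]
  simp

theorem refRadau_eval_self {k : ℕ} {q : ℝ[X]} (hq : q.natDegree ≤ k) :
    refRadau k (fun x => q.eval x) = q := by
  rw [← sub_eq_zero]
  refine eq_zero_of_radauCoef_eq_zero (k := k)
    ((natDegree_sub_le _ _).trans (max_le (natDegree_refRadau_le _ _) hq)) fun i => ?_
  simp only [eval_sub]
  rw [radauCoef_sub (Polynomial.continuous _).continuousOn (Polynomial.continuous _).continuousOn,
    radauCoef_refRadau, sub_self]

theorem refRadau_sub {k : ℕ} {w w' : ℝ → ℝ} (hw : ContinuousOn w (Icc 0 1))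
    (hw' : ContinuousOn w' (Icc 0 1)) :
    refRadau k (fun x => w x - w' x) = refRadau k w - refRadau k w' := by
  simp only [refRadau, radauCoef_sub hw hw', map_sub, sub_mul, Finset.sum_sub_distrib]

theorem refRadau_const_mul {k : ℕ} (c : ℝ) (w : ℝ → ℝ) :
    refRadau k (fun x => c * w x) = C c * refRadau k w := by
  simp only [refRadau, radauCoef_const_mul, map_mul, Finset.mul_sum, mul_assoc]

theorem refRadau_eval_one (k : ℕ) (w : ℝ → ℝ) : (refRadau k w).eval 1 = w 1 := by
  simpa [radauCoef] using radauCoef_refRadau k w (Fin.last k)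

theorem integral_sub_refRadau_mul {k : ℕ} {w : ℝ → ℝ} (hw : ContinuousOn w (Icc 0 1)) {v : ℝ[X]}
    (hv : v.degree < k) : ∫ x in (0 : ℝ)..1, (w x - (refRadau k w).eval x) * v.eval x = 0 := by
  refine integral_mul_eq_zero_of_moments (hw.sub (Polynomial.continuous _).continuousOn)
    (fun i hi => ?_) hv
  have h1 := radauCoef_sub (k := k) hw (refRadau k w).continuous.continuousOn ⟨i, by omega⟩
  rw [radauCoef_refRadau, sub_self] at h1
  simpa [radauCoef, hi] using h1

/-- Each functional is bounded by the maximum norm and the basis is fixed, so the constant depends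
on `k` alone; scaling transfers it to all cells. -/
theorem exists_refRadau_bound (k : ℕ) : ∃ K : ℝ, 0 < K ∧ ∀ (w : ℝ → ℝ) (δ : ℝ),
    (∀ x ∈ Icc (0 : ℝ) 1, |w x| ≤ δ) → ∀ x ∈ Icc (0 : ℝ) 1, |(refRadau k w).eval x| ≤ K * δ := by
  choose B hB using fun i : Fin (k + 1) =>
    isCompact_Icc.exists_bound_of_continuousOn (s := Icc (0 : ℝ) 1)
      (radauBasis k i).continuous.continuousOn
  have hB0 : ∀ i, 0 ≤ B i := fun i => (norm_nonneg _).trans (hB i 0 (by simp))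
  refine ⟨∑ i, B i + 1, by have := Finset.sum_nonneg fun i (_ : i ∈ Finset.univ) => hB0 i; linarith,
    fun w δ h x hx => ?_⟩
  have hδ : 0 ≤ δ := (abs_nonneg _).trans (h 0 (by simp))
  rw [refRadau, eval_finsetSum]
  calc |∑ i, (C (radauCoef k w i) * radauBasis k i).eval x|
      ≤ ∑ i, |(C (radauCoef k w i) * radauBasis k i).eval x| := Finset.abs_sum_le_sum_abs _ _
    _ ≤ ∑ i, B i * δ := by
        refine Finset.sum_le_sum fun i _ => ?_
        rw [eval_mul, eval_C, abs_mul, mul_comm]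
        have := abs_radauCoef_le h i
        have := hB i x hx
        rw [Real.norm_eq_abs] at this
        have := hB0 i
        gcongr
    _ ≤ (∑ i, B i + 1) * δ := by rw [← Finset.sum_mul]; gcongr; linarith

/-- The Gauss–Radau projection on the interval with end points `c`, `c + d`, exact at `c + d`. -/
noncomputable def radau (k : ℕ) (c d : ℝ) (w : ℝ → ℝ) : ℝ[X] :=
  (refRadau k fun s => w (c + d * s)).comp (C d⁻¹ * (X - C c))

variable {k : ℕ} {c d : ℝ}

theorem eval_radau (hd : d ≠ 0) (w : ℝ → ℝ) (s : ℝ) :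
    (radau k c d w).eval (c + d * s) = (refRadau k fun s => w (c + d * s)).eval s := by
  simp only [radau, eval_comp, eval_mul, eval_C, eval_sub, eval_X]
  congr 1
  field_simp
  ring

theorem natDegree_radau_le (w : ℝ → ℝ) : (radau k c d w).natDegree ≤ k := by
  refine natDegree_comp_le.trans ?_
  have h1 : (C d⁻¹ * (X - C c)).natDegree ≤ 1 :=
    (natDegree_C_mul_le _ _).trans (natDegree_X_sub_C c).le
  have h2 := natDegree_refRadau_le k fun s => w (c + d * s)
  calc _ ≤ k * 1 := Nat.mul_le_mul h2 h1
    _ = k := mul_one k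

theorem eval_radau_end (hd : d ≠ 0) (w : ℝ → ℝ) : (radau k c d w).eval (c + d) = w (c + d) := by
  have := eval_radau (k := k) (c := c) hd w 1
  rw [refRadau_eval_one] at this
  simpa using this

theorem mapsTo_affine (c d : ℝ) : MapsTo (fun s => c + d * s) (Icc 0 1) (uIcc c (c + d)) := by
  intro s hs
  rw [mem_uIcc]
  rcases le_total 0 d with h | h
  · left; constructor <;> nlinarith [hs.1, hs.2]
  · right; constructor <;> nlinarith [hs.1, hs.2]

theorem continuousOn_affine {w : ℝ → ℝ} (hw : ContinuousOn w (uIcc c (c + d))) :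
    ContinuousOn (fun s => w (c + d * s)) (Icc 0 1) :=
  hw.comp (by fun_prop) (mapsTo_affine c d)

theorem radau_sub {w w' : ℝ → ℝ} (hw : ContinuousOn w (uIcc c (c + d)))
    (hw' : ContinuousOn w' (uIcc c (c + d))) :
    radau k c d (fun x => w x - w' x) = radau k c d w - radau k c d w' := by
  simp only [radau]
  rw [refRadau_sub (continuousOn_affine hw) (continuousOn_affine hw'), sub_comp]

theorem radau_const_mul (a : ℝ) (w : ℝ → ℝ) :
    radau k c d (fun x => a * w x) = C a * radau k c d w := by
  simp only [radau]
  rw [refRadau_const_mul a, mul_comp, C_comp]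

theorem integral_sub_radau_mul (hd : d ≠ 0) {w : ℝ → ℝ} (hw : ContinuousOn w (uIcc c (c + d)))
    {v : ℝ[X]} (hv : v.degree < k) :
    ∫ x in c..(c + d), (w x - (radau k c d w).eval x) * v.eval x = 0 := by
  have h := mul_integral_comp_add_mul (a := 0) (b := 1)
    (f := fun x => (w x - (radau k c d w).eval x) * v.eval x) d c
  simp only [mul_zero, add_zero, mul_one] at h
  rw [← h]
  simp only [eval_radau hd]
  have hv' : (v.comp (C c + C d * X)).degree < k := by
    rcases eq_or_ne v 0 with rfl | hv0
    · simp
    · have h1 : (v.comp (C c + C d * X)).natDegree ≤ v.natDegree := by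
        refine natDegree_comp_le.trans ?_
        have : (C c + C d * X).natDegree ≤ 1 := by
          rw [add_comm]; exact natDegree_linear_le
        calc _ ≤ v.natDegree * 1 := Nat.mul_le_mul_left _ this
          _ = _ := mul_one _
      have h2 := (natDegree_lt_iff_degree_lt hv0).mpr hv
      exact degree_le_natDegree.trans_lt (by exact_mod_cast h1.trans_lt h2)
  have := integral_sub_refRadau_mul (continuousOn_affine hw) hv'
  simp only [eval_comp, eval_add, eval_C, eval_mul, eval_X] at this
  rw [this, mul_zero]

theorem exists_affine_eq (hd : d ≠ 0) {x : ℝ} (hx : x ∈ uIcc c (c + d)) :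
    ∃ s ∈ Icc (0 : ℝ) 1, x = c + d * s := by
  refine ⟨(x - c) / d, ?_, by field_simp; ring⟩
  rw [mem_uIcc] at hx
  rcases lt_or_gt_of_ne hd with h | h
  · rcases hx with hx | hx
    · constructor
      · exact div_nonneg_of_nonpos (by linarith) h.le
      · rw [div_le_one_of_neg h]; linarith
    · constructor
      · exact div_nonneg_of_nonpos (by linarith) h.le
      · rw [div_le_one_of_neg h]; linarith
  · rcases hx with hx | hx
    · constructor
      · exact div_nonneg (by linarith) h.le
      · rw [div_le_one h]; linarith
    · constructor
      · exact div_nonneg (by linarith) h.le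
      · rw [div_le_one h]; linarith

/-- The Gauss–Radau projection is quasi-optimal in the maximum norm. -/
theorem exists_radau_quasi_optimal (k : ℕ) : ∃ K : ℝ, 0 < K ∧ ∀ (c d : ℝ), d ≠ 0 →
    ∀ w : ℝ → ℝ, ContinuousOn w (uIcc c (c + d)) → ∀ (δ : ℝ) (q : ℝ[X]), q.natDegree ≤ k →
      (∀ x ∈ uIcc c (c + d), |w x - q.eval x| ≤ δ) →
      ∀ x ∈ uIcc c (c + d), |w x - (radau k c d w).eval x| ≤ K * δ := by
  obtain ⟨K, hK, hb⟩ := exists_refRadau_bound k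
  refine ⟨1 + K, by linarith, fun c d hd w hw δ q hq h x hx => ?_⟩
  -- Polynomials are reproduced, so the error of `w` equals that of `w - q`; hence the constant `1 +
  -- K`.
  have hqr : radau k c d (fun x => q.eval x) = q := by
    have hdeg : (q.comp (C c + C d * X)).natDegree ≤ k := by
      refine natDegree_comp_le.trans ?_
      have : (C c + C d * X).natDegree ≤ 1 := by
        rw [add_comm]; exact natDegree_linear_le
      calc _ ≤ k * 1 := Nat.mul_le_mul hq this
        _ = _ := mul_one _
    have e := refRadau_eval_self hdeg
    simp only [eval_comp, eval_add, eval_C, eval_mul, eval_X] at e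
    rw [radau, e, comp_assoc]
    have : (C c + C d * X).comp (C d⁻¹ * (X - C c)) = (X : ℝ[X]) := by
      simp only [add_comp, mul_comp, C_comp, X_comp]
      rw [← mul_assoc, ← C_mul, mul_inv_cancel₀ hd, C_1]
      ring
    rw [this, comp_X]
  obtain ⟨s, hs, rfl⟩ := exists_affine_eq hd hx
  have h1 := h _ hx
  have h2 : |(radau k c d fun x => w x - q.eval x).eval (c + d * s)| ≤ K * δ := by
    rw [eval_radau hd]
    exact hb _ δ (fun y hy => h _ (mapsTo_affine c d hy)) s hs
  rw [radau_sub hw q.continuous.continuousOn, hqr, eval_sub] at h2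
  calc |w (c + d * s) - (radau k c d w).eval (c + d * s)|
      = |(w (c + d * s) - q.eval (c + d * s))
          - ((radau k c d w).eval (c + d * s) - q.eval (c + d * s))| := by ring_nf
    _ ≤ |w (c + d * s) - q.eval (c + d * s)|
          + |(radau k c d w).eval (c + d * s) - q.eval (c + d * s)| := abs_sub _ _
    _ ≤ (1 + K) * δ := by linarith

theorem exists_derivative_eq (q : ℝ[X]) : ∃ Q : ℝ[X], derivative Q = q ∧
    Q.natDegree ≤ q.natDegree + 1 := by
  refine ⟨∑ i ∈ Finset.range (q.natDegree + 1), monomial (i + 1) (q.coeff i / (i + 1)), ?_, ?_⟩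
  · rw [derivative_sum]
    conv_rhs => rw [q.as_sum_range]
    refine Finset.sum_congr rfl fun i _ => ?_
    rw [derivative_monomial]
    congr 1
    push_cast
    field_simp
  · refine natDegree_sum_le_of_forall_le _ _ fun i hi => (natDegree_monomial_le _).trans ?_
    exact Finset.mem_range.mp hi

/-- Polynomial approximation of a function with `k + 1` successive (weak) derivatives. -/
theorem exists_polynomial_approx {L a b : ℝ} (hab : a ≤ b) (ha : a ∈ Icc 0 L) (hb : b ∈ Icc 0 L)
    (k : ℕ) : ∀ w : ℕ → ℝ → ℝ, (∀ j < k + 1, IsPrimitive L (w j) (w (j + 1))) →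
      ∃ q : ℝ[X], q.natDegree ≤ k ∧ ∀ x ∈ Icc a b,
        |w 0 x - q.eval x| ≤ (b - a) ^ k * ∫ s in a..b, |w (k + 1) s| := by
  induction k with
  | zero =>
    intro w hw
    have h0 := hw 0 (by omega)
    refine ⟨C (w 0 a), by simp, fun x hx => ?_⟩
    have hx' : x ∈ Icc 0 L := ⟨ha.1.trans hx.1, hx.2.trans hb.2⟩
    rw [eval_C, h0.sub_eq ha hx', pow_zero, one_mul, zero_add]
    refine (abs_integral_le_integral_abs hx.1).trans ?_
    exact integral_mono_interval le_rfl hx.1 hx.2 (Filter.Eventually.of_forall fun _ => abs_nonneg _)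
      (intervalIntegrable_of_Icc h0.1 ha hb).abs
  | succ k ih =>
    intro w hw
    -- The derivative `w 1` is approximated first; an antiderivative of `q` matched to `w 0` at `a`
    -- gains one factor `b - a`.
    obtain ⟨q, hq, h⟩ := ih (fun j => w (j + 1)) fun j hj => hw (j + 1) (by omega)
    obtain ⟨Q, hQ, hQd⟩ := exists_derivative_eq q
    have h0 := hw 0 (by omega)
    refine ⟨Q + C (w 0 a - Q.eval a), ?_, fun x hx => ?_⟩
    · rw [natDegree_add_C]; omega
    · have hx' : x ∈ Icc 0 L := ⟨ha.1.trans hx.1, hx.2.trans hb.2⟩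
      have hQi : ∫ s in a..x, q.eval s = Q.eval x - Q.eval a := by
        refine integral_eq_sub_of_hasDerivAt (f := fun s => Q.eval s) (fun s _ => ?_) (q.continuous.intervalIntegrable _ _)
        rw [← hQ]; exact Q.hasDerivAt s
      have e : w 0 x - (Q + C (w 0 a - Q.eval a)).eval x = ∫ s in a..x, (w 1 s - q.eval s) := by
        rw [intervalIntegral.integral_sub (intervalIntegrable_of_Icc h0.1 ha hx')
          (q.continuous.intervalIntegrable _ _), ← h0.sub_eq ha hx', hQi, eval_add, eval_C]
        ring
      rw [e]
      have := norm_integral_le_of_norm_le_const (a := a) (b := x)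
        (C := (b - a) ^ k * ∫ s in a..b, |w (k + 1 + 1) s|) (f := fun s => w 1 s - q.eval s)
        (fun s hs => by
          rw [uIoc_of_le hx.1] at hs
          exact h s ⟨hs.1.le, hs.2.trans hx.2⟩)
      rw [Real.norm_eq_abs] at this
      refine this.trans ?_
      have hI : 0 ≤ ∫ s in a..b, |w (k + 1 + 1) s| :=
        integral_nonneg hab fun _ _ => abs_nonneg _
      have hba : 0 ≤ b - a := by linarith
      rw [abs_of_nonneg (by linarith [hx.1]), pow_succ]
      calc _ ≤ ((b - a) ^ k * ∫ s in a..b, |w (k + 1 + 1) s|) * (b - a) := by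
            gcongr; exact hx.2
        _ = _ := by ring

/-- Cauchy–Schwarz as nonnegativity of the variance of `|g|`. -/
theorem sq_integral_abs_le {a b : ℝ} (hab : a ≤ b) {g : ℝ → ℝ}
    (hg : IntervalIntegrable g volume a b)
    (hg2 : IntervalIntegrable (fun x => g x ^ 2) volume a b) :
    (∫ s in a..b, |g s|) ^ 2 ≤ (b - a) * ∫ s in a..b, g s ^ 2 := by
  rcases hab.eq_or_lt with rfl | hlt
  · simp
  set I := ∫ s in a..b, |g s|
  set m := I / (b - a)
  have hba : 0 < b - a := by linarith
  have h0 : 0 ≤ ∫ s in a..b, (|g s| - m) ^ 2 := integral_nonneg hab fun _ _ => sq_nonneg _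
  have e : ∫ s in a..b, (|g s| - m) ^ 2 = (∫ s in a..b, g s ^ 2) - 2 * m * I + m ^ 2 * (b - a) := by
    have e1 : ∀ s, (|g s| - m) ^ 2 = g s ^ 2 - 2 * m * |g s| + m ^ 2 := by
      intro s; rw [sub_sq, sq_abs]; ring
    simp_rw [e1]
    rw [intervalIntegral.integral_add (hg2.sub (hg.abs.const_mul _)) (by simp),
      intervalIntegral.integral_sub hg2 (hg.abs.const_mul _), intervalIntegral.integral_const_mul,
      intervalIntegral.integral_const, smul_eq_mul]
    ring
  rw [e] at h0
  have hm : m * (b - a) = I := div_mul_cancel₀ _ hba.ne'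
  have : 0 ≤ (b - a) * ((∫ s in a..b, g s ^ 2) - 2 * m * I + m ^ 2 * (b - a)) := by positivity
  nlinarith [this]

/-- Local error estimate of the Gauss–Radau projection. -/
theorem exists_radau_error_bound (k : ℕ) : ∃ K : ℝ, 0 < K ∧ ∀ (L c d a b : ℝ), d ≠ 0 → a ≤ b →
    uIcc c (c + d) = Icc a b → a ∈ Icc 0 L → b ∈ Icc 0 L →
    ∀ w : ℕ → ℝ → ℝ, (∀ j < k + 1, IsPrimitive L (w j) (w (j + 1))) →
      ContinuousOn (w 0) (Icc 0 L) →
      IntervalIntegrable (fun x => w (k + 1) x ^ 2) volume 0 L →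
      ∫ x in a..b, (w 0 x - (radau k c d (w 0)).eval x) ^ 2
        ≤ K * (b - a) ^ (2 * (k + 1)) * ∫ x in a..b, w (k + 1) x ^ 2 := by
  obtain ⟨K, hK, hopt⟩ := exists_radau_quasi_optimal k
  refine ⟨K ^ 2, by positivity, fun L c d a b hd hab hu ha hb w hw hc h2 => ?_⟩
  obtain ⟨q, hq, h⟩ := exists_polynomial_approx hab ha hb k w hw
  have hsub : Icc a b ⊆ Icc 0 L := Icc_subset_Icc ha.1 hb.2
  have hc' : ContinuousOn (w 0) (uIcc c (c + d)) := by rw [hu]; exact hc.mono hsub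
  set I := ∫ s in a..b, |w (k + 1) s|
  have hpt := hopt c d hd (w 0) hc' _ q hq (by rw [hu]; exact h)
  rw [hu] at hpt
  have hI := sq_integral_abs_le hab (intervalIntegrable_of_Icc (hw k (by omega)).1 ha hb)
    (intervalIntegrable_of_Icc h2 ha hb)
  have hba : 0 ≤ b - a := by linarith
  have hcc : ContinuousOn (fun x => (w 0 x - (radau k c d (w 0)).eval x) ^ 2) (uIcc a b) := by
    rw [uIcc_of_le hab]
    exact ((hc.mono hsub).sub (Polynomial.continuous _).continuousOn).pow 2
  calc ∫ x in a..b, (w 0 x - (radau k c d (w 0)).eval x) ^ 2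
      ≤ ∫ x in a..b, (K * ((b - a) ^ k * I)) ^ 2 := by
        refine integral_mono_on hab hcc.intervalIntegrable (by simp) fun x hx => ?_
        rw [← sq_abs]
        gcongr
        exact hpt x hx
    -- The exponent is `2k` from the squared pointwise bound and `1` from the length of the cell;
    -- Cauchy–Schwarz adds the last factor `b - a`.
    _ = K ^ 2 * (b - a) ^ (2 * k + 1) * I ^ 2 := by
        rw [intervalIntegral.integral_const, smul_eq_mul]; ring
    _ ≤ K ^ 2 * (b - a) ^ (2 * k + 1) * ((b - a) * ∫ s in a..b, w (k + 1) s ^ 2) := by gcongr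
    _ = _ := by ring

end Radau

/-! ### The mesh, discrete derivatives and cellwise projections. -/

section MeshLemmas

open MeasureTheory Set intervalIntegral Polynomial

namespace Mesh

variable {L : ℝ} {N : ℕ} (𝒯 : Mesh L N)

theorem left_lt_right (j : Fin N) : 𝒯.left j < 𝒯.right j :=
  𝒯.strictMono Fin.castSucc_lt_succ

theorem node_mem (i : Fin (N + 1)) : 𝒯.node i ∈ Icc 0 L :=
  ⟨𝒯.first.symm.trans_le (𝒯.strictMono.monotone (Fin.zero_le i)),
    (𝒯.strictMono.monotone (Fin.le_last i)).trans_eq 𝒯.last⟩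

theorem left_mem (j : Fin N) : 𝒯.left j ∈ Icc 0 L := 𝒯.node_mem _

theorem right_mem (j : Fin N) : 𝒯.right j ∈ Icc 0 L := 𝒯.node_mem _

theorem cell_subset (j : Fin N) : Icc (𝒯.left j) (𝒯.right j) ⊆ Icc 0 L :=
  Icc_subset_Icc (𝒯.left_mem j).1 (𝒯.right_mem j).2

theorem cell_le_size (j : Fin N) : 𝒯.right j - 𝒯.left j ≤ 𝒯.size :=
  le_ciSup (f := fun j : Fin N => 𝒯.right j - 𝒯.left j) (finite_range _).bddAbove j

theorem size_nonneg : 0 ≤ 𝒯.size :=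
  Real.iSup_nonneg fun j => (sub_pos.mpr (𝒯.left_lt_right j)).le

theorem sum_integral_cells {f : ℝ → ℝ} (hf : IntervalIntegrable f volume 0 L) :
    ∑ j, ∫ x in (𝒯.left j)..(𝒯.right j), f x = ∫ x in (0 : ℝ)..L, f x := by
  -- The default `0` beyond index `N` is never evaluated.
  set a : ℕ → ℝ := fun i => if h : i < N + 1 then 𝒯.node ⟨i, h⟩ else 0 with ha
  have hmem : ∀ i, i < N + 1 → a i ∈ Icc 0 L := fun i hi => by
    simp only [ha, hi, dite_true]; exact 𝒯.node_mem _
  have h := sum_integral_adjacent_intervals (f := f) (μ := volume) (a := a) (n := N)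
    fun i hi => intervalIntegrable_of_Icc hf (hmem i (by omega)) (hmem (i + 1) (by omega))
  have h0 : a 0 = 0 := by simpa [ha] using 𝒯.first
  have hN : a N = L := by simpa [ha, Fin.last] using 𝒯.last
  rw [h0, hN] at h
  rw [← h, ← Fin.sum_univ_eq_sum_range (fun i => ∫ x in a i..a (i + 1), f x)]
  refine Finset.sum_congr rfl fun j _ => ?_
  have h1 : a j = 𝒯.left j := by
    have : (j : ℕ) < N + 1 := by omega
    simp only [ha, this, dite_true]; rfl
  have h2 : a (j + 1) = 𝒯.right j := by
    have : (j : ℕ) + 1 < N + 1 := by omega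
    simp only [ha, this, dite_true]; rfl
  rw [h1, h2]

theorem apply_left_finRotate {u : ℝ → ℝ} (hu : u L = u 0) (j : Fin N) :
    u (𝒯.left (finRotate N j)) = u (𝒯.right j) := by
  cases N with
  | zero => exact j.elim0
  | succ n =>
    rcases Fin.eq_castSucc_or_eq_last j with ⟨i, rfl⟩ | rfl
    · have : finRotate (n + 1) i.castSucc = i.succ := by
        rw [finRotate_apply, Fin.coeSucc_eq_succ]
      rw [this]
      rfl
    · rw [finRotate_last]
      have h1 : 𝒯.left 0 = 0 := 𝒯.first
      have h2 : 𝒯.right (Fin.last n) = L := 𝒯.last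
      rw [h1, h2, hu]

/-- Functions that are continuous on each closed cell. -/
def contFn : Submodule ℝ (Fin N → ℝ → ℝ) where
  carrier := {v | ∀ j, ContinuousOn (v j) (Icc (𝒯.left j) (𝒯.right j))}
  add_mem' := fun hv hw j => (hv j).add (hw j)
  zero_mem' := fun _ => continuousOn_const
  smul_mem' := fun c _ hv j => (hv j).const_smul c

theorem intervalIntegrable_cell {j : Fin N} {f : ℝ → ℝ}
    (hf : ContinuousOn f (Icc (𝒯.left j) (𝒯.right j))) :
    IntervalIntegrable f volume (𝒯.left j) (𝒯.right j) := by
  refine ContinuousOn.intervalIntegrable ?_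
  rwa [uIcc_of_le (𝒯.left_lt_right j).le]

/-- Only semidefinite, since values outside the cell do not count; hence the seminorm. -/
noncomputable instance : PreInnerProductSpace.Core ℝ 𝒯.contFn where
  inner v w := 𝒯.innerProd v w
  conj_inner_symm v w := by
    simp only [innerProd, conj_trivial]
    exact Finset.sum_congr rfl fun j _ => integral_congr fun x _ => mul_comm _ _
  re_inner_nonneg v := by
    simp only [innerProd, RCLike.re_to_real]
    exact Finset.sum_nonneg fun j _ =>
      integral_nonneg (𝒯.left_lt_right j).le fun x _ => mul_self_nonneg _
  add_left v w z := by
    simp only [innerProd, Submodule.coe_add, Pi.add_apply, add_mul, ← Finset.sum_add_distrib]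
    exact Finset.sum_congr rfl fun j _ => intervalIntegral.integral_add
      (𝒯.intervalIntegrable_cell ((v.2 j).mul (z.2 j)))
      (𝒯.intervalIntegrable_cell ((w.2 j).mul (z.2 j)))
  smul_left v w c := by
    simp only [innerProd, Submodule.coe_smul, Pi.smul_apply, smul_eq_mul, mul_assoc,
      intervalIntegral.integral_const_mul, Finset.mul_sum, conj_trivial]

noncomputable instance : SeminormedAddCommGroup 𝒯.contFn :=
  InnerProductSpace.Core.toSeminormedAddCommGroup (𝕜 := ℝ)

noncomputable instance : InnerProductSpace ℝ 𝒯.contFn := InnerProductSpace.ofCore inferInstance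

theorem norm_eq (v : 𝒯.contFn) : ‖v‖ = 𝒯.l2norm v := by
  rw [norm_eq_sqrt_real_inner]; rfl

/-- A piecewise polynomial as a cellwise continuous function. -/
noncomputable def polyFn : (Fin N → ℝ[X]) →ₗ[ℝ] 𝒯.contFn where
  toFun v := ⟨cellFun v, fun j => (v j).continuous.continuousOn⟩
  map_add' v w := by ext j x; simp [cellFun]
  map_smul' c v := by ext j x; simp [cellFun]

/-- A function on `[0, L]` as a cellwise continuous function. -/
def globalFn (g : ℝ → ℝ) (hg : ContinuousOn g (Icc 0 L)) : 𝒯.contFn :=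
  ⟨fun _ => g, fun j => hg.mono (𝒯.cell_subset j)⟩

theorem globalFn_norm_le (hL : 0 ≤ L) {g : ℝ → ℝ} (hg : ContinuousOn g (Icc 0 L)) {C : ℝ}
    (hC : ∀ x ∈ Icc 0 L, |g x| ≤ C) : ‖𝒯.globalFn g hg‖ ≤ √L * C := by
  have hC0 : 0 ≤ C := (abs_nonneg _).trans (hC 0 ⟨le_rfl, hL⟩)
  have hi : ContinuousOn (fun x => g x * g x) (uIcc 0 L) := by
    rw [uIcc_of_le hL]; exact hg.mul hg
  rw [norm_eq, l2norm, innerProd]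
  refine Real.sqrt_le_iff.mpr ⟨by positivity, ?_⟩
  change ∑ j, ∫ x in (𝒯.left j)..(𝒯.right j), g x * g x ≤ _
  rw [𝒯.sum_integral_cells hi.intervalIntegrable, mul_pow, Real.sq_sqrt hL]
  calc ∫ x in (0 : ℝ)..L, g x * g x ≤ ∫ x in (0 : ℝ)..L, C ^ 2 := by
        refine integral_mono_on hL hi.intervalIntegrable (by simp) fun x hx => ?_
        rw [← sq, ← sq_abs]
        gcongr
        exact hC x hx
    _ = L * C ^ 2 := by simp

end Mesh

variable {L : ℝ} {N : ℕ} (𝒯 : Mesh L N)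

theorem dgSpace_sub {k : ℕ} {v w : Fin N → ℝ[X]} (hv : v ∈ dgSpace N k) (hw : w ∈ dgSpace N k) :
    v - w ∈ dgSpace N k := fun j =>
  (natDegree_sub_le _ _).trans (max_le (hv j) (hw j))

/-- Integration by parts on each cell leaves end-point products; with alternating fluxes these
cancel after a cyclic shift of the interface sum. -/
theorem formPlus_add_formMinus (p v : Fin N → ℝ[X]) : formPlus 𝒯 p v + formMinus 𝒯 v p = 0 := by
  have h1 : 𝒯.innerProd (cellFun p) (cellDeriv v) + 𝒯.innerProd (cellFun v) (cellDeriv p)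
      = ∑ j, ((p j).eval (𝒯.right j) * (v j).eval (𝒯.right j)
          - (p j).eval (𝒯.left j) * (v j).eval (𝒯.left j)) := by
    simp only [Mesh.innerProd, cellFun, cellDeriv, ← Finset.sum_add_distrib]
    refine Finset.sum_congr rfl fun j _ => ?_
    rw [← intervalIntegral.integral_add (Continuous.intervalIntegrable (by fun_prop) _ _)
      (Continuous.intervalIntegrable (by fun_prop) _ _)]
    refine integral_eq_sub_of_hasDerivAt (f := fun x => (p j).eval x * (v j).eval x)
      (fun x _ => ?_) (Continuous.intervalIntegrable (by fun_prop) _ _)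
    exact (((p j).hasDerivAt x).fun_mul ((v j).hasDerivAt x)).congr_deriv (by ring)
  have h2 : ∑ j, (v ((finRotate N).symm j)).eval (𝒯.right ((finRotate N).symm j))
        * (p j).eval (𝒯.left j)
      = ∑ j, (v j).eval (𝒯.right j) * (p (finRotate N j)).eval (𝒯.left (finRotate N j)) := by
    rw [← Equiv.sum_comp (finRotate N)]
    simp only [Equiv.symm_apply_apply]
  simp only [formPlus, formMinus, dgForm]
  calc _ = (𝒯.innerProd (cellFun p) (cellDeriv v) + 𝒯.innerProd (cellFun v) (cellDeriv p))
        - ∑ j, ((p j).eval (𝒯.right j) * (v j).eval (𝒯.right j)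
          - (p j).eval (𝒯.left j) * (v j).eval (𝒯.left j))
        + ((∑ j, (v ((finRotate N).symm j)).eval (𝒯.right ((finRotate N).symm j))
            * (p j).eval (𝒯.left j))
          - ∑ j, (v j).eval (𝒯.right j) * (p (finRotate N j)).eval (𝒯.left (finRotate N j))) := by
        simp only [Finset.sum_sub_distrib]
        simp only [mul_comm]
        ring
    _ = 0 := by rw [h1, h2]; ring

theorem dgForm_sub (q q' : Fin N → ℝ[X]) (a b a' b' : Fin N → ℝ) (w : Fin N → ℝ[X]) :
    dgForm 𝒯 (q - q') (fun j => a j - a' j) (fun j => b j - b' j) w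
      = dgForm 𝒯 q a b w - dgForm 𝒯 q' a' b' w := by
  have h1 : 𝒯.innerProd (cellFun (q - q')) (cellDeriv w)
      = 𝒯.innerProd (cellFun q) (cellDeriv w) - 𝒯.innerProd (cellFun q') (cellDeriv w) := by
    simp only [Mesh.innerProd, cellFun, cellDeriv, ← Finset.sum_sub_distrib]
    refine Finset.sum_congr rfl fun j _ => ?_
    rw [← intervalIntegral.integral_sub (Continuous.intervalIntegrable (by fun_prop) _ _)
      (Continuous.intervalIntegrable (by fun_prop) _ _)]
    refine integral_congr fun x _ => ?_
    simp only [Pi.sub_apply, eval_sub]; ring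
  simp only [dgForm, h1, sub_mul, Finset.sum_sub_distrib]
  ring

theorem formMinus_sub (q q' w : Fin N → ℝ[X]) :
    formMinus 𝒯 (q - q') w = formMinus 𝒯 q w - formMinus 𝒯 q' w := by
  simp only [formMinus, ← dgForm_sub, Pi.sub_apply, eval_sub]

theorem formPlus_sub (q q' w : Fin N → ℝ[X]) :
    formPlus 𝒯 (q - q') w = formPlus 𝒯 q w - formPlus 𝒯 q' w := by
  simp only [formPlus, ← dgForm_sub, Pi.sub_apply, eval_sub]

/-- The cellwise Gauss–Radau projection that is exact at the right end points. -/
noncomputable def radauRight (k : ℕ) (w : ℝ → ℝ) : Fin N → ℝ[X] :=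
  fun j => radau k (𝒯.left j) (𝒯.right j - 𝒯.left j) w

/-- The cellwise Gauss–Radau projection that is exact at the left end points. -/
noncomputable def radauLeft (k : ℕ) (w : ℝ → ℝ) : Fin N → ℝ[X] :=
  -- The negative length reflects the reference interval, so that exactness falls on the left end
  -- point.
  fun j => radau k (𝒯.right j) (𝒯.left j - 𝒯.right j) w

variable {k : ℕ}

theorem radauRight_mem (w : ℝ → ℝ) : radauRight 𝒯 k w ∈ dgSpace N k :=
  fun _ => natDegree_radau_le w

theorem radauLeft_mem (w : ℝ → ℝ) : radauLeft 𝒯 k w ∈ dgSpace N k :=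
  fun _ => natDegree_radau_le w

theorem degree_derivative_lt_of_natDegree_le {v : ℝ[X]} (hv : v.natDegree ≤ k) :
    (derivative v).degree < k := by
  rcases eq_or_ne (derivative v) 0 with h | h
  · rw [h, degree_zero]; exact WithBot.bot_lt_coe k
  · rw [← natDegree_lt_iff_degree_lt h]
    have : v.natDegree ≠ 0 := fun h0 => h (derivative_of_natDegree_zero h0)
    exact (natDegree_derivative_lt this).trans_le hv

theorem uIcc_cell (j : Fin N) :
    uIcc (𝒯.left j) (𝒯.left j + (𝒯.right j - 𝒯.left j)) = Icc (𝒯.left j) (𝒯.right j) := by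
  rw [add_sub_cancel, uIcc_of_le (𝒯.left_lt_right j).le]

theorem uIcc_cell' (j : Fin N) :
    uIcc (𝒯.right j) (𝒯.right j + (𝒯.left j - 𝒯.right j)) = Icc (𝒯.left j) (𝒯.right j) := by
  rw [add_sub_cancel, uIcc_of_ge (𝒯.left_lt_right j).le]

theorem integral_radauRight_mul {u : ℝ → ℝ} (hu : ContinuousOn u (Icc 0 L)) (j : Fin N) {v : ℝ[X]}
    (hv : v.degree < k) : ∫ x in (𝒯.left j)..(𝒯.right j), (radauRight 𝒯 k u j).eval x * v.eval x
      = ∫ x in (𝒯.left j)..(𝒯.right j), u x * v.eval x := by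
  have hc := hu.mono (𝒯.cell_subset j)
  have h := integral_sub_radau_mul (k := k) (c := 𝒯.left j) (d := 𝒯.right j - 𝒯.left j)
    (sub_pos.mpr (𝒯.left_lt_right j)).ne' (w := u) (by rwa [uIcc_cell]) hv
  rw [add_sub_cancel] at h
  simp_rw [sub_mul] at h
  rw [intervalIntegral.integral_sub (𝒯.intervalIntegrable_cell (hc.fun_mul v.continuous.continuousOn))
    (Continuous.intervalIntegrable (by fun_prop) _ _)] at h
  exact (sub_eq_zero.mp h).symm

theorem integral_radauLeft_mul {u : ℝ → ℝ} (hu : ContinuousOn u (Icc 0 L)) (j : Fin N) {v : ℝ[X]}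
    (hv : v.degree < k) : ∫ x in (𝒯.left j)..(𝒯.right j), (radauLeft 𝒯 k u j).eval x * v.eval x
      = ∫ x in (𝒯.left j)..(𝒯.right j), u x * v.eval x := by
  have hc := hu.mono (𝒯.cell_subset j)
  have h := integral_sub_radau_mul (k := k) (c := 𝒯.right j) (d := 𝒯.left j - 𝒯.right j)
    (sub_neg.mpr (𝒯.left_lt_right j)).ne (w := u) (by rwa [uIcc_cell']) hv
  rw [add_sub_cancel, integral_symm, neg_eq_zero] at h
  simp_rw [sub_mul] at h
  rw [intervalIntegral.integral_sub (𝒯.intervalIntegrable_cell (hc.fun_mul v.continuous.continuousOn))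
    (Continuous.intervalIntegrable (by fun_prop) _ _)] at h
  exact (sub_eq_zero.mp h).symm

theorem eval_radauRight (u : ℝ → ℝ) (j : Fin N) :
    (radauRight 𝒯 k u j).eval (𝒯.right j) = u (𝒯.right j) := by
  have := eval_radau_end (k := k) (c := 𝒯.left j) (sub_pos.mpr (𝒯.left_lt_right j)).ne' u
  rwa [add_sub_cancel] at this

theorem eval_radauLeft (u : ℝ → ℝ) (j : Fin N) :
    (radauLeft 𝒯 k u j).eval (𝒯.left j) = u (𝒯.left j) := by
  have := eval_radau_end (k := k) (c := 𝒯.right j) (sub_neg.mpr (𝒯.left_lt_right j)).ne u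
  rwa [add_sub_cancel] at this

theorem IsPrimitive.integral_cell_mul {u p : ℝ → ℝ} (h : IsPrimitive L u p) (j : Fin N)
    (w : ℝ[X]) : ∫ x in (𝒯.left j)..(𝒯.right j), p x * w.eval x
      = u (𝒯.right j) * w.eval (𝒯.right j) - u (𝒯.left j) * w.eval (𝒯.left j)
        - ∫ x in (𝒯.left j)..(𝒯.right j), u x * (derivative w).eval x :=
  h.integral_mul (𝒯.left_lt_right j).le (𝒯.left_mem j) (𝒯.right_mem j) (fun x => w.hasDerivAt x)
    (derivative w).continuous

/-- Consistency of the discrete derivative with the flux `u⁻` on the Gauss–Radau projection. -/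
theorem formMinus_radauRight (hL : 0 ≤ L) {u p : ℝ → ℝ} (h : IsPrimitive L u p) (hu : u L = u 0)
    {w : Fin N → ℝ[X]} (hw : w ∈ dgSpace N k) :
    formMinus 𝒯 (radauRight 𝒯 k u) w = - 𝒯.innerProd (fun _ => p) (cellFun w) := by
  have hc := h.continuousOn hL
  simp only [formMinus, dgForm, Mesh.innerProd, cellFun, cellDeriv, eval_radauRight,
    ← Finset.sum_sub_distrib, ← Finset.sum_neg_distrib]
  refine Finset.sum_congr rfl fun j _ => ?_
  -- The derivative of the test function has degree below `k`, so the moments replace the projection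
  -- by `u`; the fluxes read it only where it is exact.
  rw [integral_radauRight_mul 𝒯 hc j (degree_derivative_lt_of_natDegree_le (hw j)),
    h.integral_cell_mul 𝒯 j (w j)]
  have := 𝒯.apply_left_finRotate hu ((finRotate N).symm j)
  rw [Equiv.apply_symm_apply] at this
  rw [this]
  ring

/-- Consistency of the discrete derivative with the flux `p⁺` on the Gauss–Radau projection. -/
theorem formPlus_radauLeft (hL : 0 ≤ L) {p g : ℝ → ℝ} (h : IsPrimitive L p g) (hp : p L = p 0)
    {v : Fin N → ℝ[X]} (hv : v ∈ dgSpace N k) :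
    formPlus 𝒯 (radauLeft 𝒯 k p) v = - 𝒯.innerProd (fun _ => g) (cellFun v) := by
  have hc := h.continuousOn hL
  simp only [formPlus, dgForm, Mesh.innerProd, cellFun, cellDeriv, eval_radauLeft,
    ← Finset.sum_sub_distrib, ← Finset.sum_neg_distrib]
  refine Finset.sum_congr rfl fun j _ => ?_
  rw [integral_radauLeft_mul 𝒯 hc j (degree_derivative_lt_of_natDegree_le (hv j)),
    h.integral_cell_mul 𝒯 j (v j), 𝒯.apply_left_finRotate hp j]
  ring

/-- Error of the cellwise projections in the `L²` norm. -/
theorem exists_radau_norm_bound (k : ℕ) : ∃ K : ℝ, 0 < K ∧ ∀ {L : ℝ} {N : ℕ} (𝒯 : Mesh L N)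
    (w : ℕ → ℝ → ℝ) (hc : ContinuousOn (w 0) (Icc 0 L)),
    (∀ j < k + 1, IsPrimitive L (w j) (w (j + 1))) →
    IntervalIntegrable (fun x => w (k + 1) x ^ 2) volume 0 L → ∀ B : ℝ, 0 ≤ B →
    ∫ x in (0 : ℝ)..L, w (k + 1) x ^ 2 ≤ B ^ 2 →
    ‖𝒯.polyFn (radauRight 𝒯 k (w 0)) - 𝒯.globalFn (w 0) hc‖ ≤ K * 𝒯.size ^ (k + 1) * B ∧
    ‖𝒯.polyFn (radauLeft 𝒯 k (w 0)) - 𝒯.globalFn (w 0) hc‖ ≤ K * 𝒯.size ^ (k + 1) * B := by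
  obtain ⟨K, hK, hb⟩ := exists_radau_error_bound k
  refine ⟨√K, by positivity, fun {L N} 𝒯 w hc hw h2 B hB hwB => ?_⟩
  have hsz := 𝒯.size_nonneg
  have key : ∀ q : Fin N → ℝ[X], (∀ j, ∫ x in (𝒯.left j)..(𝒯.right j), (w 0 x - (q j).eval x) ^ 2
      ≤ K * (𝒯.right j - 𝒯.left j) ^ (2 * (k + 1))
        * ∫ x in (𝒯.left j)..(𝒯.right j), w (k + 1) x ^ 2) →
      ‖𝒯.polyFn q - 𝒯.globalFn (w 0) hc‖ ≤ √K * 𝒯.size ^ (k + 1) * B := by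
    intro q hq
    rw [Mesh.norm_eq, Mesh.l2norm]
    refine Real.sqrt_le_iff.mpr ⟨by positivity, ?_⟩
    have e : 𝒯.innerProd (𝒯.polyFn q - 𝒯.globalFn (w 0) hc : 𝒯.contFn)
        (𝒯.polyFn q - 𝒯.globalFn (w 0) hc : 𝒯.contFn)
        = ∑ j, ∫ x in (𝒯.left j)..(𝒯.right j), (w 0 x - (q j).eval x) ^ 2 := by
      refine Finset.sum_congr rfl fun j _ => integral_congr fun x _ => ?_
      change ((q j).eval x - w 0 x) * ((q j).eval x - w 0 x) = _
      ring
    rw [e]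
    calc ∑ j, ∫ x in (𝒯.left j)..(𝒯.right j), (w 0 x - (q j).eval x) ^ 2
        ≤ ∑ j, K * 𝒯.size ^ (2 * (k + 1))
            * ∫ x in (𝒯.left j)..(𝒯.right j), w (k + 1) x ^ 2 := by
          refine Finset.sum_le_sum fun j _ => (hq j).trans ?_
          have h1 : 0 ≤ ∫ x in (𝒯.left j)..(𝒯.right j), w (k + 1) x ^ 2 :=
            integral_nonneg (𝒯.left_lt_right j).le fun _ _ => sq_nonneg _
          have h3 : 0 ≤ 𝒯.right j - 𝒯.left j := (sub_pos.mpr (𝒯.left_lt_right j)).le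
          gcongr
          exact 𝒯.cell_le_size j
      _ = K * 𝒯.size ^ (2 * (k + 1)) * ∫ x in (0 : ℝ)..L, w (k + 1) x ^ 2 := by
          rw [← Finset.mul_sum, 𝒯.sum_integral_cells h2]
      _ ≤ K * 𝒯.size ^ (2 * (k + 1)) * B ^ 2 := by gcongr
      _ = (√K * 𝒯.size ^ (k + 1) * B) ^ 2 := by
          rw [mul_pow, mul_pow, Real.sq_sqrt hK.le]; ring
  constructor
  · exact key _ fun j => hb L _ _ _ _ (sub_pos.mpr (𝒯.left_lt_right j)).ne'
      (𝒯.left_lt_right j).le (uIcc_cell 𝒯 j) (𝒯.left_mem j) (𝒯.right_mem j) w hw hc h2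
  · exact key _ fun j => hb L _ _ _ _ (sub_neg.mpr (𝒯.left_lt_right j)).ne
      (𝒯.left_lt_right j).le (uIcc_cell' 𝒯 j) (𝒯.left_mem j) (𝒯.right_mem j) w hw hc h2

/-! ### Stability in time. -/

theorem glSum_le_one {α : ℝ} (hα : 0 < α) (hα' : α < 1) (n : ℕ) : glSum α n ≤ 1 := by
  induction n with
  | zero => simp [glSum_zero]
  | succ n ih => rw [glSum_succ_eq_add]; linarith [glWeight_succ_nonpos hα hα' n]

/-- Stability of the Grünwald–Lubich time stepping. -/
theorem norm_le_of_glWeight {E : Type*} [SeminormedAddCommGroup E] [InnerProductSpace ℝ E]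
    {α A B X : ℝ} (hα : 0 < α) (hα' : α < 1) (hB : 0 ≤ B) (hX : 0 < X)
    (hABX : A * X + B ≤ X ^ 2) (Ξ : ℕ → E) (M : ℕ)
    (h : ∀ n < M, ∑ i ∈ Finset.range (n + 1), glWeight α i * inner ℝ (Ξ (n + 1 - i)) (Ξ (n + 1))
      ≤ glSum α n * (A * ‖Ξ (n + 1)‖ + B)) :
    ∀ n < M, ‖Ξ (n + 1)‖ ≤ X := by
  intro n
  induction n using Nat.strong_induction_on with
  | _ n ih =>
    intro hn
    by_contra! hcon
    set a := ‖Ξ (n + 1)‖ with ha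
    have ha0 : 0 < a := hX.trans hcon
    have hg := glSum_pos hα' n
    have hg1 := glSum_le_one hα hα' n
    -- The later weights are nonpositive with sum `glSum α n - 1`, and the earlier norms are at most
    -- `X`. The index `n + 1 - i` stays positive, so `Ξ 0` never enters.
    have h1 : a ^ 2 + (glSum α n - 1) * (X * a)
        ≤ ∑ i ∈ Finset.range (n + 1), glWeight α i * inner ℝ (Ξ (n + 1 - i)) (Ξ (n + 1)) := by
      rw [glSum, Finset.sum_range_succ', Finset.sum_range_succ']
      simp only [Nat.sub_zero, real_inner_self_eq_norm_sq, ← ha]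
      have h0 : glWeight α 0 = 1 := rfl
      rw [h0, one_mul, add_sub_cancel_right, Finset.sum_mul, add_comm]
      refine add_le_add (Finset.sum_le_sum fun i hi => ?_) le_rfl
      have hi' := Finset.mem_range.mp hi
      have hb : inner ℝ (Ξ (n + 1 - (i + 1))) (Ξ (n + 1)) ≤ X * a := by
        refine (real_inner_le_norm _ _).trans ?_
        have e : n + 1 - (i + 1) = n - i - 1 + 1 := by omega
        have := ih (n - i - 1) (by omega) (by omega)
        rw [e]
        gcongr
      have hw := glWeight_succ_nonpos hα hα' i
      exact mul_le_mul_of_nonpos_left hb hw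
    have h2 := h1.trans (h n hn)
    -- Replacing `X` by the larger `a` leaves exactly `glSum α n * a²` on the left; the common
    -- factor cancels and `a² ≤ A a + B` remains.
    have h3 : (1 - glSum α n) * (X * a) ≤ (1 - glSum α n) * (a * a) := by
      have : 0 ≤ 1 - glSum α n := by linarith
      gcongr
    have h4 : glSum α n * (a ^ 2) ≤ glSum α n * (A * a + B) := by nlinarith
    have h5 : a ^ 2 ≤ A * a + B := le_of_mul_le_mul_left h4 hg
    -- Since `B ≥ 0` and `X < a`, one gets `X a² ≤ a (A X + B) ≤ a X²`, contradicting `X < a`.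
    have h6 : X * a ^ 2 ≤ X * (A * a + B) := by gcongr
    have h7 : a * (A * X + B) ≤ a * X ^ 2 := by gcongr
    have h8 : X * B ≤ a * B := by gcongr
    have h9 : 0 < X * a * (a - X) := by
      have : 0 < a - X := by linarith
      positivity
    nlinarith

end MeshLemmas

/-! ### From Sobolev-valued curves to pointwise regularity. -/

section Regularity

open MeasureTheory Set intervalIntegral

variable {L : ℝ} {w g : ℝ → ℝ}

theorem IsPrimitive.congr (hL : 0 ≤ L) {g' : ℝ → ℝ} (h : IsPrimitive L w g)
    (he : g =ᵐ[domainMeasure L] g') : IsPrimitive L w g' := by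
  have he' : ∀ x ∈ Icc 0 L, g =ᵐ[volume.restrict (uIoc 0 x)] g' := fun x hx => by
    rw [uIoc_of_le hx.1]
    exact ae_restrict_of_ae_restrict_of_subset (Ioc_subset_Ioc_right hx.2) he
  refine ⟨h.1.congr_ae (he' L ⟨hL, le_rfl⟩), fun x hx => ?_⟩
  rw [h.2 x hx, integral_congr_ae_restrict (he' x hx)]

theorem eqOn_of_ae_eq (hL : 0 < L) {w' : ℝ → ℝ} (hw : ContinuousOn w (Icc 0 L))
    (hw' : ContinuousOn w' (Icc 0 L)) (h : w =ᵐ[domainMeasure L] w') : EqOn w w' (Icc 0 L) := by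
  refine Measure.eqOn_Icc_of_ae_eq volume hL.ne ?_ hw hw'
  rwa [← restrict_Ioc_eq_restrict_Icc]

theorem IsPeriodicWeakDeriv.congr_left {j : ℕ} {w' : ℝ → ℝ} (hL : 0 ≤ L)
    (h : IsPeriodicWeakDeriv L j w g) (he : w =ᵐ[domainMeasure L] w') :
    IsPeriodicWeakDeriv L j w' g := by
  refine ⟨h.1.congr he, h.2.1, fun φ hφ hp => ?_⟩
  rw [← h.2.2 φ hφ hp]
  refine integral_congr_ae_restrict ?_
  rw [uIoc_of_le hL]
  filter_upwards [he] with x hx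
  rw [hx]

/-- A continuous function is a primitive of its periodic weak derivative. -/
theorem IsPeriodicWeakDeriv.isPrimitive (hL : 0 < L) (h : IsPeriodicWeakDeriv L 1 w g)
    (hw : ContinuousOn w (Icc 0 L)) : IsPrimitive L w g ∧ w L = w 0 := by
  obtain ⟨⟨c, hc⟩, hz⟩ := h.exists_primitive hL (memLp_of_continuousOn hw)
  have hgi : IntervalIntegrable g volume 0 L :=
    (intervalIntegrable_iff_integrableOn_Ioc_of_le hL.le).mpr h.2.1
  have hp : IsPrimitive L (fun x => c + ∫ s in (0 : ℝ)..x, g s) g := ⟨hgi, fun x _ => by simp⟩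
  have he := eqOn_of_ae_eq hL hw (hp.continuousOn hL.le) hc
  have h0 : w 0 = c := by simpa using he ⟨le_rfl, hL.le⟩
  refine ⟨⟨hgi, fun x hx => by rw [he hx, h0]⟩, ?_⟩
  rw [he ⟨hL.le, le_rfl⟩, h0]
  simp [hz]

/-- Representatives of the weak derivatives of a continuous function: those of order below `m` may
be chosen continuous. -/
theorem exists_primitive_chain (hL : 0 < L) (m : ℕ) (hm : 0 < m) (hw : ContinuousOn w (Icc 0 L))
    (V : ℕ → Lp ℝ 2 (domainMeasure L)) (h : ∀ j ≤ m, IsPeriodicWeakDeriv L j w (V j)) :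
    ∃ d : ℕ → ℝ → ℝ, d 0 = w ∧ (∀ j ≤ m, d j =ᵐ[domainMeasure L] V j) ∧
      ∀ j < m, IsPrimitive L (d j) (d (j + 1)) ∧ d j L = d j 0 := by
  have hV : ∀ j, MemLp (V j) 2 (domainMeasure L) := fun j => Lp.memLp (V j)
  have hw0 : w =ᵐ[domainMeasure L] V 0 := (h 0 (by omega)).ae_eq hL (memLp_of_continuousOn hw) (hV 0)
  have hex : ∀ j, ∃ c : ℝ, j < m → V j =ᵐ[domainMeasure L]
      fun x => c + ∫ s in (0 : ℝ)..x, V (j + 1) s := by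
    intro j
    by_cases hj : j < m
    · obtain ⟨⟨c, hc⟩, -⟩ := ((h j hj.le).succ (h (j + 1) hj)).exists_primitive hL (hV j)
      exact ⟨c, fun _ => hc⟩
    · exact ⟨0, fun h => absurd h hj⟩
  choose c hc using hex
  -- Order `0` is the given continuous function, intermediate orders are primitives, and the top
  -- order is only an `L²` representative.
  let d : ℕ → ℝ → ℝ := fun j => if j = 0 then w else
    if j < m then fun x => c j + ∫ s in (0 : ℝ)..x, V (j + 1) s else V j
  have hae : ∀ j ≤ m, d j =ᵐ[domainMeasure L] V j := by
    intro j hj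
    by_cases h0 : j = 0
    · subst h0; simpa [d] using hw0
    · by_cases hjm : j < m
      · simpa [d, h0, hjm] using (hc j hjm).symm
      · simp [d, h0, hjm]
  have hcont : ∀ j < m, ContinuousOn (d j) (Icc 0 L) := by
    intro j hj
    by_cases h0 : j = 0
    · subst h0; simpa [d] using hw
    · have hp : IsPrimitive L (d j) (V (j + 1)) := by
        simp only [d, h0, hj, if_true, if_false]
        exact ⟨intervalIntegrable_of_memLp hL.le (hV _), fun x _ => by simp⟩
      exact hp.continuousOn hL.le
  refine ⟨d, by simp [d], hae, fun j hj => ?_⟩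
  have h1 := (((h j hj.le).succ (h (j + 1) hj)).congr_left hL.le (hae j hj.le).symm).isPrimitive hL
    (hcont j hj)
  exact ⟨h1.1.congr hL.le (hae (j + 1) hj).symm, h1.2⟩

theorem integral_sq_eq_norm_sq (hL : 0 ≤ L) {V : Lp ℝ 2 (domainMeasure L)}
    (h : g =ᵐ[domainMeasure L] V) : ∫ x in (0 : ℝ)..L, g x ^ 2 = ‖V‖ ^ 2 := by
  rw [← real_inner_self_eq_norm_sq, L2.inner_def, integral_of_le hL]
  refine MeasureTheory.integral_congr_ae ?_
  filter_upwards [h] with x hx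
  rw [hx, real_inner_self_eq_norm_sq, Real.norm_eq_abs, sq_abs]

theorem inner_toLp_eq (hL : 0 ≤ L) {a : ℝ → ℝ} (ha : MemLp a 2 (domainMeasure L))
    {V : Lp ℝ 2 (domainMeasure L)} (h : g =ᵐ[domainMeasure L] V) :
    inner ℝ (ha.toLp a) V = ∫ x in (0 : ℝ)..L, a x * g x := by
  rw [L2.inner_def, integral_of_le hL]
  refine MeasureTheory.integral_congr_ae ?_
  filter_upwards [h, ha.coeFn_toLp] with x hx hx'
  rw [hx', ← hx, real_inner_eq_re_inner, RCLike.inner_apply']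
  simp

/-- Point values are uniformly bounded linear functionals of the function and its derivative. -/
theorem exists_eval_functional (hL : 0 < L) : ∃ C : ℝ, 0 ≤ C ∧ ∀ x ∈ Icc 0 L,
    ∃ a b : Lp ℝ 2 (domainMeasure L), ‖a‖ ≤ C ∧ ‖b‖ ≤ C ∧
      ∀ (w g : ℝ → ℝ) (V W : Lp ℝ 2 (domainMeasure L)), IsPrimitive L w g →
        w =ᵐ[domainMeasure L] V → g =ᵐ[domainMeasure L] W → w x = inner ℝ a V + inner ℝ b W := by
  set μ := domainMeasure L
  set D : ℝ := (measureUnivNNReal μ : ℝ) ^ ((2 : ENNReal).toReal)⁻¹ * (2 + L⁻¹)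
  have hD : 0 ≤ D := by positivity
  refine ⟨D, hD, fun x hx => ?_⟩
  have hLp : 0 < L⁻¹ := by positivity
  have ha : MemLp (fun _ : ℝ => L⁻¹) 2 μ := memLp_const _
  -- Integrating `g` against `(s - L) / L` by parts expresses `w 0` through the mean of `w`; adding
  -- `∫₀ˣ g` gives `w x`. Thus `a = 1/L` and `b = β`.
  let β : ℝ → ℝ := fun s => (Ioc 0 x).indicator (fun _ => (1 : ℝ)) s + L⁻¹ * (s - L)
  have hβb : ∀ᵐ s ∂μ, ‖β s‖ ≤ 2 + L⁻¹ := by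
    refine (ae_restrict_iff' measurableSet_Ioc).mpr (Filter.Eventually.of_forall fun s hs => ?_)
    have h1 : |(Ioc 0 x).indicator (fun _ => (1 : ℝ)) s| ≤ 1 := by
      unfold indicator; split_ifs <;> simp
    have h2 : |L⁻¹ * (s - L)| ≤ 1 := by
      rw [abs_mul, abs_of_pos hLp, abs_of_nonpos (by linarith [hs.2]), inv_mul_le_iff₀ hL]
      linarith [hs.1]
    rw [Real.norm_eq_abs]
    exact (abs_add_le _ _).trans (by linarith)
  have hβ : MemLp β 2 μ := by
    refine MemLp.of_bound ?_ (2 + L⁻¹) hβb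
    exact ((measurable_const.indicator measurableSet_Ioc).add (by fun_prop)).aestronglyMeasurable
  refine ⟨ha.toLp _, hβ.toLp _, ?_, ?_, fun w g V W hp hV hW => ?_⟩
  · refine Lp.norm_le_of_ae_bound (by positivity) ?_
    filter_upwards [ha.coeFn_toLp] with s hs
    rw [hs, Real.norm_eq_abs, abs_of_pos hLp]
    linarith
  · refine Lp.norm_le_of_ae_bound (by positivity) ?_
    filter_upwards [hβ.coeFn_toLp, hβb] with s hs hb
    rwa [hs]
  · rw [inner_toLp_eq hL.le ha hV, inner_toLp_eq hL.le hβ hW]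
    have e1 := hp.integral_mul hL.le ⟨le_rfl, hL.le⟩ ⟨hL.le, le_rfl⟩ (φ := fun s => L⁻¹ * (s - L))
      (φ' := fun _ => L⁻¹)
      (fun s => by simpa using ((hasDerivAt_id s).sub_const L).const_mul L⁻¹) continuous_const
    have hind : ∀ s, (Ioc 0 x).indicator (fun _ => (1 : ℝ)) s * g s = (Ioc 0 x).indicator g s := by
      intro s; unfold indicator; split_ifs <;> simp
    have e2 : ∫ s in (0 : ℝ)..L, β s * g s
        = (∫ s in (0 : ℝ)..x, g s) + ∫ s in (0 : ℝ)..L, g s * (L⁻¹ * (s - L)) := by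
      have i1 : IntervalIntegrable ((Ioc 0 x).indicator g) volume 0 L := by
        rw [intervalIntegrable_iff_integrableOn_Ioc_of_le hL.le]
        exact ((intervalIntegrable_iff_integrableOn_Ioc_of_le hL.le).mp hp.1).indicator
          measurableSet_Ioc
      have i2 : IntervalIntegrable (fun s => g s * (L⁻¹ * (s - L))) volume 0 L :=
        hp.1.mul_continuousOn (by fun_prop)
      have e3 : ∫ s in (0 : ℝ)..x, g s = ∫ s in (0 : ℝ)..L, (Ioc 0 x).indicator g s := by
        rw [integral_of_le hL.le, integral_of_le hx.1, setIntegral_indicator measurableSet_Ioc,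
          Ioc_inter_Ioc, max_self, min_eq_right hx.2]
      rw [e3, ← intervalIntegral.integral_add i1 i2]
      refine integral_congr fun s _ => ?_
      simp only [β, add_mul, hind]
      ring
    rw [e2, e1, hp.2 x hx]
    have e4 : ∫ s in (0 : ℝ)..L, L⁻¹ * w s = ∫ s in (0 : ℝ)..L, w s * L⁻¹ :=
      integral_congr fun s _ => mul_comm _ _
    rw [e4, sub_self, mul_zero, mul_zero, zero_sub]
    field_simp
    ring

/-- A `C²` curve on `[0, T]` has a bounded Lipschitz derivative. -/
theorem exists_lipschitz_derivative {E : Type*} [NormedAddCommGroup E] [NormedSpace ℝ E] {T : ℝ}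
    (hT : 0 < T) {F : ℝ → E} (hF : ContDiffOn ℝ 2 F (Icc 0 T)) :
    ∃ (F' : ℝ → E) (K : ℝ), 0 ≤ K ∧
      (∀ t ∈ Icc 0 T, HasDerivWithinAt F (F' t) (Icc 0 T) t) ∧
      (∀ t ∈ Icc 0 T, ‖F t‖ ≤ K) ∧ (∀ t ∈ Icc 0 T, ‖F' t‖ ≤ K) ∧
      (∀ s ∈ Icc 0 T, ∀ t ∈ Icc 0 T, ‖F s - F t‖ ≤ K * |s - t|) ∧
      ∀ s ∈ Icc 0 T, ∀ t ∈ Icc 0 T, ‖F' s - F' t‖ ≤ K * |s - t| := by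
  have hu := uniqueDiffOn_Icc hT
  have hF1 : ContDiffOn ℝ 1 (derivWithin F (Icc 0 T)) (Icc 0 T) :=
    hF.derivWithin hu (by norm_num)
  have hF2 : ContDiffOn ℝ 0 (derivWithin (derivWithin F (Icc 0 T)) (Icc 0 T)) (Icc 0 T) :=
    hF1.derivWithin hu (by norm_num)
  obtain ⟨K0, hK0⟩ := isCompact_Icc.exists_bound_of_continuousOn hF.continuousOn
  obtain ⟨K1, hK1⟩ := isCompact_Icc.exists_bound_of_continuousOn hF1.continuousOn
  obtain ⟨K2, hK2⟩ := isCompact_Icc.exists_bound_of_continuousOn hF2.continuousOn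
  set K := max K0 (max K1 K2)
  have h0 : K0 ≤ K := le_max_left _ _
  have h1 : K1 ≤ K := (le_max_left _ _).trans (le_max_right _ _)
  have h2 : K2 ≤ K := (le_max_right _ _).trans (le_max_right _ _)
  have hd : ∀ t ∈ Icc 0 T, HasDerivWithinAt F (derivWithin F (Icc 0 T) t) (Icc 0 T) t :=
    fun t ht => (hF.differentiableOn (by norm_num) t ht).hasDerivWithinAt
  have hd1 : ∀ t ∈ Icc 0 T, HasDerivWithinAt (derivWithin F (Icc 0 T))
      (derivWithin (derivWithin F (Icc 0 T)) (Icc 0 T) t) (Icc 0 T) t :=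
    fun t ht => (hF1.differentiableOn (by norm_num) t ht).hasDerivWithinAt
  refine ⟨derivWithin F (Icc 0 T), K, (norm_nonneg _).trans ((hK0 0 ⟨le_rfl, hT.le⟩).trans h0), hd,
    fun t ht => (hK0 t ht).trans h0, fun t ht => (hK1 t ht).trans h1, fun s hs t ht => ?_,
    fun s hs t ht => ?_⟩
  · simpa using Convex.norm_image_sub_le_of_norm_hasDerivWithin_le hd
      (fun r hr => (hK1 r hr).trans h1) (convex_Icc 0 T) ht hs
  · simpa using Convex.norm_image_sub_le_of_norm_hasDerivWithin_le hd1
      (fun r hr => (hK2 r hr).trans h2) (convex_Icc 0 T) ht hs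

/-- The classical content of the regularity assumption: `d t j` represents the `j`-th weak space
derivative of `u(·, t)`, and `ψ x` is the time derivative of `e^{λt} u(x, t)`. -/
structure RegularSolution (α lam κ L T : ℝ) (k : ℕ) (f u : ℝ → ℝ → ℝ) (d : ℝ → ℕ → ℝ → ℝ)
    (ψ : ℝ → ℝ → ℝ) (K : ℝ) : Prop where
  nonneg : 0 ≤ K
  zero : ∀ t ∈ Icc 0 T, d t 0 = fun x => u x t
  prim : ∀ t ∈ Icc 0 T, ∀ j < k + 2, IsPrimitive L (d t j) (d t (j + 1))
  periodic : ∀ t ∈ Icc 0 T, ∀ j < k + 2, d t j L = d t j 0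
  memLp : ∀ t ∈ Icc 0 T, ∀ j ≤ k + 2, MemLp (d t j) 2 (domainMeasure L)
  bound : ∀ t ∈ Icc 0 T, ∀ j ≤ k + 2, ∫ x in (0 : ℝ)..L, (Real.exp (lam * t) * d t j x) ^ 2 ≤ K ^ 2
  lipschitz : ∀ s ∈ Icc 0 T, ∀ t ∈ Icc 0 T, ∀ j ≤ k + 2,
    ∫ x in (0 : ℝ)..L, (Real.exp (lam * s) * d s j x - Real.exp (lam * t) * d t j x) ^ 2
      ≤ (K * |s - t|) ^ 2
  hasDeriv : ∀ x ∈ Icc 0 L, ∀ t ∈ Icc 0 T,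
    HasDerivWithinAt (fun r => Real.exp (lam * r) * u x r) (ψ x t) (Icc 0 T) t
  deriv_bound : ∀ x ∈ Icc 0 L, ∀ t ∈ Icc 0 T, |ψ x t| ≤ K
  deriv_lipschitz : ∀ x ∈ Icc 0 L, ∀ s ∈ Icc 0 T, ∀ t ∈ Icc 0 T, |ψ x s - ψ x t| ≤ K * |s - t|
  equation : ∀ t ∈ Ioc 0 T, ∃ g, IsPrimitive L (d t 1) g ∧
    ∀ᵐ x ∂(domainMeasure L), caputoTempered α lam (u x) t = κ * g x + f x t

/-- The curves `e^{λt} U j` are `C²` in `L²`; the evaluation functionals, bounded uniformly in `x`,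
carry their derivative and its Lipschitz bound to every point. -/
theorem exists_regularSolution {α lam κ L T : ℝ} (hL : 0 < L) (hT : 0 < T) {k : ℕ}
    {f : ℝ → ℝ → ℝ} {u₀ : ℝ → ℝ} {u : ℝ → ℝ → ℝ} (hu : IsExactSolution α lam κ L T f u₀ u)
    (hreg : TimeSobolevRegular L T 2 (k + 2) u) :
    ∃ d ψ K, RegularSolution α lam κ L T k f u d ψ K := by
  obtain ⟨U, hU⟩ := hreg
  have hchain : ∀ t, ∃ d : ℕ → ℝ → ℝ, t ∈ Icc 0 T → d 0 = (fun x => u x t) ∧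
      (∀ j ≤ k + 2, d j =ᵐ[domainMeasure L] U j t) ∧
      ∀ j < k + 2, IsPrimitive L (d j) (d (j + 1)) ∧ d j L = d j 0 := by
    intro t
    by_cases ht : t ∈ Icc 0 T
    · obtain ⟨d, hd⟩ := exists_primitive_chain hL (k + 2) (by omega)
        (hu.continuous t ht).continuousOn (fun j => U j t) fun j hj => (hU j hj).2 t ht
      exact ⟨d, fun _ => hd⟩
    · exact ⟨fun _ _ => 0, fun h => absurd h ht⟩
  choose d hd using hchain
  let W : ℕ → ℝ → Lp ℝ 2 (domainMeasure L) := fun j t => Real.exp (lam * t) • U j t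
  have hW : ∀ j ≤ k + 2, ContDiffOn ℝ 2 (W j) (Icc 0 T) := fun j hj => by
    have h1 : ContDiffOn ℝ 2 (U j) (Icc 0 T) := by exact_mod_cast (hU j hj).1
    have h2 : ContDiff ℝ 2 fun t : ℝ => Real.exp (lam * t) := by fun_prop
    exact h2.contDiffOn.smul h1
  have hWd : ∀ j, ∃ (F' : ℝ → Lp ℝ 2 (domainMeasure L)) (K : ℝ), 0 ≤ K ∧ (j ≤ k + 2 →
      (∀ t ∈ Icc 0 T, HasDerivWithinAt (W j) (F' t) (Icc 0 T) t) ∧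
      (∀ t ∈ Icc 0 T, ‖W j t‖ ≤ K) ∧ (∀ t ∈ Icc 0 T, ‖F' t‖ ≤ K) ∧
      (∀ s ∈ Icc 0 T, ∀ t ∈ Icc 0 T, ‖W j s - W j t‖ ≤ K * |s - t|) ∧
      ∀ s ∈ Icc 0 T, ∀ t ∈ Icc 0 T, ‖F' s - F' t‖ ≤ K * |s - t|) := by
    intro j
    by_cases hj : j ≤ k + 2
    · obtain ⟨F', K, hK, h⟩ := exists_lipschitz_derivative hT (hW j hj)
      exact ⟨F', K, hK, fun _ => h⟩
    · exact ⟨0, 0, le_rfl, fun h => absurd h hj⟩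
  choose W' K hK hWK using hWd
  obtain ⟨C, hC, hev⟩ := exists_eval_functional hL
  have hex : ∀ x, ∃ a b : Lp ℝ 2 (domainMeasure L), x ∈ Icc 0 L → ‖a‖ ≤ C ∧ ‖b‖ ≤ C ∧
      ∀ (w g : ℝ → ℝ) (V W : Lp ℝ 2 (domainMeasure L)), IsPrimitive L w g →
        w =ᵐ[domainMeasure L] V → g =ᵐ[domainMeasure L] W → w x = inner ℝ a V + inner ℝ b W := by
    intro x
    by_cases hx : x ∈ Icc 0 L
    · obtain ⟨a, b, h⟩ := hev x hx
      exact ⟨a, b, fun _ => h⟩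
    · exact ⟨0, 0, fun h => absurd h hx⟩
  choose a b hab using hex
  set K₁ := ∑ j ∈ Finset.range (k + 3), K j
  have hK₁ : ∀ j ≤ k + 2, K j ≤ K₁ := fun j hj =>
    Finset.single_le_sum (fun i _ => hK i) (Finset.mem_range.mpr (by omega))
  have hK₁0 : 0 ≤ K₁ := Finset.sum_nonneg fun i _ => hK i
  set K₂ := max K₁ (C * K₁ + C * K₁)
  have hK₂ : K₁ ≤ K₂ := le_max_left _ _
  have hK₂' : C * K₁ + C * K₁ ≤ K₂ := le_max_right _ _
  have hinner : ∀ x ∈ Icc 0 L, ∀ (V V' : Lp ℝ 2 (domainMeasure L)) (r : ℝ), 0 ≤ r →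
      ‖V‖ ≤ K₁ * r → ‖V'‖ ≤ K₁ * r → |inner ℝ (a x) V + inner ℝ (b x) V'| ≤ K₂ * r := by
    intro x hx V V' r hr hV hV'
    have h1 := abs_real_inner_le_norm (a x) V
    have h2 := abs_real_inner_le_norm (b x) V'
    have h3 : ‖a x‖ * ‖V‖ ≤ C * (K₁ * r) := by have := (hab x hx).1; gcongr
    have h4 : ‖b x‖ * ‖V'‖ ≤ C * (K₁ * r) := by have := (hab x hx).2.1; gcongr
    have h5 : (C * K₁ + C * K₁) * r ≤ K₂ * r := by gcongr
    have := abs_add_le (inner ℝ (a x) V) (inner ℝ (b x) V')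
    linarith
  have hae : ∀ t ∈ Icc 0 T, ∀ j ≤ k + 2, d t j =ᵐ[domainMeasure L] U j t :=
    fun t ht j hj => (hd t ht).2.1 j hj
  have haeW : ∀ t ∈ Icc 0 T, ∀ j ≤ k + 2,
      (fun x => Real.exp (lam * t) * d t j x) =ᵐ[domainMeasure L] W j t := by
    intro t ht j hj
    filter_upwards [hae t ht j hj, Lp.coeFn_smul (Real.exp (lam * t)) (U j t)] with x h1 h2
    rw [h1, h2]; simp
  refine ⟨d, fun x t => inner ℝ (a x) (W' 0 t) + inner ℝ (b x) (W' 1 t), K₂, ?_⟩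
  refine ⟨hK₁0.trans hK₂, fun t ht => (hd t ht).1, fun t ht j hj => ((hd t ht).2.2 j hj).1,
    fun t ht j hj => ((hd t ht).2.2 j hj).2,
    fun t ht j hj => (memLp_congr_ae (hae t ht j hj)).mpr (Lp.memLp _), ?_, ?_, ?_, ?_, ?_, ?_⟩
  · intro t ht j hj
    rw [integral_sq_eq_norm_sq hL.le (haeW t ht j hj)]
    have := (hWK j hj).2.1 t ht
    have := hK₁ j hj
    gcongr
    linarith
  · intro s hs t ht j hj
    have h1 : (fun x => Real.exp (lam * s) * d s j x - Real.exp (lam * t) * d t j x)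
        =ᵐ[domainMeasure L] (W j s - W j t : Lp ℝ 2 (domainMeasure L)) := by
      filter_upwards [haeW s hs j hj, haeW t ht j hj, Lp.coeFn_sub (W j s) (W j t)]
        with x h1 h2 h3
      rw [h1, h2, h3]; rfl
    rw [integral_sq_eq_norm_sq hL.le h1]
    have h2 := (hWK j hj).2.2.2.1 s hs t ht
    have h3 : K j * |s - t| ≤ K₂ * |s - t| := by
      have := hK₁ j hj
      gcongr
      linarith
    have := h2.trans h3
    gcongr
  · intro x hx t ht
    have h0 := (hWK 0 (by omega)).1 t ht
    have h1 := (hWK 1 (by omega)).1 t ht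
    have e := ((innerSL ℝ (a x)).hasFDerivAt.comp_hasDerivWithinAt t h0).add
      ((innerSL ℝ (b x)).hasFDerivAt.comp_hasDerivWithinAt t h1)
    have hform : ∀ r ∈ Icc 0 T, Real.exp (lam * r) * u x r
        = inner ℝ (a x) (W 0 r) + inner ℝ (b x) (W 1 r) := by
      intro r hr
      have := (hab x hx).2.2 _ _ _ _ (((hd r hr).2.2 0 (by omega)).1.smul (Real.exp (lam * r)))
        (haeW r hr 0 (by omega)) (haeW r hr 1 (by omega))
      rw [← this, (hd r hr).1]
    exact e.congr hform (hform t ht)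
  · intro x hx t ht
    have := hinner x hx (W' 0 t) (W' 1 t) 1 zero_le_one
      (by rw [mul_one]; exact ((hWK 0 (by omega)).2.2.1 t ht).trans (hK₁ 0 (by omega)))
      (by rw [mul_one]; exact ((hWK 1 (by omega)).2.2.1 t ht).trans (hK₁ 1 (by omega)))
    rwa [mul_one] at this
  · intro x hx s hs t ht
    have hb : ∀ j ≤ k + 2, ‖W' j s - W' j t‖ ≤ K₁ * |s - t| := fun j hj => by
      refine ((hWK j hj).2.2.2.2 s hs t ht).trans ?_
      have := hK₁ j hj
      gcongr
    have := hinner x hx (W' 0 s - W' 0 t) (W' 1 s - W' 1 t) |s - t| (abs_nonneg _)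
      (hb 0 (by omega)) (hb 1 (by omega))
    rw [inner_sub_right, inner_sub_right] at this
    convert this using 2
    ring
  -- The second derivative in the equation is some weak derivative `g`, a priori different from `d t
  -- 2`; being a weak derivative of the continuous `d t 1`, it has `d t 1` as a primitive.
  · intro t ht
    have ht' : t ∈ Icc 0 T := Ioc_subset_Icc_self ht
    obtain ⟨g, hg, heq⟩ := hu.equation t ht
    refine ⟨g, ?_, heq⟩
    have hcont : ContinuousOn (d t 1) (Icc 0 L) :=
      ((hd t ht').2.2 1 (by omega)).1.continuousOn hL.le
    exact ((((hU 1 (by omega)).2 t ht').succ hg).congr_left hL.le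
      (hae t ht' 1 (by omega)).symm |>.isPrimitive hL hcont).1

end Regularity

/-! ### Consistency of the time discretization for the exact solution. -/

section Consistency

open MeasureTheory Set intervalIntegral

variable {α lam κ L T : ℝ} {k : ℕ} {f u : ℝ → ℝ → ℝ} {d : ℝ → ℕ → ℝ → ℝ} {ψ : ℝ → ℝ → ℝ} {K : ℝ}

/-- The end point `s = t` is discarded as a null set, because for `t = T` only a one-sided
derivative is known there. -/
theorem RegularSolution.exp_mul_caputo (R : RegularSolution α lam κ L T k f u d ψ K) {x t : ℝ}
    (hx : x ∈ Icc 0 L) (ht : t ∈ Icc 0 T) :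
    Real.exp (lam * t) * caputoTempered α lam (u x) t
      = 1 / Real.Gamma (1 - α) * (∫ s in (0 : ℝ)..t, (t - s) ^ (-α) * ψ x s) := by
  have hI : ∫ s in (0 : ℝ)..t, (t - s) ^ (-α) * deriv (fun r => Real.exp (lam * r) * u x r) s
      = ∫ s in (0 : ℝ)..t, (t - s) ^ (-α) * ψ x s := by
    refine integral_congr_ae ?_
    have hne : ∀ᵐ s : ℝ, s ≠ t := by simp [ae_iff, measure_singleton]
    filter_upwards [hne] with s hs hs'
    rw [uIoc_of_le ht.1] at hs'
    have h1 : s < t := lt_of_le_of_ne hs'.2 hs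
    have h2 : s ∈ Icc 0 T := ⟨hs'.1.le, hs'.2.trans ht.2⟩
    rw [((R.hasDeriv x hx s h2).hasDerivAt
      (Icc_mem_nhds hs'.1 (h1.trans_le ht.2))).deriv]
  rw [caputoTempered, hI, ← mul_assoc, ← mul_div_assoc, ← Real.exp_add]
  congr 2
  simp

/-- Constant of the truncation error. -/
noncomputable def truncConst (α T K : ℝ) : ℝ :=
  K * (T + 1 + 2 * T / (1 - α)) / Real.Gamma (2 - α)

/-- Grünwald–Lubich approximation of `e^{λt}` times the tempered derivative. -/
noncomputable def glApprox (α lam : ℝ) (v : ℝ → ℝ) (τ : ℝ) (n : ℕ) : ℝ :=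
  τ ^ (-α) * (∑ i ∈ Finset.range (n + 1), glWeight α i
    * (Real.exp (lam * ((n + 1 - i : ℕ) * τ)) * v ((n + 1 - i : ℕ) * τ)) - glSum α n * v 0)

/-- The correction `glSum α n * v 0` in `glApprox` is the boundary term of the summation by parts,
which leaves the increments of `φ` only. -/
theorem RegularSolution.truncation (hα : 0 < α) (hα' : α < 1)
    (R : RegularSolution α lam κ L T k f u d ψ K) {x : ℝ} (hx : x ∈ Icc 0 L) {τ : ℝ} (hτ : 0 < τ)
    (n : ℕ) (hn : ((n : ℝ) + 1) * τ ≤ T) :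
    |Real.exp (lam * ((n + 1) * τ)) * caputoTempered α lam (u x) ((n + 1) * τ)
      - glApprox α lam (u x) τ n| ≤ truncConst α T K * (τ * ((n + 1) * τ) ^ (-α)) := by
  have h := abs_fractional_sub_glSum_le hα hα' (R.hasDeriv x hx) (R.deriv_bound x hx)
    (R.deriv_lipschitz x hx) hτ n hn
  rw [R.exp_mul_caputo hx ⟨by positivity, hn⟩]
  have e := sum_glWeight_smul α (fun m : ℕ => Real.exp (lam * (m * τ)) * u x (m * τ)) n
  simp only [smul_eq_mul, Nat.cast_zero, zero_mul, mul_zero, Real.exp_zero, one_mul] at e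
  rw [glApprox, e, add_sub_cancel_right]
  exact h

theorem RegularSolution.continuousOn (hL : 0 ≤ L) (R : RegularSolution α lam κ L T k f u d ψ K)
    {t : ℝ} (ht : t ∈ Icc 0 T) : ContinuousOn (fun x => u x t) (Icc 0 L) := by
  rw [← R.zero t ht]
  exact (R.prim t ht 0 (by omega)).continuousOn hL

theorem RegularSolution.glApprox_continuousOn (hL : 0 ≤ L)
    (R : RegularSolution α lam κ L T k f u d ψ K) {τ : ℝ} (hτ : 0 ≤ τ) (n : ℕ)
    (hn : ((n : ℝ) + 1) * τ ≤ T) : ContinuousOn (fun x => glApprox α lam (u x) τ n) (Icc 0 L) := by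
  have hmem : ∀ m ≤ n + 1, (m : ℝ) * τ ∈ Icc 0 T := fun m hm => by
    have : (m : ℝ) ≤ n + 1 := by exact_mod_cast hm
    exact ⟨by positivity, (mul_le_mul_of_nonneg_right this hτ).trans hn⟩
  have h0 : (0 : ℝ) ∈ Icc 0 T := by simpa using hmem 0 (by omega)
  unfold glApprox
  refine continuousOn_const.mul ((continuousOn_finsetSum _ fun i hi => ?_).sub
    (continuousOn_const.mul (R.continuousOn hL h0)))
  exact continuousOn_const.mul (continuousOn_const.mul (R.continuousOn hL (hmem _ (by omega))))

/-- A uniform limit in `x` of Grünwald–Lubich approximations with step `t / (n + 1)`. Continuity is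
needed to treat the derivative as an element of `contFn`; none is assumed of `f`. -/
theorem RegularSolution.caputo_continuousOn (hα : 0 < α) (hα' : α < 1) (hL : 0 ≤ L)
    (R : RegularSolution α lam κ L T k f u d ψ K) {t : ℝ} (ht : t ∈ Ioc 0 T) :
    ContinuousOn (fun x => caputoTempered α lam (u x) t) (Icc 0 L) := by
  have hE : Real.exp (lam * t) ≠ 0 := (Real.exp_pos _).ne'
  have e : (fun x => caputoTempered α lam (u x) t)
      = fun x => (Real.exp (lam * t))⁻¹ * (Real.exp (lam * t) * caputoTempered α lam (u x) t) := by
    funext x; field_simp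
  rw [e]
  refine continuousOn_const.mul ?_
  have hcancel : ∀ n : ℕ, ((n : ℝ) + 1) * (t / (n + 1)) = t := fun n => by field_simp
  have htend : Filter.Tendsto (fun n : ℕ => truncConst α T K * (t / ((n : ℝ) + 1) * t ^ (-α)))
      Filter.atTop (nhds 0) := by
    have h1 : Filter.Tendsto (fun n : ℕ => 1 / ((n : ℝ) + 1)) Filter.atTop (nhds 0) :=
      tendsto_one_div_add_atTop_nhds_zero_nat
    have h2 := h1.const_mul (truncConst α T K * t * t ^ (-α))
    rw [mul_zero] at h2
    refine h2.congr fun n => ?_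
    ring
  have hunif : TendstoUniformlyOn (fun (n : ℕ) x => glApprox α lam (u x) (t / (n + 1)) n)
      (fun x => Real.exp (lam * t) * caputoTempered α lam (u x) t) Filter.atTop (Icc 0 L) := by
    rw [Metric.tendstoUniformlyOn_iff]
    intro ε hε
    filter_upwards [htend.eventually (gt_mem_nhds hε)] with n hn x hx
    have := R.truncation hα hα' hx (τ := t / (n + 1)) (by have := ht.1; positivity) n
      (by rw [hcancel]; exact ht.2)
    rw [hcancel] at this
    rw [Real.dist_eq]
    exact this.trans_lt hn
  refine hunif.continuousOn (Filter.Eventually.frequently (Filter.Eventually.of_forall fun n => ?_))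
  refine R.glApprox_continuousOn hL (by have := ht.1; positivity) n ?_
  rw [hcancel]; exact ht.2

end Consistency

/-! ### Linearity of the projections and of the inner product. -/

section ErrorEstimate

open MeasureTheory Set intervalIntegral Polynomial

variable {L : ℝ} {N : ℕ} (𝒯 : Mesh L N) {k : ℕ}

theorem innerProd_congr_ae {g g' : ℝ → ℝ} (h : g =ᵐ[domainMeasure L] g') (v : Fin N → ℝ → ℝ) :
    𝒯.innerProd (fun _ => g) v = 𝒯.innerProd (fun _ => g') v := by
  refine Finset.sum_congr rfl fun j _ => integral_congr_ae_restrict ?_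
  rw [uIoc_of_le (𝒯.left_lt_right j).le]
  have h' := ae_restrict_of_ae_restrict_of_subset
    (Ioc_subset_Ioc (𝒯.left_mem j).1 (𝒯.right_mem j).2) h
  filter_upwards [h'] with x hx
  rw [hx]

theorem innerProd_sub_const_mul (v : Fin N → ℝ[X]) {a g : ℝ → ℝ} (ha : ContinuousOn a (Icc 0 L))
    (hg : IntervalIntegrable g volume 0 L) (κ : ℝ) :
    𝒯.innerProd (fun _ x => a x - κ * g x) (cellFun v)
      = 𝒯.innerProd (fun _ => a) (cellFun v) - κ * 𝒯.innerProd (fun _ => g) (cellFun v) := by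
  simp only [Mesh.innerProd, cellFun, Finset.mul_sum, ← Finset.sum_sub_distrib]
  refine Finset.sum_congr rfl fun j _ => ?_
  have hv := (v j).continuous.continuousOn (s := uIcc (𝒯.left j) (𝒯.right j))
  have h1 : IntervalIntegrable (fun x => a x * (v j).eval x) volume (𝒯.left j) (𝒯.right j) :=
    (𝒯.intervalIntegrable_cell (ha.mono (𝒯.cell_subset j))).mul_continuousOn hv
  have h2 : IntervalIntegrable (fun x => g x * (v j).eval x) volume (𝒯.left j) (𝒯.right j) :=
    (intervalIntegrable_of_Icc hg (𝒯.left_mem j) (𝒯.right_mem j)).mul_continuousOn hv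
  rw [← intervalIntegral.integral_const_mul, ← intervalIntegral.integral_sub h1 (h2.const_mul κ)]
  refine integral_congr fun x _ => ?_
  ring

theorem polyFn_radauRight_comb {w w' : ℝ → ℝ} (hw : ContinuousOn w (Icc 0 L))
    (hw' : ContinuousOn w' (Icc 0 L)) (a b : ℝ) :
    𝒯.polyFn (radauRight 𝒯 k fun x => a * w x - b * w' x)
      = a • 𝒯.polyFn (radauRight 𝒯 k w) - b • 𝒯.polyFn (radauRight 𝒯 k w') := by
  rw [← map_smul, ← map_smul, ← map_sub]
  congr 1
  funext j
  have hs := 𝒯.cell_subset j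
  have h := radau_sub (k := k) (c := 𝒯.left j) (d := 𝒯.right j - 𝒯.left j)
    (w := fun x => a * w x) (w' := fun x => b * w' x)
    (by rw [uIcc_cell]; exact continuousOn_const.mul (hw.mono hs))
    (by rw [uIcc_cell]; exact continuousOn_const.mul (hw'.mono hs))
  rw [radau_const_mul, radau_const_mul] at h
  simpa [radauRight, smul_eq_C_mul] using h

theorem polyFn_radauLeft_const_mul (a : ℝ) (w : ℝ → ℝ) :
    𝒯.polyFn (radauLeft 𝒯 k fun x => a * w x) = a • 𝒯.polyFn (radauLeft 𝒯 k w) := by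
  rw [← map_smul]
  congr 1
  funext j
  simp [radauLeft, smul_eq_C_mul, radau_const_mul]

theorem polyFn_radauRight_const_mul (a : ℝ) (w : ℝ → ℝ) :
    𝒯.polyFn (radauRight 𝒯 k fun x => a * w x) = a • 𝒯.polyFn (radauRight 𝒯 k w) := by
  rw [← map_smul]
  congr 1
  funext j
  simp [radauRight, smul_eq_C_mul, radau_const_mul]

end ErrorEstimate

/-! ### Projection errors, error equation and energy inequality. -/

section ErrorEquation

open MeasureTheory Set intervalIntegral Polynomial

open Classical in
/-- A function on `[0, L]` as an element of `contFn`, zero if it is not continuous. -/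
noncomputable def Mesh.lift {L : ℝ} {N : ℕ} (𝒯 : Mesh L N) (g : ℝ → ℝ) : 𝒯.contFn :=
  if h : ContinuousOn g (Icc 0 L) then 𝒯.globalFn g h else 0

theorem Mesh.lift_of {L : ℝ} {N : ℕ} (𝒯 : Mesh L N) {g : ℝ → ℝ} (h : ContinuousOn g (Icc 0 L)) :
    𝒯.lift g = 𝒯.globalFn g h := dif_pos h

/-- `K` bounds the error of the Gauss–Radau projections on the mesh `𝒯`. -/
def RadauBound {L : ℝ} {N : ℕ} (𝒯 : Mesh L N) (k : ℕ) (K : ℝ) : Prop :=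
  ∀ (w : ℕ → ℝ → ℝ) (hc : ContinuousOn (w 0) (Icc 0 L)),
    (∀ j < k + 1, IsPrimitive L (w j) (w (j + 1))) →
    IntervalIntegrable (fun x => w (k + 1) x ^ 2) volume 0 L → ∀ B : ℝ, 0 ≤ B →
    ∫ x in (0 : ℝ)..L, w (k + 1) x ^ 2 ≤ B ^ 2 →
    ‖𝒯.polyFn (radauRight 𝒯 k (w 0)) - 𝒯.globalFn (w 0) hc‖ ≤ K * 𝒯.size ^ (k + 1) * B ∧
    ‖𝒯.polyFn (radauLeft 𝒯 k (w 0)) - 𝒯.globalFn (w 0) hc‖ ≤ K * 𝒯.size ^ (k + 1) * B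

variable {α lam κ L T : ℝ} {k : ℕ} {f u : ℝ → ℝ → ℝ} {d : ℝ → ℕ → ℝ → ℝ} {ψ : ℝ → ℝ → ℝ} {K : ℝ}
  {N : ℕ} {𝒯 : Mesh L N}

/-- Error of the projection of `u(·, t)`, weighted by `e^{λt}`. -/
noncomputable def projError (𝒯 : Mesh L N) (k : ℕ) (lam : ℝ) (u : ℝ → ℝ → ℝ) (t : ℝ) : 𝒯.contFn :=
  Real.exp (lam * t) • (𝒯.polyFn (radauRight 𝒯 k fun x => u x t) - 𝒯.lift fun x => u x t)

theorem intervalIntegrable_sq (hL : 0 ≤ L) {g : ℝ → ℝ} (hg : MemLp g 2 (domainMeasure L)) :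
    IntervalIntegrable (fun x => g x ^ 2) volume 0 L :=
  (intervalIntegrable_iff_integrableOn_Ioc_of_le hL).mpr hg.integrable_sq

theorem RegularSolution.norm_projError_le (hL : 0 ≤ L)
    (R : RegularSolution α lam κ L T k f u d ψ K) {Kp : ℝ} (hKp : RadauBound 𝒯 k Kp) {t : ℝ}
    (ht : t ∈ Icc 0 T) : ‖projError 𝒯 k lam u t‖ ≤ Kp * 𝒯.size ^ (k + 1) * K := by
  have hc := R.continuousOn hL ht
  have hc' : ContinuousOn (fun x => Real.exp (lam * t) * d t 0 x) (Icc 0 L) := by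
    rw [R.zero t ht]; exact continuousOn_const.mul hc
  have h := (hKp (fun j x => Real.exp (lam * t) * d t j x) hc'
    (fun j hj => (R.prim t ht j (by omega)).smul _)
    (intervalIntegrable_sq hL ((R.memLp t ht (k + 1) (by omega)).const_mul _)) K R.nonneg
    (R.bound t ht (k + 1) (by omega))).1
  rw [polyFn_radauRight_const_mul] at h
  simp only [R.zero t ht] at h
  convert h using 2
  rw [projError, smul_sub, 𝒯.lift_of hc]
  congr 1

/-- By linearity the increment is the projection error of an increment of `e^{λt} u`, which gains
the factor `|s - t|`. -/
theorem RegularSolution.norm_projError_sub_le (hL : 0 ≤ L)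
    (R : RegularSolution α lam κ L T k f u d ψ K) {Kp : ℝ} (hKp : RadauBound 𝒯 k Kp) {s t : ℝ}
    (hs : s ∈ Icc 0 T) (ht : t ∈ Icc 0 T) :
    ‖projError 𝒯 k lam u s - projError 𝒯 k lam u t‖ ≤ Kp * 𝒯.size ^ (k + 1) * (K * |s - t|) := by
  have hcs := R.continuousOn hL hs
  have hct := R.continuousOn hL ht
  have hc' : ContinuousOn (fun x => Real.exp (lam * s) * d s 0 x - Real.exp (lam * t) * d t 0 x)
      (Icc 0 L) := by
    rw [R.zero t ht, R.zero s hs]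
    exact (continuousOn_const.mul hcs).sub (continuousOn_const.mul hct)
  have h := (hKp (fun j x => Real.exp (lam * s) * d s j x - Real.exp (lam * t) * d t j x) hc'
    (fun j hj => ((R.prim s hs j (by omega)).smul _).sub ((R.prim t ht j (by omega)).smul _))
    (intervalIntegrable_sq hL (((R.memLp s hs (k + 1) (by omega)).const_mul _).sub
      ((R.memLp t ht (k + 1) (by omega)).const_mul _)))
    (K * |s - t|) (mul_nonneg R.nonneg (abs_nonneg _)) (R.lipschitz s hs t ht (k + 1) (by omega))).1
  have e := polyFn_radauRight_comb 𝒯 (k := k) hcs hct (Real.exp (lam * s)) (Real.exp (lam * t))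
  simp only [R.zero s hs, R.zero t ht] at h
  rw [e] at h
  convert h using 2
  rw [projError, projError, smul_sub, smul_sub, 𝒯.lift_of hcs, 𝒯.lift_of hct, sub_sub_sub_comm]
  congr 1

/-- The chain of derivatives starts at order one here, so order `k + 2` is reached. -/
theorem RegularSolution.norm_flux_projError_le (hL : 0 ≤ L)
    (R : RegularSolution α lam κ L T k f u d ψ K) {Kp : ℝ} (hKp : RadauBound 𝒯 k Kp) {t : ℝ}
    (ht : t ∈ Icc 0 T) :
    ‖Real.exp (lam * t) • (𝒯.polyFn (radauLeft 𝒯 k (d t 1)) - 𝒯.lift (d t 1))‖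
      ≤ Kp * 𝒯.size ^ (k + 1) * K := by
  have hc : ContinuousOn (d t 1) (Icc 0 L) := (R.prim t ht 1 (by omega)).continuousOn hL
  have h := (hKp (fun j x => Real.exp (lam * t) * d t (j + 1) x) (continuousOn_const.mul hc)
    (fun j hj => (R.prim t ht (j + 1) (by omega)).smul _)
    (intervalIntegrable_sq hL ((R.memLp t ht (k + 1 + 1) (by omega)).const_mul _)) K R.nonneg
    (R.bound t ht (k + 1 + 1) (by omega))).2
  rw [polyFn_radauLeft_const_mul] at h
  convert h using 2
  rw [smul_sub, 𝒯.lift_of hc]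
  congr 1

/-- Summation by parts leaves increments of size `O(τ h^{k+1})` and the projection error at time
`0`; both come out proportional to `glSum α n`, as stability requires. -/
theorem RegularSolution.norm_sum_projError_le (hα : 0 < α) (hα' : α < 1) (hL : 0 ≤ L)
    (R : RegularSolution α lam κ L T k f u d ψ K) {Kp : ℝ} (hKp0 : 0 ≤ Kp)
    (hKp : RadauBound 𝒯 k Kp) {τ : ℝ} (hτ : 0 ≤ τ) (n : ℕ) (hn : ((n : ℝ) + 1) * τ ≤ T) :
    ‖∑ i ∈ Finset.range (n + 1), glWeight α i • projError 𝒯 k lam u ((n + 1 - i : ℕ) * τ)‖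
      ≤ glSum α n * (Kp * K * (T / (1 - α) + 1) * 𝒯.size ^ (k + 1)) := by
  have hmem : ∀ m ≤ n + 1, (m : ℝ) * τ ∈ Icc 0 T := fun m hm => by
    have : (m : ℝ) ≤ n + 1 := by exact_mod_cast hm
    exact ⟨by positivity, (mul_le_mul_of_nonneg_right this hτ).trans hn⟩
  have hK := R.nonneg
  have hsz := 𝒯.size_nonneg
  have h1α : 0 < 1 - α := by linarith
  have hg := glSum_pos hα' n
  rw [sum_glWeight_smul α (fun m : ℕ => projError 𝒯 k lam u (m * τ)) n]
  set P := Kp * 𝒯.size ^ (k + 1) with hP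
  have hP0 : 0 ≤ P := by positivity
  calc _ ≤ ‖∑ j ∈ Finset.range (n + 1), glSum α j • (projError 𝒯 k lam u ((n + 1 - j : ℕ) * τ)
          - projError 𝒯 k lam u ((n - j : ℕ) * τ))‖
          + ‖glSum α n • projError 𝒯 k lam u ((0 : ℕ) * τ)‖ := norm_add_le _ _
    _ ≤ (∑ j ∈ Finset.range (n + 1), glSum α j * (P * (K * τ))) + glSum α n * (P * K) := by
        refine add_le_add ((norm_sum_le _ _).trans (Finset.sum_le_sum fun j hj => ?_)) ?_
        · have hj' := Finset.mem_range.mp hj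
          rw [norm_smul, Real.norm_eq_abs, abs_of_pos (glSum_pos hα' j)]
          have hb := R.norm_projError_sub_le hL hKp (hmem (n + 1 - j) (by omega))
            (hmem (n - j) (by omega))
          have e : |((n + 1 - j : ℕ) : ℝ) * τ - ((n - j : ℕ) : ℝ) * τ| = τ := by
            rw [show n + 1 - j = n - j + 1 by omega]
            push_cast
            rw [← sub_mul, add_sub_cancel_left, one_mul, abs_of_nonneg hτ]
          rw [e] at hb
          have := glSum_pos hα' j
          gcongr
        · rw [norm_smul, Real.norm_eq_abs, abs_of_pos hg]
          have := R.norm_projError_le hL hKp (hmem 0 (by omega))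
          gcongr
    _ ≤ ((n + 1) * glSum α n / (1 - α)) * (P * (K * τ)) + glSum α n * (P * K) := by
        rw [← Finset.sum_mul]
        have := sum_glSum_le_mul hα hα' n
        gcongr
    _ = glSum α n * (P * K * (((n + 1) * τ) / (1 - α) + 1)) := by ring
    _ ≤ glSum α n * (P * K * (T / (1 - α) + 1)) := by gcongr
    _ = _ := by rw [hP]; ring

/-- The discretization error against the projection, weighted by `e^{λt}`. -/
noncomputable def discError (𝒯 : Mesh L N) (k : ℕ) (lam τ : ℝ) (u : ℝ → ℝ → ℝ)
    (uh : ℕ → Fin N → ℝ[X]) (m : ℕ) : 𝒯.contFn :=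
  Real.exp (lam * (m * τ)) • 𝒯.polyFn ((radauRight 𝒯 k fun x => u x (m * τ)) - uh m)

/-- The weighted truncation error. -/
noncomputable def truncFn (α lam : ℝ) (u : ℝ → ℝ → ℝ) (τ : ℝ) (n : ℕ) (x : ℝ) : ℝ :=
  glApprox α lam (u x) τ n - Real.exp (lam * ((n + 1) * τ)) * caputoTempered α lam (u x) ((n + 1) * τ)

theorem innerProd_polyFn (v w : Fin N → ℝ[X]) :
    𝒯.innerProd (cellFun v) (cellFun w) = inner ℝ (𝒯.polyFn v) (𝒯.polyFn w) := rfl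

theorem innerProd_globalFn {g : ℝ → ℝ} (hg : ContinuousOn g (Icc 0 L)) (w : Fin N → ℝ[X]) :
    𝒯.innerProd (fun _ => g) (cellFun w) = inner ℝ (𝒯.lift g) (𝒯.polyFn w) := by
  rw [𝒯.lift_of hg]; rfl

/-- The scheme times `e^{λt}` is subtracted from the exact equation. Projection errors disappear
from the spatial term of this equation and remain only in the convolution. -/
theorem error_equation (hα : 0 < α) (hα' : α < 1) (hL : 0 < L) (hT : 0 < T)
    (R : RegularSolution α lam κ L T k f u d ψ K) {u₀ : ℝ → ℝ}
    (hu₀ : ∀ x ∈ Ioo 0 L, u x 0 = u₀ x) {M : ℕ} {uh ph : ℕ → Fin N → ℝ[X]}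
    (S : IsLDGSolution α lam κ T f u₀ k 𝒯 M uh ph) {τ : ℝ} (hτM : τ = T / M) {n : ℕ} (hn : n < M)
    {v : Fin N → ℝ[X]} (hv : v ∈ dgSpace N k) :
    inner ℝ (∑ i ∈ Finset.range (n + 1), glWeight α i • discError 𝒯 k lam τ u uh (n + 1 - i))
        (𝒯.polyFn v)
      + κ * τ ^ α * Real.exp (lam * ((n + 1) * τ))
          * formPlus 𝒯 (radauLeft 𝒯 k (d ((n + 1) * τ) 1) - ph (n + 1)) v
      = inner ℝ (∑ i ∈ Finset.range (n + 1),
            glWeight α i • projError 𝒯 k lam u ((n + 1 - i : ℕ) * τ)) (𝒯.polyFn v)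
        + τ ^ α * inner ℝ (𝒯.lift (truncFn α lam u τ n)) (𝒯.polyFn v) := by
  have hM : (0 : ℝ) < M := by exact_mod_cast (by omega : 0 < M)
  have hτ : 0 < τ := by rw [hτM]; positivity
  have hτα : τ ^ α * τ ^ (-α) = 1 := by rw [← Real.rpow_add hτ]; simp
  have hmem : ∀ m ≤ n + 1, (m : ℝ) * τ ∈ Icc 0 T := fun m hm => by
    have h1 : (m : ℝ) ≤ M := by exact_mod_cast (by omega : m ≤ M)
    refine ⟨by positivity, ?_⟩
    calc (m : ℝ) * τ ≤ M * τ := by gcongr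
      _ = T := by rw [hτM]; field_simp
  set t : ℝ := (n + 1) * τ with ht
  have htm : t ∈ Icc 0 T := by simpa [ht] using hmem (n + 1) le_rfl
  have ht0 : t ∈ Ioc 0 T := ⟨by positivity, htm.2⟩
  set E := Real.exp (lam * t) with hE
  set e := 𝒯.polyFn v with he
  have hcapc := R.caputo_continuousOn hα hα' hL.le ht0
  have h0 : (0 : ℝ) ∈ Icc 0 T := ⟨le_rfl, hT.le⟩
  have hVc : ∀ m ≤ n + 1, ContinuousOn (fun x => u x (m * τ)) (Icc 0 L) :=
    fun m hm => R.continuousOn hL.le (hmem m hm)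
  have hu0c := R.continuousOn hL.le h0
  have hρc : ContinuousOn (truncFn α lam u τ n) (Icc 0 L) :=
    (R.glApprox_continuousOn hL.le hτ.le n htm.2).sub (continuousOn_const.mul hcapc)
  obtain ⟨g, hg, hgeq⟩ := R.equation t ht0
  -- the flux term
  have hF : formPlus 𝒯 (radauLeft 𝒯 k (d t 1) - ph (n + 1)) v
      = - 𝒯.innerProd (fun _ => g) (cellFun v) - formPlus 𝒯 (ph (n + 1)) v := by
    rw [formPlus_sub, formPlus_radauLeft 𝒯 hL.le hg (R.periodic t htm 1 (by omega)) hv]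
  -- the scheme, multiplied by the exponential weight
  have hinit : inner ℝ (𝒯.polyFn (uh 0)) e = inner ℝ (𝒯.lift fun x => u x 0) e := by
    rw [← innerProd_polyFn, S.initial v hv, ← innerProd_globalFn hu0c]
    refine innerProd_congr_ae 𝒯 ?_ _
    rw [domainMeasure, ← restrict_Ioo_eq_restrict_Ioc]
    exact (ae_restrict_iff' measurableSet_Ioo).mpr
      (Filter.Eventually.of_forall fun x hx => (hu₀ x hx).symm)
  -- The force is eliminated through the differential equation, which holds almost everywhere.
  have hforce : 𝒯.innerProd (fun _ x => f x t) (cellFun v)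
      = inner ℝ (𝒯.lift fun x => caputoTempered α lam (u x) t) e
        - κ * 𝒯.innerProd (fun _ => g) (cellFun v) := by
    rw [← innerProd_globalFn hcapc, ← innerProd_sub_const_mul 𝒯 v hcapc hg.1]
    refine innerProd_congr_ae 𝒯 ?_ _
    filter_upwards [hgeq] with x hx
    rw [hx]; ring
  have hS := S.evolution_eq (n + 1) (by omega) (by omega) v hv
  rw [← hτM] at hS
  have hcast : (((n + 1 : ℕ) : ℝ)) * τ = t := by rw [ht]; push_cast; ring
  simp only [innerProd_polyFn, hcast] at hS
  rw [hforce, ← he, hinit] at hS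
  have hexp : ∀ i ≤ n, E * Real.exp (-lam * (i * τ)) = Real.exp (lam * ((n + 1 - i : ℕ) * τ)) := by
    intro i hi
    rw [hE, ← Real.exp_add, Nat.cast_sub (by omega), ht]
    congr 1
    push_cast
    ring
  have hscheme : ∑ i ∈ Finset.range (n + 1), glWeight α i * Real.exp (lam * ((n + 1 - i : ℕ) * τ))
        * inner ℝ (𝒯.polyFn (uh (n + 1 - i))) e
      = glSum α n * inner ℝ (𝒯.lift fun x => u x 0) e
        + E * τ ^ α * (inner ℝ (𝒯.lift fun x => caputoTempered α lam (u x) t) e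
          - κ * 𝒯.innerProd (fun _ => g) (cellFun v))
        - κ * τ ^ α * E * formPlus 𝒯 (ph (n + 1)) v := by
    have e1 : ∑ i ∈ Finset.range (n + 1), glWeight α i * Real.exp (lam * ((n + 1 - i : ℕ) * τ))
        * inner ℝ (𝒯.polyFn (uh (n + 1 - i))) e
        = E * (glWeight α 0 * inner ℝ (𝒯.polyFn (uh (n + 1))) e
          + ∑ i ∈ Finset.Ico 1 (n + 1), Real.exp (-lam * (i * τ)) * glWeight α i
              * inner ℝ (𝒯.polyFn (uh (n + 1 - i))) e) := by
      rw [Finset.range_eq_Ico, Finset.sum_eq_sum_Ico_succ_bot (by omega), mul_add, Finset.mul_sum]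
      congr 1
      · rw [← hexp 0 (by omega)]; simp; ring
      · refine Finset.sum_congr rfl fun i hi => ?_
        rw [← hexp i (by have := Finset.mem_Ico.mp hi; omega)]; ring
    have e2 : E * Real.exp (-lam * t) = 1 := by
      rw [hE, ← Real.exp_add]; simp
    rw [e1, glSum]
    linear_combination E * hS
      + (∑ i ∈ Finset.range (n + 1), glWeight α i) * inner ℝ (𝒯.lift fun x => u x 0) e * e2
  -- the truncation error
  have hρ : τ ^ α • 𝒯.lift (truncFn α lam u τ n)
      = ∑ i ∈ Finset.range (n + 1), (glWeight α i * Real.exp (lam * ((n + 1 - i : ℕ) * τ)))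
          • 𝒯.lift (fun x => u x ((n + 1 - i : ℕ) * τ))
        - glSum α n • (𝒯.lift fun x => u x 0)
        - (τ ^ α * E) • 𝒯.lift (fun x => caputoTempered α lam (u x) t) := by
    ext j x
    rw [𝒯.lift_of hρc, 𝒯.lift_of hu0c, 𝒯.lift_of hcapc]
    have e2 : ((∑ i ∈ Finset.range (n + 1),
        (glWeight α i * Real.exp (lam * ((n + 1 - i : ℕ) * τ)))
          • 𝒯.lift (fun x => u x ((n + 1 - i : ℕ) * τ)) : 𝒯.contFn) : Fin N → ℝ → ℝ) j x
        = ∑ i ∈ Finset.range (n + 1), glWeight α i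
          * (Real.exp (lam * ((n + 1 - i : ℕ) * τ)) * u x ((n + 1 - i : ℕ) * τ)) := by
      rw [Submodule.coe_sum, Finset.sum_apply, Finset.sum_apply]
      refine Finset.sum_congr rfl fun i _ => ?_
      rw [𝒯.lift_of (hVc (n + 1 - i) (by omega))]
      change _ * _ * u x _ = _
      ring
    change τ ^ α * truncFn α lam u τ n x = _ - glSum α n * u x 0
      - τ ^ α * E * caputoTempered α lam (u x) t
    rw [e2, truncFn, glApprox]
    linear_combination (∑ i ∈ Finset.range (n + 1), glWeight α i
          * (Real.exp (lam * ((n + 1 - i : ℕ) * τ)) * u x ((n + 1 - i : ℕ) * τ))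
          - glSum α n * u x 0) * hτα
  rw [← real_inner_smul_left, hρ, inner_sub_left, inner_sub_left, sum_inner, sum_inner, sum_inner,
    hF]
  simp only [real_inner_smul_left, discError, projError, map_sub, inner_sub_left]
  have hsplit : ∑ i ∈ Finset.range (n + 1), glWeight α i * (Real.exp (lam * ((n + 1 - i : ℕ) * τ))
        * (inner ℝ (𝒯.polyFn (radauRight 𝒯 k fun x => u x ((n + 1 - i : ℕ) * τ))) e
          - inner ℝ (𝒯.polyFn (uh (n + 1 - i))) e))
      = ∑ i ∈ Finset.range (n + 1), glWeight α i * (Real.exp (lam * ((n + 1 - i : ℕ) * τ))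
        * (inner ℝ (𝒯.polyFn (radauRight 𝒯 k fun x => u x ((n + 1 - i : ℕ) * τ))) e
          - inner ℝ (𝒯.lift fun x => u x ((n + 1 - i : ℕ) * τ)) e))
        + ∑ i ∈ Finset.range (n + 1), glWeight α i * Real.exp (lam * ((n + 1 - i : ℕ) * τ))
          * inner ℝ (𝒯.lift fun x => u x ((n + 1 - i : ℕ) * τ)) e
        - ∑ i ∈ Finset.range (n + 1), glWeight α i * Real.exp (lam * ((n + 1 - i : ℕ) * τ))
          * inner ℝ (𝒯.polyFn (uh (n + 1 - i))) e := by
    rw [← Finset.sum_add_distrib, ← Finset.sum_sub_distrib]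
    exact Finset.sum_congr rfl fun i _ => by ring
  rw [hsplit, hscheme]
  ring

/-- The error equation is tested with the error `ξ` of `u`, the flux equation with the error `ζ` of
the flux. -/
theorem energy_inequality (hα : 0 < α) (hα' : α < 1) (hκ : 0 < κ) (hL : 0 < L) (hT : 0 < T)
    (R : RegularSolution α lam κ L T k f u d ψ K) {u₀ : ℝ → ℝ}
    (hu₀ : ∀ x ∈ Ioo 0 L, u x 0 = u₀ x) {M : ℕ} {uh ph : ℕ → Fin N → ℝ[X]}
    (S : IsLDGSolution α lam κ T f u₀ k 𝒯 M uh ph) {τ : ℝ} (hτM : τ = T / M) {n : ℕ} (hn : n < M) :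
    ∑ i ∈ Finset.range (n + 1), glWeight α i * inner ℝ (discError 𝒯 k lam τ u uh (n + 1 - i))
        (discError 𝒯 k lam τ u uh (n + 1))
      ≤ (‖∑ i ∈ Finset.range (n + 1), glWeight α i • projError 𝒯 k lam u ((n + 1 - i : ℕ) * τ)‖
          + τ ^ α * ‖𝒯.lift (truncFn α lam u τ n)‖) * ‖discError 𝒯 k lam τ u uh (n + 1)‖
        + κ * τ ^ α / 4 * ‖Real.exp (lam * ((n + 1) * τ))
            • (𝒯.polyFn (radauLeft 𝒯 k (d ((n + 1) * τ) 1)) - 𝒯.lift (d ((n + 1) * τ) 1))‖ ^ 2 := by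
  have hM : (0 : ℝ) < M := by exact_mod_cast (by omega : 0 < M)
  have hτ : 0 < τ := by rw [hτM]; positivity
  have hn1 : ((n : ℝ) + 1) ≤ M := by exact_mod_cast hn
  have htm : ((n : ℝ) + 1) * τ ∈ Icc 0 T := by
    refine ⟨by positivity, ?_⟩
    calc ((n : ℝ) + 1) * τ ≤ M * τ := by gcongr
      _ = T := by rw [hτM]; field_simp
  have hcast : (((n + 1 : ℕ) : ℝ)) * τ = (n + 1) * τ := by push_cast; ring
  set ξ := (radauRight 𝒯 k fun x => u x ((n + 1 : ℕ) * τ)) - uh (n + 1) with hξ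
  have hξmem : ξ ∈ dgSpace N k := dgSpace_sub (radauRight_mem 𝒯 _) (S.mem_u _ (by omega))
  have heq := error_equation hα hα' hL hT R hu₀ S hτM hn hξmem
  set t : ℝ := (n + 1) * τ with ht
  set E := Real.exp (lam * t) with hE
  have hE0 : 0 < E := Real.exp_pos _
  have hΞ : discError 𝒯 k lam τ u uh (n + 1) = E • 𝒯.polyFn ξ := by
    rw [hξ, discError, hcast]
  set Ξ := discError 𝒯 k lam τ u uh (n + 1) with hΞd
  set ζ := radauLeft 𝒯 k (d t 1) - ph (n + 1) with hζ
  have hζmem : ζ ∈ dgSpace N k :=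
    dgSpace_sub (radauLeft_mem 𝒯 _) (S.mem_p _ (by omega) (by omega))
  set P := 𝒯.polyFn (radauLeft 𝒯 k (d t 1)) - 𝒯.lift (d t 1) with hP
  have hprim := R.prim t htm 0 (by omega)
  rw [R.zero t htm] at hprim
  have hper := R.periodic t htm 0 (by omega)
  rw [R.zero t htm] at hper
  have hd1c : ContinuousOn (d t 1) (Icc 0 L) := (R.prim t htm 1 (by omega)).continuousOn hL.le
  -- Adjointness moves the form onto `ξ`, where the flux equation turns it into `‖ζ‖²` up to the
  -- projection error `P` of `u_x`.
  have hflux : formPlus 𝒯 ζ ξ = inner ℝ (𝒯.polyFn ζ) (𝒯.polyFn ζ) - inner ℝ P (𝒯.polyFn ζ) := by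
    have h1 := formPlus_add_formMinus 𝒯 ζ ξ
    have h2 : formMinus 𝒯 ξ ζ = - inner ℝ (𝒯.lift (d t 1)) (𝒯.polyFn ζ)
        + inner ℝ (𝒯.polyFn (ph (n + 1))) (𝒯.polyFn ζ) := by
      have h3 := S.flux_eq (n + 1) (by omega) (by omega) ζ hζmem
      rw [hξ, formMinus_sub, hcast, formMinus_radauRight 𝒯 hL.le hprim hper hζmem,
        ← innerProd_globalFn hd1c, ← innerProd_polyFn]
      linear_combination -h3
    have h4 : inner ℝ (𝒯.polyFn ζ) (𝒯.polyFn ζ)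
        = inner ℝ (𝒯.polyFn (radauLeft 𝒯 k (d t 1))) (𝒯.polyFn ζ)
          - inner ℝ (𝒯.polyFn (ph (n + 1))) (𝒯.polyFn ζ) := by
      rw [← inner_sub_left, ← map_sub]
    have h5 : inner ℝ P (𝒯.polyFn ζ) = inner ℝ (𝒯.polyFn (radauLeft 𝒯 k (d t 1))) (𝒯.polyFn ζ)
        - inner ℝ (𝒯.lift (d t 1)) (𝒯.polyFn ζ) := by rw [hP, inner_sub_left]
    linear_combination h1 - h2 - h4 + h5
  -- Completing the square in `‖ζ‖² - ‖P‖ ‖ζ‖`.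
  have hlow : -(‖P‖ ^ 2 / 4) ≤ formPlus 𝒯 ζ ξ := by
    rw [hflux, real_inner_self_eq_norm_sq]
    have := real_inner_le_norm P (𝒯.polyFn ζ)
    nlinarith [sq_nonneg (‖P‖ / 2 - ‖𝒯.polyFn ζ‖)]
  set A := ∑ i ∈ Finset.range (n + 1), glWeight α i • projError 𝒯 k lam u ((n + 1 - i : ℕ) * τ)
  set ρ := 𝒯.lift (truncFn α lam u τ n)
  have hsum : ∑ i ∈ Finset.range (n + 1), glWeight α i * inner ℝ (discError 𝒯 k lam τ u uh (n + 1 - i)) Ξ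
      = inner ℝ A Ξ + τ ^ α * inner ℝ ρ Ξ - κ * τ ^ α * E ^ 2 * formPlus 𝒯 ζ ξ := by
    have e1 : ∑ i ∈ Finset.range (n + 1),
        glWeight α i * inner ℝ (discError 𝒯 k lam τ u uh (n + 1 - i)) Ξ
        = inner ℝ (∑ i ∈ Finset.range (n + 1),
          glWeight α i • discError 𝒯 k lam τ u uh (n + 1 - i)) Ξ := by
      rw [sum_inner]
      exact Finset.sum_congr rfl fun i _ => (real_inner_smul_left _ _ _).symm
    rw [e1, hΞ, real_inner_smul_right, real_inner_smul_right, real_inner_smul_right]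
    linear_combination E * heq
  rw [hsum]
  have hτα : 0 < τ ^ α := by positivity
  have h1 := real_inner_le_norm A Ξ
  have h2 : τ ^ α * inner ℝ ρ Ξ ≤ τ ^ α * (‖ρ‖ * ‖Ξ‖) := by
    have := real_inner_le_norm ρ Ξ
    gcongr
  have h3 : κ * τ ^ α * E ^ 2 * (-(‖P‖ ^ 2 / 4)) ≤ κ * τ ^ α * E ^ 2 * formPlus 𝒯 ζ ξ := by
    gcongr
  have h4 : ‖E • P‖ ^ 2 = E ^ 2 * ‖P‖ ^ 2 := by
    rw [norm_smul, Real.norm_eq_abs, abs_of_pos hE0, mul_pow]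
  rw [h4]
  nlinarith [h1, h2, h3]

end ErrorEquation

end TemperedLDG

/-! ### The error estimate. -/

theorem mainTheorem5 (α lam κ L T : ℝ) (hα : 0 < α) (hα' : α < 1) (hlam : 0 ≤ lam)
    (hκ : 0 < κ) (hL : 0 < L) (hT : 0 < T) (k : ℕ)
    (f : ℝ → ℝ → ℝ) (u₀ : ℝ → ℝ) (u : ℝ → ℝ → ℝ)
    (hu : TemperedLDG.IsExactSolution α lam κ L T f u₀ u)
    (hreg : TemperedLDG.TimeSobolevRegular L T 2 (k + 2) u) :
    ∃ C : ℝ, 0 < C ∧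
      ∀ (N : ℕ) (𝒯 : TemperedLDG.Mesh L N) (M : ℕ) (uh ph : ℕ → Fin N → Polynomial ℝ),
        TemperedLDG.IsLDGSolution α lam κ T f u₀ k 𝒯 M uh ph →
        ∀ n : ℕ, 1 ≤ n → n ≤ M →
          𝒯.l2norm (fun j x => u x (n * (T / M)) - (uh n j).eval x)
            ≤ C * (T / M + 𝒯.size ^ (k + 1)) := by
  open TemperedLDG in
  obtain ⟨d, ψ, K, R⟩ := exists_regularSolution hL hT hu hreg
  obtain ⟨Kp, hKp0, hKp⟩ := exists_radau_norm_bound k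
  have hK := R.nonneg
  have h1α : 0 < 1 - α := by linarith
  set G := Real.Gamma (1 - α)
  have hG : 0 < G := Real.Gamma_pos_of_pos h1α
  have hG2 : 0 < Real.Gamma (2 - α) := Real.Gamma_pos_of_pos (by linarith)
  set c₀ := truncConst α T K
  have hc₀ : 0 ≤ c₀ := by simp only [c₀, truncConst]; positivity
  -- `c₁` collects the projection and truncation errors, linear in the error norm; `c₂` collects the
  -- flux projection error, which enters squared.
  set c₁ := Kp * K * (T / (1 - α) + 1) + √L * c₀ * G
  set c₂ := κ * T ^ α * G / 4 * (Kp * K) ^ 2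
  have hc₁ : 0 ≤ c₁ := by positivity
  have hc₂ : 0 ≤ c₂ := by positivity
  -- `c₁ + c₂ + 1` is the stability level relative to `τ + h^{k+1}`; `Kp * K` is the projection
  -- error of `u`.
  refine ⟨c₁ + c₂ + 1 + Kp * K, by positivity, fun N 𝒯 M uh ph S n hn1 hnM => ?_⟩
  have hM : (0 : ℝ) < M := by exact_mod_cast (by omega : 0 < M)
  set τ := T / M with hτM
  have hτ : 0 < τ := by positivity
  have hsz := 𝒯.size_nonneg
  set η := 𝒯.size ^ (k + 1) with hη
  have hη0 : 0 ≤ η := by positivity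
  set ε := τ + η
  have hε : 0 < ε := by positivity
  have hτε : τ ≤ ε := by simp only [ε]; linarith
  have hηε : η ≤ ε := by simp only [ε]; linarith
  have hB : RadauBound 𝒯 k Kp := hKp 𝒯
  have hmem : ∀ m ≤ M, (m : ℝ) * τ ∈ Set.Icc 0 T := fun m hm => by
    have h1 : (m : ℝ) ≤ M := by exact_mod_cast hm
    refine ⟨by positivity, ?_⟩
    calc (m : ℝ) * τ ≤ M * τ := by gcongr
      _ = T := by rw [hτM]; field_simp
  have hstab := norm_le_of_glWeight (E := 𝒯.contFn) hα hα' (A := c₁ * ε) (B := c₂ * ε ^ 2)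
    (X := (c₁ + c₂ + 1) * ε) (by positivity) (by positivity)
    (by
      have : 0 ≤ ε ^ 2 * (c₁ * (c₂ + 1) + c₂ * (c₂ + c₁ + 1) + 1) := by positivity
      nlinarith [this]) (discError 𝒯 k lam τ u uh) M (fun m hm => by
        have hg := glSum_pos hα' m
        have htm : ((m : ℝ) + 1) * τ ∈ Set.Icc 0 T := by simpa using hmem (m + 1) hm
        have ht0 : 0 < ((m : ℝ) + 1) * τ := by positivity
        refine (energy_inequality hα hα' hκ hL hT R hu.initial S hτM hm).trans ?_
        -- The powers of `τ` cancel and leave `(m+1)^{-α}`: the singular truncation error becomes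
        -- admissible for stability.
        have hτα : τ ^ α * (((m : ℝ) + 1) * τ) ^ (-α) ≤ G * glSum α m := by
          refine le_trans (le_of_eq ?_) (rpow_le_glSum hα hα' m)
          rw [Real.mul_rpow (by positivity) hτ.le, mul_left_comm, ← Real.rpow_add hτ]
          simp
        have hτα' : τ ^ α ≤ G * glSum α m * T ^ α := by
          calc τ ^ α = τ ^ α * (((m : ℝ) + 1) * τ) ^ (-α) * (((m : ℝ) + 1) * τ) ^ α := by
                rw [mul_assoc, ← Real.rpow_add ht0]; simp
            _ ≤ G * glSum α m * T ^ α := by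
                have := htm.2
                gcongr
        have b1 := R.norm_sum_projError_le hα hα' hL.le hKp0.le hB hτ.le m htm.2
        have b2 : τ ^ α * ‖𝒯.lift (truncFn α lam u τ m)‖
            ≤ glSum α m * (√L * c₀ * G * τ) := by
          have hρc : ContinuousOn (truncFn α lam u τ m) (Set.Icc 0 L) :=
            (R.glApprox_continuousOn hL.le hτ.le m htm.2).sub
              (continuousOn_const.mul (R.caputo_continuousOn hα hα' hL.le ⟨ht0, htm.2⟩))
          have h1 := 𝒯.globalFn_norm_le hL.le hρc
            (C := c₀ * (τ * (((m : ℝ) + 1) * τ) ^ (-α))) fun x hx => by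
              rw [truncFn, abs_sub_comm]
              exact R.truncation hα hα' hx hτ m htm.2
          rw [𝒯.lift_of hρc]
          calc _ ≤ τ ^ α * (√L * (c₀ * (τ * (((m : ℝ) + 1) * τ) ^ (-α)))) := by gcongr
            _ = √L * c₀ * τ * (τ ^ α * (((m : ℝ) + 1) * τ) ^ (-α)) := by ring
            _ ≤ √L * c₀ * τ * (G * glSum α m) := by gcongr
            _ = _ := by ring
        have b3 := R.norm_flux_projError_le hL.le hB htm
        have b12 : ‖∑ i ∈ Finset.range (m + 1),
              glWeight α i • projError 𝒯 k lam u ((m + 1 - i : ℕ) * τ)‖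
            + τ ^ α * ‖𝒯.lift (truncFn α lam u τ m)‖ ≤ glSum α m * (c₁ * ε) := by
          refine (add_le_add b1 b2).trans ?_
          rw [← mul_add]
          have h1 : Kp * K * (T / (1 - α) + 1) * η ≤ Kp * K * (T / (1 - α) + 1) * ε := by gcongr
          have h2 : √L * c₀ * G * τ ≤ √L * c₀ * G * ε := by gcongr
          have h3 : c₁ * ε = Kp * K * (T / (1 - α) + 1) * ε + √L * c₀ * G * ε := by
            simp only [c₁]; ring
          rw [h3]
          gcongr
        have b4 : κ * τ ^ α / 4 * ‖Real.exp (lam * ((m + 1) * τ))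
            • (𝒯.polyFn (radauLeft 𝒯 k (d ((m + 1) * τ) 1)) - 𝒯.lift (d ((m + 1) * τ) 1))‖ ^ 2
            ≤ glSum α m * (c₂ * ε ^ 2) := by
          calc _ ≤ κ * (G * glSum α m * T ^ α) / 4 * (Kp * ε * K) ^ 2 := by
                have h5 : Kp * 𝒯.size ^ (k + 1) * K ≤ Kp * ε * K := by rw [← hη]; gcongr
                have h6 := b3.trans h5
                gcongr
            _ = _ := by simp only [c₂]; ring
        exact (add_le_add (mul_le_mul_of_nonneg_right b12 (norm_nonneg _)) b4).trans_eq (by ring))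
  have hΞ := hstab (n - 1) (by omega)
  rw [Nat.sub_add_cancel hn1] at hΞ
  have hH := R.norm_projError_le hL.le hB (hmem n hnM)
  have hc := R.continuousOn hL.le (hmem n hnM)
  set E := Real.exp (lam * (n * τ)) with hE
  have hE1 : 1 ≤ E := Real.one_le_exp (by positivity)
  have hnorm : 𝒯.l2norm (fun j x => u x (n * τ) - (uh n j).eval x)
      = ‖𝒯.lift (fun x => u x (n * τ)) - 𝒯.polyFn (uh n)‖ := by
    rw [𝒯.lift_of hc]; rfl
  have hsplit : E • (𝒯.lift (fun x => u x (n * τ)) - 𝒯.polyFn (uh n))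
      = discError 𝒯 k lam τ u uh n - projError 𝒯 k lam u (n * τ) := by
    rw [discError, projError, ← hE, ← smul_sub, map_sub]
    congr 1
    abel
  -- The exponential weight is at least `1` because `λ ≥ 0`, so it can be dropped.
  have hle : ‖𝒯.lift (fun x => u x (n * τ)) - 𝒯.polyFn (uh n)‖
      ≤ ‖E • (𝒯.lift (fun x => u x (n * τ)) - 𝒯.polyFn (uh n))‖ := by
    rw [norm_smul, Real.norm_eq_abs, abs_of_pos (by linarith)]
    exact le_mul_of_one_le_left (norm_nonneg _) hE1
  rw [hnorm]
  refine hle.trans ?_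
  rw [hsplit]
  refine (norm_sub_le _ _).trans ((add_le_add hΞ hH).trans ?_)
  have : Kp * η * K ≤ Kp * ε * K := by gcongr
  nlinarith [this]
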